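/- Let $0<\alpha<\theta<\tfrac12$. There is $\nu>0$, depending only on $\alpha$ and $\theta$, such that the following holds. **Kernel.** Let $W:(0,\infty)^2\to\mathbb R$ be symmetric, homogeneous of degree $0$, with $0\le W(x,y)\le (x/y)^\alpha+(y/x)^\alpha$, and let $W(\cdot,1)$ have an analytic extension to $\mathbb C\setminus(-\infty,0]$ (again denoted $W(\cdot,1)$) with $\operatorname{Re}W(\xi,1)\ge 0$ for $\operatorname{Re}\xi\ge 0$, $\xi\neq0$, and $|W(\xi,1)|\le c(|\xi|^{-\alpha}+|\xi|^\alpha)$ for some $c$. Assume that the restrictions $W_\pm$ of $W(\cdot,1)$ to $\{\pm\operatorname{Im}\xi>0\}$ have differentiable extensions to $\{\pm\operatorname{Im}\xi\ge0\}\setminus\{0\}$ with, for some $c$ and $\gamma>0$, $|W_\pm(z)|\le c(|z|^{-\alpha}+|z|^{\alpha})$, $|W_\pm'(z)|\le c(|z|^{-\alpha-1}+|z|^{\alpha-1})$ and, whenever $|z_1-z_2|\le \frac12 r$ with $r=\min\{|z_1|,|z_2|\}$, $|W_\pm'(z_1)-W_\pm'(z_2)|\le c\,|z_1-z_2|^\gamma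 r^{-\alpha-1-\gamma}$ if $r\le1$ and $\le c\,|z_1-z_2|^\gamma r^{\alpha-1-\gamma}$ if $r>1$. Assume finally that for some $C_W>0$, $\xi^\alpha W(\xi,1)\to C_W$ as $\xi\to0$ in $\mathbb C\setminus(-\infty,0]$ (uniformly in $\arg \xi$). **Profiles.** For $\varepsilon>0$ let $K=2+\varepsilon W$, and let $f\ge0$ be a self-similar profile of finite mass for $K$: $f\in L^1_{\rm loc}([0,\infty))$, $\int_0^\infty xf(x)\,dx<\infty$ and $$x^2f(x)=\int_0^x\int_{x-y}^\infty yK(y,z)f(y)f(z)\,dz\,dy\quad\text{for a.e. }x>0,$$ normalized such that $f(x)=e^{-xa(x)}$ for large $x$ with $a(x)\to1$ as $x\to\infty$. Put $\mu(x)=f(x)e^{x}$. **The functions $H_0$ and $Q_0$.** Let $\kappa=2\int_0^\infty\mu(z)e^{-z}dz-2$ and, for $x\in\mathbb C\setminus(-\infty,0]$, $$\beta_W(x)=\int_0^\infty W(x/z,1)\mu(z)e^{-z}\,dz,\qquad \Phi(x)=\varepsilon\int_x^{\infty}\frac{\beta_W(t)}{t}e^{-t}\,dt,$$ the last integral along the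 horizontal ray $x+(0,\infty)$. For $p>0$ and $\operatorname{Re}y\ge0$, $y\ne0$, let, with integration along the segment from $0$ to $y$, $$H_0(y,p)=\frac{2+\kappa}{py(1+y)}\int_0^y e^{-px}x\Big(\frac xy\Big)^{\kappa}\frac{e^{\Phi(y)}}{e^{\Phi(x)}}\,dx-\frac{1}{py(1+y)}\int_0^y e^{-px}\Phi'(x)x^2\Big(\frac xy\Big)^{\kappa}\frac{e^{\Phi(y)}}{e^{\Phi(x)}}\,dx .$$ The inverse Laplace transform $Q_0(\cdot,p)\in L^2(\mathbb R)$ of $H_0(\cdot,p)$ is $$Q_0(\xi,p)=\frac1{2\pi i}\lim_{R\to\infty}\int_{-iR}^{iR}H_0(y,p)e^{y\xi}\,dy ,$$ the limit being taken in $L^2(\mathbb R)$, where $t\mapsto H_0(it,p)$ is in $L^2(\mathbb R)$. **Claim.** For every such $W$ there are $\varepsilon_0>0$ and $C>0$ such that for all $\varepsilon\in(0,\varepsilon_0)$ and all such profiles $f$, the function $Q_0(\cdot,p)$ exists for every $p>0$ and satisfies $$\int_0^\infty\frac{|Q_0(\xi,p)|}{(1+\xi)^{2\theta-\nu}}\,d\xi\le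 C\,\frac{(1+p)^{1-\theta}}{p^3}\qquad\text{for all }p>0,$$ the integral on the left being finite. In particular $C$ does not depend on $\varepsilon$, $f$ and $p$. -/

import Mathlib

open MeasureTheory Set Filter Topology

noncomputable section

namespace SelfSim

/-- `w` restricted to the open half-plane `{σ * Im > 0}` (`σ = 1`: upper, `σ = -1`: lower) has a
`C^{1,γ}` extension `wb`, with derivative `wb'`, to the closed half-plane without the origin, with
a local Hölder bound on the derivative and growth bounds on the function and on its derivative. -/
def HasHalfPlaneExtension (α σ : ℝ) (w : ℂ → ℂ) : Prop :=
  ∃ (wb wb' : ℂ → ℂ) (γ C : ℝ), 0 < γ ∧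
    EqOn wb w {z | 0 < σ * z.im} ∧
    (∀ z ∈ {z : ℂ | 0 ≤ σ * z.im ∧ z ≠ 0},
      HasDerivWithinAt wb (wb' z) {z : ℂ | 0 ≤ σ * z.im ∧ z ≠ 0} z) ∧
    (∀ z₁ ∈ {z : ℂ | 0 ≤ σ * z.im ∧ z ≠ 0}, ∀ z₂ ∈ {z : ℂ | 0 ≤ σ * z.im ∧ z ≠ 0},
      ‖z₁ - z₂‖ ≤ min ‖z₁‖ ‖z₂‖ / 2 →
        ‖wb' z₁ - wb' z₂‖ ≤ C * ‖z₁ - z₂‖ ^ γ *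
          (if min ‖z₁‖ ‖z₂‖ ≤ 1 then (min ‖z₁‖ ‖z₂‖) ^ (-α - 1 - γ)
            else (min ‖z₁‖ ‖z₂‖) ^ (α - 1 - γ))) ∧
    (∀ z ∈ {z : ℂ | 0 ≤ σ * z.im ∧ z ≠ 0}, ‖wb z‖ ≤ C * (‖z‖ ^ (-α) + ‖z‖ ^ α)) ∧
    (∀ z ∈ {z : ℂ | 0 ≤ σ * z.im ∧ z ≠ 0},
      ‖wb' z‖ ≤ C * (‖z‖ ^ (-α - 1) + ‖z‖ ^ (α - 1)))

/-- The assumptions on the perturbation `W` of the constant kernel, where `w` is the analytic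
extension of `W(·, 1)` to `ℂ \ (-∞, 0]`. -/
structure IsAdmissibleKernel (α : ℝ) (W : ℝ → ℝ → ℝ) (w : ℂ → ℂ) : Prop where
  symmetric : ∀ x y, 0 < x → 0 < y → W x y = W y x
  homogeneous : ∀ l x y, 0 < l → 0 < x → 0 < y → W (l * x) (l * y) = W x y
  nonneg : ∀ x y, 0 < x → 0 < y → 0 ≤ W x y
  le_powers : ∀ x y, 0 < x → 0 < y → W x y ≤ (x / y) ^ α + (y / x) ^ α
  extends_W : ∀ x : ℝ, 0 < x → w x = W x 1
  analytic : DifferentiableOn ℂ w Complex.slitPlane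
  re_nonneg : ∀ ξ ∈ Complex.slitPlane, 0 ≤ ξ.re → 0 ≤ (w ξ).re
  growth : ∃ C : ℝ, ∀ ξ ∈ Complex.slitPlane, ‖w ξ‖ ≤ C * (1 / ‖ξ‖ ^ α + ‖ξ‖ ^ α)
  upper : HasHalfPlaneExtension α 1 w
  lower : HasHalfPlaneExtension α (-1) w
  /-- `w ξ ∼ C_W ξ ^ (-α)` as `ξ → 0`, uniformly in the argument of `ξ`. -/
  asymptotics : ∃ C_W : ℝ, 0 < C_W ∧
    Tendsto (fun ξ : ℂ => ξ ^ (α : ℂ) * w ξ) (𝓝[Complex.slitPlane] 0) (𝓝 (C_W : ℂ))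

/-- `f` is a self-similar profile of finite mass for the kernel `K = 2 + ε W`, rescaled such that
`f(x) = exp (-x a(x))` with `a(x) → 1` as `x → ∞`. All integrands in the equation are
non-negative, so its right-hand side is written as an integral with values in `[0, ∞]`; the
function `f` is understood up to null sets, also in the limit. -/
structure IsNormalizedProfile (ε : ℝ) (W : ℝ → ℝ → ℝ) (f : ℝ → ℝ) : Prop where
  locallyIntegrable : LocallyIntegrableOn f (Ici 0)
  nonneg : ∀ᵐ x ∂volume.restrict (Ioi (0 : ℝ)), 0 ≤ f x
  finite_mass : IntegrableOn (fun x => x * f x) (Ioi 0)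
  equation : ∀ᵐ x ∂volume.restrict (Ioi (0 : ℝ)),
    ENNReal.ofReal (x ^ 2 * f x) =
      ∫⁻ y in Ioo 0 x, ∫⁻ z in Ioi (x - y),
        ENNReal.ofReal (y * (2 + ε * W y z) * f y * f z)
  decay : Tendsto (fun x => -Real.log (f x) / x) (atTop ⊓ ae volume) (𝓝 1)

/-- `μ(x) = f(x) e^x`. -/
def muOf (f : ℝ → ℝ) (x : ℝ) : ℝ := f x * Real.exp x

/-- `κ = β₂(μ) - 2` with `β₂(μ) = ∫₀^∞ 2 μ(z) e^{-z} dz`. -/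
def kappa (μ : ℝ → ℝ) : ℝ := (∫ z in Ioi (0 : ℝ), 2 * μ z * Real.exp (-z)) - 2

/-- The analytic extension of `β_W(y; μ) = ∫₀^∞ W(y, z) μ(z) e^{-z} dz` to `ℂ \ (-∞, 0]`; by
homogeneity `W(y, z) = W(y / z, 1)`. -/
def betaW (w : ℂ → ℂ) (μ : ℝ → ℝ) (y : ℂ) : ℂ :=
  ∫ z in Ioi (0 : ℝ), w (y / z) * μ z * Real.exp (-z)

/-- `Φ(x; μ) = ε ∫_x^∞ β_W(t; μ) / t * e^{-t} dt`, the path being the horizontal ray `x + (0, ∞)`. -/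
def Phi (ε : ℝ) (w : ℂ → ℂ) (μ : ℝ → ℝ) (x : ℂ) : ℂ :=
  ε * ∫ s in Ioi (0 : ℝ), betaW w μ (x + s) / (x + s) * Complex.exp (-(x + s))

/-- The path integral `∫_0^y F(x) dx` over the segment from `0` to `y`. -/
def segmentIntegral (F : ℂ → ℂ) (y : ℂ) : ℂ := ∫ s in (0 : ℝ)..1, F (s * y) * y

/-- `(2 + κ) / (p y (1 + y)) ∫_0^y e^{-px} x (x/y)^κ e^{Φ(y)} / e^{Φ(x)} dx`, for `Re y ≥ 0`. -/
def H01 (ε : ℝ) (w : ℂ → ℂ) (μ : ℝ → ℝ) (p : ℝ) (y : ℂ) : ℂ :=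
  (2 + kappa μ) / (p * y * (1 + y)) *
    segmentIntegral (fun x => Complex.exp (-p * x) * x * (x / y) ^ (kappa μ : ℂ) *
      (Complex.exp (Phi ε w μ y) / Complex.exp (Phi ε w μ x))) y

/-- `-1 / (p y (1 + y)) ∫_0^y e^{-px} Φ'(x) x² (x/y)^κ e^{Φ(y)} / e^{Φ(x)} dx`, for `Re y ≥ 0`. -/
def H02 (ε : ℝ) (w : ℂ → ℂ) (μ : ℝ → ℝ) (p : ℝ) (y : ℂ) : ℂ :=
  -(1 / (p * y * (1 + y))) *
    segmentIntegral (fun x => Complex.exp (-p * x) * deriv (Phi ε w μ) x * x ^ 2 *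
      (x / y) ^ (kappa μ : ℂ) *
      (Complex.exp (Phi ε w μ y) / Complex.exp (Phi ε w μ x))) y

def H0 (ε : ℝ) (w : ℂ → ℂ) (μ : ℝ → ℝ) (p : ℝ) (y : ℂ) : ℂ :=
  H01 ε w μ p y + H02 ε w μ p y

/-- `(1 / 2πi) ∫_{-iR}^{iR} F(y) e^{yξ} dy`. -/
def truncatedInverseLaplace (F : ℂ → ℂ) (R ξ : ℝ) : ℂ :=
  1 / (2 * Real.pi * Complex.I) *
    ∫ t in (-R)..R, F (t * Complex.I) * Complex.exp (t * Complex.I * ξ) * Complex.I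

/-- `Q ∈ L²(ℝ)` is the inverse Laplace transform of `F`: the boundary function `t ↦ F(it)` is
square integrable and `Q(ξ) = (1 / 2πi) lim_{R → ∞} ∫_{-iR}^{iR} F(y) e^{yξ} dy` in `L²(ℝ)`. -/
structure IsInverseLaplace (F : ℂ → ℂ) (Q : ℝ → ℂ) : Prop where
  boundary_memLp : MemLp (fun t : ℝ => F (t * Complex.I)) 2 volume
  memLp : MemLp Q 2 volume
  tendsto : Tendsto
    (fun R : ℝ => eLpNorm (fun ξ => truncatedInverseLaplace F R ξ - Q ξ) 2 volume) atTop (𝓝 0)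

end SelfSim

end

/-! On the imaginary axis `H0` is, up to factors 1/p, a superposition over s in (0, 1) of
oscillations e^{-ipst}, with amplitudes B(st) e^{Φ(it) - Φ(ist)} / (1 + it). If J and tJ' are
bounded by |t|^{-a} + |t|^{-b}, then all truncated inverse transforms of J are bounded by |ξ|^{a-1}
+ |ξ|^{b-1} (`IsOscillatoryAmplitude.norm_integral_le`). The oscillation translates this bound by
ps, and integrating |ξ - P|^{a-1} against (1 + ξ)^{-σ} gives (1 + P)^{a-σ}
(`exists_lintegral_weight_le`). Decay in p therefore has two sources: this translation, and
integration by parts in s, which gains a factor 1/p each time (`kernelTransform_mul_I`).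

Integrating by parts differentiates the phase and so multiplies B by b = εβ_W, which may be as large
as ε|t|^{-α} at the origin. What saves the estimate is damping. Near the origin Re b is at least
cε|t|^{-α} on the imaginary axis, up to a harmless error, so that |e^{Φ(it) - Φ(ist)}| is at most a
constant times exp(-c(1-s)A) with A = ε(s|t|)^{-α} (`IsRate.isPhase`). This cancels every power of A
for s ≤ 1/2. For s near 1 it removes almost one power of |t|^{-α}, at the price of the integrable
factor (1-s)^{-(1-η)} (`weight_pow_le_of_le_one`). Terms of order two in b thus behave almost like
|t|^{-α} and terms of order three almost like |t|^{-2α}. The former still leave the decay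
(1+p)^{-θ}; the latter leave none, but they appear only after three gains of 1/p
(`kernelTransform_expansion`), and |t|^{-2α} is admissible because 2α < 2θ - ν.

All constants must be uniform in ε and f. The properties of f that matter are ν((0, ∞)) between 7/8
and 1 for ν = f dx, a bounded first moment, enough mass away from 0, and a bounded moment of order
-α. They come from testing the symmetrized equation: with powers, which compares the moments with
those of the constant kernel and bounds the first moment above and below by the normalization at
infinity; with 1 - e^{-qx}, which gives an approximate Riccati equation and hence the mass
(`IsProfileMeasure.bernstein_lower`); and with a truncated negative power
(`IsProfileMeasure.neg_moment_truncated`). `IsAdmissibleKernel.exists_isRate` collects the result.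

Square integrability of the boundary function gives existence by Plancherel, and bounds that hold
for all truncations pass to the limit along an almost everywhere convergent subsequence. -/

noncomputable section

/-! ### Profiles as measures, and the symmetrized weak equation. -/

namespace SelfSim

/-- The measure `f(x) dx` on `(0, ∞)` of a normalized profile, for the kernel
`2 + ε v(y / z)`. -/
structure IsProfileMeasure (ε : ℝ) (v : ℝ → ℝ) (ν : Measure ℝ) : Prop where
  finite : IsFiniteMeasure ν
  pos : ∀ᵐ x ∂ν, 0 < x
  eps_pos : 0 < ε
  measurable_v : Measurable v
  v_nonneg : ∀ r, 0 < r → 0 ≤ v r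
  v_le : ∀ r, 0 < r → v r ≤ 2 + r + r⁻¹
  v_inv : ∀ r, 0 < r → v r⁻¹ = v r
  equation : ∀ φ : ℝ → ENNReal, Measurable φ →
    ∫⁻ x, ENNReal.ofReal (x ^ 2) * φ x ∂ν =
      ∫⁻ y, ∫⁻ z, ENNReal.ofReal (y * (2 + ε * v (y / z))) *
        (∫⁻ x in Ioo y (y + z), φ x) ∂ν ∂ν
  -- The normalization at infinity enters only through this field and the next; the rates 1/2 and 3
  -- merely lie on either side of 1.
  exp_integrable : Integrable (fun x => Real.exp (x / 2)) ν
  exp_not_integrable : ¬ Integrable (fun x => Real.exp (3 * x)) ν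

lemma lintegral_Ioo_of_hasDerivAt {Ψ φ : ℝ → ℝ} (hΨ : ∀ x, 0 < x → HasDerivAt Ψ (φ x) x)
    (hφ : ∀ x, 0 < x → 0 ≤ φ x) {y z : ℝ} (hy : 0 < y) (hyz : y ≤ z) :
    ∫⁻ x in Ioo y z, ENNReal.ofReal (φ x) = ENNReal.ofReal (Ψ z - Ψ y) := by
  have hcont : ContinuousOn Ψ (Icc y z) := fun x hx =>
    (hΨ x (hy.trans_le hx.1)).continuousAt.continuousWithinAt
  have hd : ∀ x ∈ Ioo y z, HasDerivAt Ψ (φ x) x := fun x hx => hΨ x (hy.trans hx.1)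
  have hi : IntegrableOn φ (Ioc y z) :=
    intervalIntegral.integrableOn_deriv_of_nonneg hcont hd
      (fun x hx => hφ x (hy.trans hx.1))
  have h1 := intervalIntegral.integral_eq_sub_of_hasDerivAt_of_le hyz hcont hd
    ((intervalIntegrable_iff_integrableOn_Ioc_of_le hyz).2 hi)
  rw [← h1, intervalIntegral.integral_of_le hyz,
    ofReal_integral_eq_lintegral_ofReal hi
      ((ae_restrict_mem measurableSet_Ioc).mono fun x hx => hφ x (hy.trans hx.1))]
  exact setLIntegral_congr Ioo_ae_eq_Ioc

namespace IsProfileMeasure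

variable {ε : ℝ} {v : ℝ → ℝ} {ν : Measure ℝ}

lemma ae_prod_pos (h : IsProfileMeasure ε v ν) : ∀ᵐ p ∂(ν.prod ν), 0 < p.1 ∧ 0 < p.2 := by
  have := h.finite
  have h1 : ∀ᵐ p ∂(ν.prod ν), 0 < p.1 := Measure.quasiMeasurePreserving_fst.ae h.pos
  have h2 : ∀ᵐ p ∂(ν.prod ν), 0 < p.2 := Measure.quasiMeasurePreserving_snd.ae h.pos
  filter_upwards [h1, h2] with p a b using ⟨a, b⟩

lemma equation_real (h : IsProfileMeasure ε v ν) {Ψ φ : ℝ → ℝ}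
    (hΨ : ∀ x, 0 < x → HasDerivAt Ψ (φ x) x) (hφ : ∀ x, 0 < x → 0 ≤ φ x)
    (hφm : Measurable φ) (hΨm : Measurable Ψ) :
    ∫⁻ x, ENNReal.ofReal (x ^ 2 * φ x) ∂ν =
      ∫⁻ p, ENNReal.ofReal ((2 + ε * v (p.1 / p.2)) * (p.1 * (Ψ (p.1 + p.2) - Ψ p.1)))
        ∂(ν.prod ν) := by
  have := h.finite
  have hv := h.measurable_v
  have e0 := h.equation (fun x => ENNReal.ofReal (φ x)) hφm.ennreal_ofReal
  have e1 : ∫⁻ x, ENNReal.ofReal (x ^ 2 * φ x) ∂ν =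
      ∫⁻ x, ENNReal.ofReal (x ^ 2) * ENNReal.ofReal (φ x) ∂ν :=
    lintegral_congr fun x => ENNReal.ofReal_mul (sq_nonneg x)
  rw [e1, e0, lintegral_prod _ (by fun_prop)]
  refine lintegral_congr_ae ?_
  filter_upwards [h.pos] with y hy
  refine lintegral_congr_ae ?_
  filter_upwards [h.pos] with z hz
  rw [lintegral_Ioo_of_hasDerivAt hΨ hφ hy (by linarith), ← ENNReal.ofReal_mul]
  · congr 1; ring
  · have := h.v_nonneg (y / z) (by positivity)
    have := h.eps_pos
    positivity

/-- The symmetrized weak formulation. -/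
lemma weak_identity (h : IsProfileMeasure ε v ν) {Ψ φ : ℝ → ℝ} {G : ℝ → ℝ → ℝ}
    (hΨ : ∀ x, 0 < x → HasDerivAt Ψ (φ x) x) (hφ : ∀ x, 0 < x → 0 ≤ φ x)
    (hφm : Measurable φ) (hΨm : Measurable Ψ)
    (hint : Integrable (fun x => x ^ 2 * φ x) ν)
    (hG : ∀ y z, 0 < y → 0 < z → y * (Ψ (y + z) - Ψ y) + z * (Ψ (y + z) - Ψ z) = G y z) :
    Integrable (fun p : ℝ × ℝ => (2 + ε * v (p.1 / p.2)) * G p.1 p.2) (ν.prod ν) ∧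
    ∫ p, (2 + ε * v (p.1 / p.2)) * G p.1 p.2 ∂(ν.prod ν) = 2 * ∫ x, x ^ 2 * φ x ∂ν := by
  have := h.finite
  have hv := h.measurable_v
  have hεp := h.eps_pos
  have mono : ∀ y z, 0 < y → 0 < z → 0 ≤ Ψ (y + z) - Ψ y := by
    intro y z hy hz
    have : MonotoneOn Ψ (Ioi 0) := by
      apply monotoneOn_of_deriv_nonneg (convex_Ioi 0)
      · exact fun x hx => (hΨ x hx).continuousAt.continuousWithinAt
      · exact fun x hx => (hΨ x (by simpa using hx)).differentiableAt.differentiableWithinAt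
      · intro x hx
        rw [interior_Ioi] at hx
        rw [(hΨ x hx).deriv]; exact hφ x hx
    have := this (mem_Ioi.2 hy) (mem_Ioi.2 (by linarith : 0 < y + z)) (by linarith)
    linarith
  have e1 := h.equation_real hΨ hφ hφm hΨm
  -- Exchanging the two variables changes neither the product measure nor, by `v_inv`, the kernel.
  have e2 : ∫⁻ x, ENNReal.ofReal (x ^ 2 * φ x) ∂ν =
      ∫⁻ p, ENNReal.ofReal ((2 + ε * v (p.1 / p.2)) * (p.2 * (Ψ (p.1 + p.2) - Ψ p.2)))
        ∂(ν.prod ν) := by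
    rw [e1, ← lintegral_prod_swap]
    refine lintegral_congr_ae ?_
    filter_upwards [h.ae_prod_pos] with p hp
    simp only [Prod.fst_swap, Prod.snd_swap]
    rw [← h.v_inv (p.2 / p.1) (div_pos hp.2 hp.1), inv_div, add_comm p.2 p.1]
  -- Adding both forms: with g(x) = xΨ(x) the integrand is the kernel times g(y+z) - g(y) - g(z).
  -- The mass, moment and Laplace identities below are choices of g.
  have key : ∫⁻ p, ENNReal.ofReal ((2 + ε * v (p.1 / p.2)) * G p.1 p.2) ∂(ν.prod ν) =
      2 * ∫⁻ x, ENNReal.ofReal (x ^ 2 * φ x) ∂ν := by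
    rw [two_mul]
    nth_rewrite 1 [e1]
    rw [e2, ← lintegral_add_left (by fun_prop)]
    refine lintegral_congr_ae ?_
    filter_upwards [h.ae_prod_pos] with p hp
    have := h.v_nonneg (p.1 / p.2) (div_pos hp.1 hp.2)
    have h1 := mono p.1 p.2 hp.1 hp.2
    have h2 := mono p.2 p.1 hp.2 hp.1
    rw [add_comm p.2 p.1] at h2
    have := hp.1; have := hp.2
    rw [← ENNReal.ofReal_add (by positivity) (by positivity), ← hG _ _ hp.1 hp.2]
    congr 1; ring
  have nn : 0 ≤ᵐ[ν.prod ν] fun p : ℝ × ℝ => (2 + ε * v (p.1 / p.2)) * G p.1 p.2 := by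
    filter_upwards [h.ae_prod_pos] with p hp
    have := h.v_nonneg (p.1 / p.2) (div_pos hp.1 hp.2)
    have h1 := mono p.1 p.2 hp.1 hp.2
    have h2 := mono p.2 p.1 hp.2 hp.1
    rw [add_comm p.2 p.1] at h2
    have := hp.1; have := hp.2
    show 0 ≤ (2 + ε * v (p.1 / p.2)) * G p.1 p.2
    rw [← hG _ _ hp.1 hp.2]
    positivity
  have nn' : 0 ≤ᵐ[ν] fun x => x ^ 2 * φ x := by
    filter_upwards [h.pos] with x hx
    exact mul_nonneg (sq_nonneg x) (hφ x hx)
  have hm : AEStronglyMeasurable (fun p : ℝ × ℝ => (2 + ε * v (p.1 / p.2)) * G p.1 p.2)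
      (ν.prod ν) := by
    have : Measurable fun p : ℝ × ℝ => (2 + ε * v (p.1 / p.2)) *
        (p.1 * (Ψ (p.1 + p.2) - Ψ p.1) + p.2 * (Ψ (p.1 + p.2) - Ψ p.2)) := by fun_prop
    refine this.aestronglyMeasurable.congr ?_
    filter_upwards [h.ae_prod_pos] with p hp
    rw [hG _ _ hp.1 hp.2]
  constructor
  · refine ⟨hm, ?_⟩
    rw [hasFiniteIntegral_iff_ofReal nn, key]
    exact ENNReal.mul_lt_top (by simp) ((hasFiniteIntegral_iff_ofReal nn').1 hint.2)
  · rw [integral_eq_lintegral_of_nonneg_ae nn hm, key,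
      integral_eq_lintegral_of_nonneg_ae nn' hint.1, ENNReal.toReal_mul]
    simp

lemma integrable_pow (h : IsProfileMeasure ε v ν) (n : ℕ) : Integrable (fun x => x ^ n) ν := by
  refine ((h.exp_integrable.const_mul ((n.factorial : ℝ) * 2 ^ n))).mono'
    (by fun_prop) ?_
  filter_upwards [h.pos] with x hx
  rw [Real.norm_of_nonneg (by positivity)]
  have := Real.pow_div_factorial_le_exp (x / 2) (by positivity) n
  rw [div_pow, div_div, div_le_iff₀ (by positivity)] at this
  linarith

end IsProfileMeasure

end SelfSim
end

/-! ### Moments: upper and lower bounds for the first moment. -/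

noncomputable section

namespace SelfSim

/-- Binomial theorem divided by (n+2)!, without its two extreme terms; this is g(y+z) - g(y) - g(z)
for g(x) = x^{n+2}/(n+2)!. -/
lemma sum_antidiagonal_shift_eq (y z : ℝ) (n : ℕ) :
    (y + z) ^ (n + 2) / (n + 2).factorial - y ^ (n + 2) / (n + 2).factorial -
      z ^ (n + 2) / (n + 2).factorial =
    ∑ p ∈ Finset.HasAntidiagonal.antidiagonal n, (y ^ (p.1 + 1) / (p.1 + 1).factorial) *
      (z ^ (p.2 + 1) / (p.2 + 1).factorial) := by
  have e : (y + z) ^ (n + 2) / (n + 2).factorial = ∑ p ∈ Finset.HasAntidiagonal.antidiagonal (n + 2),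
      (y ^ p.1 / p.1.factorial) * (z ^ p.2 / p.2.factorial) := by
    rw [(Commute.all y z).add_pow', Finset.sum_div]
    refine Finset.sum_congr rfl fun p hp => ?_
    rw [Finset.HasAntidiagonal.mem_antidiagonal] at hp
    have := Nat.add_choose_mul_factorial_mul_factorial p.1 p.2
    rw [← hp, nsmul_eq_mul, ← this, Nat.choose_symm_add]
    have h1 := Nat.factorial_ne_zero p.1
    have h2 := Nat.factorial_ne_zero p.2
    have h3 : (p.1 + p.2).choose p.2 ≠ 0 := (Nat.choose_pos (by omega)).ne'
    push_cast
    field_simp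
  rw [e, Finset.Nat.antidiagonal_succ, Finset.sum_cons, Finset.sum_map,
    Finset.Nat.antidiagonal_succ', Finset.sum_cons, Finset.sum_map]
  simp
  ring

/-- The triangle i + j < N lies in the square i, j < N, and the terms are nonnegative. -/
lemma sum_range_sum_antidiagonal_le {f : ℕ → ℝ} (hf : ∀ i, 0 ≤ f i) (N : ℕ) :
    ∑ k ∈ Finset.range N, ∑ p ∈ Finset.HasAntidiagonal.antidiagonal k, f p.1 * f p.2 ≤
      (∑ i ∈ Finset.range N, f i) ^ 2 := by
  rw [sq, Finset.sum_mul_sum, ← Finset.sum_product']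
  have : ∀ k ∈ Finset.range N, Finset.HasAntidiagonal.antidiagonal k =
      (Finset.range N ×ˢ Finset.range N).filter (fun p => p.1 + p.2 = k) := by
    intro k hk
    ext ⟨a, b⟩
    simp at hk ⊢
    omega
  rw [Finset.sum_congr rfl fun k hk => by rw [this k hk],
    Finset.sum_fiberwise_eq_sum_filter]
  exact Finset.sum_le_sum_of_subset_of_nonneg (Finset.filter_subset _ _)
    fun p _ _ => mul_nonneg (hf _) (hf _)

/-- Normalized moments. -/
def normMoment (ν : Measure ℝ) (k : ℕ) : ℝ := ∫ x, x ^ k / k.factorial ∂ν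

namespace IsProfileMeasure

variable {ε : ℝ} {v : ℝ → ℝ} {ν : Measure ℝ}

lemma integrable_pow_div (h : IsProfileMeasure ε v ν) (k : ℕ) :
    Integrable (fun x : ℝ => x ^ k / k.factorial) ν := (h.integrable_pow k).div_const _

lemma normMoment_nonneg (h : IsProfileMeasure ε v ν) (k : ℕ) : 0 ≤ normMoment ν k := by
  refine integral_nonneg_of_ae ?_
  filter_upwards [h.pos] with x hx
  show 0 ≤ x ^ k / k.factorial
  positivity

lemma normMoment_zero (_h : IsProfileMeasure ε v ν) : normMoment ν 0 = ν.real univ := by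
  simp [normMoment]

lemma two_mul_integral_le (h : IsProfileMeasure ε v ν) {G : ℝ → ℝ → ℝ}
    (hG0 : ∀ y z, 0 < y → 0 < z → 0 ≤ G y z)
    (hi : Integrable (fun p : ℝ × ℝ => G p.1 p.2) (ν.prod ν))
    (hK : Integrable (fun p : ℝ × ℝ => (2 + ε * v (p.1 / p.2)) * G p.1 p.2) (ν.prod ν)) :
    2 * ∫ p, G p.1 p.2 ∂(ν.prod ν) ≤
      ∫ p, (2 + ε * v (p.1 / p.2)) * G p.1 p.2 ∂(ν.prod ν) := by
  rw [← integral_const_mul]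
  refine integral_mono_ae (hi.const_mul _) hK ?_
  filter_upwards [h.ae_prod_pos] with p hp
  have h1 := h.v_nonneg (p.1 / p.2) (div_pos hp.1 hp.2)
  have h2 := hG0 _ _ hp.1 hp.2
  have h3 := h.eps_pos
  show 2 * G p.1 p.2 ≤ (2 + ε * v (p.1 / p.2)) * G p.1 p.2
  have : 0 ≤ ε * v (p.1 / p.2) * G p.1 p.2 := by positivity
  linarith

/-- With g = -1 the bracket equals 1, so the kernel integrates to twice the mass M; since the kernel
is at least 2, M² ≤ M. -/
lemma mass_le_one (h : IsProfileMeasure ε v ν) : ν.real univ ≤ 1 := by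
  have := h.finite
  have key := h.weak_identity (Ψ := fun x => -x⁻¹) (φ := fun x => (x ^ 2)⁻¹)
    (G := fun _ _ => 1) (fun x hx => by simpa using (hasDerivAt_inv hx.ne').fun_neg)
    (fun x _ => by positivity) (by fun_prop) (by fun_prop)
    ((integrable_const (1 : ℝ)).congr (by
      filter_upwards [h.pos] with x hx
      field_simp))
    (fun y z hy hz => by field_simp; ring)
  have h1 := h.two_mul_integral_le (G := fun _ _ => 1) (fun _ _ _ _ => zero_le_one)
    (integrable_const _) key.1
  have h2 : ∫ x, x ^ 2 * (x ^ 2)⁻¹ ∂ν = ν.real univ := by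
    have : ∫ x, x ^ 2 * (x ^ 2)⁻¹ ∂ν = ∫ x, (1 : ℝ) ∂ν := by
      refine integral_congr_ae ?_
      filter_upwards [h.pos] with x hx
      field_simp
    simp [this]
  rw [key.2, h2] at h1
  have h3 : ∫ p : ℝ × ℝ, (1 : ℝ) ∂(ν.prod ν) = ν.real univ * ν.real univ := by
    simp [measureReal_def, ← univ_prod_univ, Measure.prod_prod]
  rw [h3] at h1
  have h0 : 0 ≤ ν.real univ := measureReal_nonneg
  by_contra hc
  push Not at hc
  nlinarith

lemma moment_identity (h : IsProfileMeasure ε v ν) (n : ℕ) :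
    Integrable (fun p : ℝ × ℝ => (2 + ε * v (p.1 / p.2)) *
      ∑ q ∈ Finset.HasAntidiagonal.antidiagonal n, (p.1 ^ (q.1 + 1) / (q.1 + 1).factorial) *
      (p.2 ^ (q.2 + 1) / (q.2 + 1).factorial)) (ν.prod ν) ∧
    ∫ p, (2 + ε * v (p.1 / p.2)) *
      ∑ q ∈ Finset.HasAntidiagonal.antidiagonal n, (p.1 ^ (q.1 + 1) / (q.1 + 1).factorial) *
      (p.2 ^ (q.2 + 1) / (q.2 + 1).factorial) ∂(ν.prod ν) =
    2 * ((n + 1) * normMoment ν (n + 2)) := by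
  have key := h.weak_identity (Ψ := fun x => x ^ (n + 1) / (n + 2).factorial)
    (φ := fun x => ((n + 1 : ℕ) : ℝ) * x ^ n / (n + 2).factorial)
    (G := fun y z => ∑ q ∈ Finset.HasAntidiagonal.antidiagonal n, (y ^ (q.1 + 1) / (q.1 + 1).factorial) *
      (z ^ (q.2 + 1) / (q.2 + 1).factorial))
    (fun x _ => (hasDerivAt_pow (n + 1) x).div_const _)
    (fun x hx => by positivity) (by fun_prop) (by fun_prop)
    (((h.integrable_pow_div (n + 2)).const_mul ((n : ℝ) + 1)).congr
      (Eventually.of_forall fun x => by simp only; push_cast; ring))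
    (fun y z hy hz => by rw [← sum_antidiagonal_shift_eq]; ring)
  refine ⟨key.1, key.2.trans ?_⟩
  rw [normMoment]
  simp only [← integral_const_mul]
  refine integral_congr_ae (Eventually.of_forall fun x => ?_)
  simp only
  push_cast; ring

lemma integrable_mul_pow (h : IsProfileMeasure ε v ν) (i j : ℕ) :
    Integrable (fun p : ℝ × ℝ => (p.1 ^ i / i.factorial) * (p.2 ^ j / j.factorial))
      (ν.prod ν) := by
  have := h.finite
  exact (h.integrable_pow_div i).mul_prod (h.integrable_pow_div j)

lemma integral_mul_pow (h : IsProfileMeasure ε v ν) (i j : ℕ) :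
    ∫ p : ℝ × ℝ, (p.1 ^ i / i.factorial) * (p.2 ^ j / j.factorial) ∂(ν.prod ν) =
      normMoment ν i * normMoment ν j := by
  have := h.finite
  exact integral_prod_mul (fun x : ℝ => x ^ i / i.factorial) (fun x : ℝ => x ^ j / j.factorial)

/-- The kernel is at least 2. For the constant kernel 2 equality holds, and its solutions are
geometric sequences in k. -/
lemma sum_le_moment (h : IsProfileMeasure ε v ν) (n : ℕ) :
    ∑ q ∈ Finset.HasAntidiagonal.antidiagonal n, normMoment ν (q.1 + 1) * normMoment ν (q.2 + 1) ≤
      (n + 1) * normMoment ν (n + 2) := by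
  have k := h.moment_identity n
  have k2 := h.two_mul_integral_le (G := fun y z => ∑ q ∈ Finset.HasAntidiagonal.antidiagonal n,
      (y ^ (q.1 + 1) / (q.1 + 1).factorial) * (z ^ (q.2 + 1) / (q.2 + 1).factorial))
    (fun y z hy hz => Finset.sum_nonneg fun q _ => by positivity)
    (integrable_finsetSum _ fun q _ => h.integrable_mul_pow _ _) k.1
  rw [k.2, integral_finsetSum _ fun q _ => h.integrable_mul_pow _ _] at k2
  simp_rw [h.integral_mul_pow] at k2
  linarith

lemma pow_le_normMoment (h : IsProfileMeasure ε v ν) (n : ℕ) :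
    normMoment ν 1 ^ (n + 1) ≤ normMoment ν (n + 1) := by
  induction n using Nat.strong_induction_on with
  | _ n ih =>
    rcases n with _ | n
    · simp
    · have h1 := h.sum_le_moment n
      have h0 := h.normMoment_nonneg
      have h2 : ∑ q ∈ Finset.HasAntidiagonal.antidiagonal n, normMoment ν 1 ^ (n + 2) ≤
          ∑ q ∈ Finset.HasAntidiagonal.antidiagonal n, normMoment ν (q.1 + 1) * normMoment ν (q.2 + 1) := by
        refine Finset.sum_le_sum fun q hq => ?_
        rw [Finset.HasAntidiagonal.mem_antidiagonal] at hq
        have := mul_le_mul (ih q.1 (by omega)) (ih q.2 (by omega))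
          (pow_nonneg (h0 1) _) (h0 _)
        rw [← pow_add] at this
        convert this using 2
        omega
      rw [Finset.sum_const, Finset.Nat.card_antidiagonal, nsmul_eq_mul] at h2
      push_cast at h2
      exact le_of_mul_le_mul_left (h2.trans h1) (by positivity)

/-- Integrability of e^{x/2} forces the k-th normalized moment to be at most a constant times 2^k,
while it dominates the k-th power of the first one. -/
lemma normMoment_one_le (h : IsProfileMeasure ε v ν) : normMoment ν 1 ≤ 2 := by
  by_contra hc
  push Not at hc
  obtain ⟨n, hn⟩ := pow_unbounded_of_one_lt (∫ x, Real.exp (x / 2) ∂ν)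
    (show 1 < normMoment ν 1 / 2 by linarith)
  have h1 : normMoment ν (n + 1) ≤ 2 ^ (n + 1) * ∫ x, Real.exp (x / 2) ∂ν := by
    rw [normMoment, ← integral_const_mul]
    refine integral_mono_ae (h.integrable_pow_div _) (h.exp_integrable.const_mul _) ?_
    filter_upwards [h.pos] with x hx
    have := Real.pow_div_factorial_le_exp (x / 2) (by positivity) (n + 1)
    rw [div_pow, div_right_comm, div_le_iff₀ (by positivity)] at this
    linarith
  have h2 := h.pow_le_normMoment n
  have h3 : (normMoment ν 1 / 2) ^ n ≤ (normMoment ν 1 / 2) ^ (n + 1) :=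
    pow_le_pow_right₀ (by linarith) (by omega)
  have h4 : (normMoment ν 1 / 2) ^ (n + 1) ≤ ∫ x, Real.exp (x / 2) ∂ν := by
    rw [div_pow, div_le_iff₀ (by positivity)]
    linarith
  linarith

/-- The perturbation, bounded by ε(2 + y/z + z/y), shifts one power between the variables. The only
products containing the moment of order n+2 are those with the mass, and these are absorbed for
small ε. Writing S for the sum, the loss of a factor n+1 in front of S is harmless, since only
geometric growth matters. -/
lemma moment_le_sum (h : IsProfileMeasure ε v ν) (hε : ε ≤ 1 / 10) (n : ℕ) :
    normMoment ν (n + 2) ≤ 3 / 2 * ∑ q ∈ Finset.HasAntidiagonal.antidiagonal n,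
      normMoment ν (q.1 + 1) * normMoment ν (q.2 + 1) := by
  have h0 := h.normMoment_nonneg
  have hεp := h.eps_pos
  have hM : normMoment ν 0 ≤ 1 := by rw [h.normMoment_zero]; exact h.mass_le_one
  have k := h.moment_identity n
  set S := ∑ q ∈ Finset.HasAntidiagonal.antidiagonal n, normMoment ν (q.1 + 1) * normMoment ν (q.2 + 1) with hS
  set G : ℝ × ℝ → ℝ := fun p => ∑ q ∈ Finset.HasAntidiagonal.antidiagonal n,
    ((2 + 2 * ε) * ((p.1 ^ (q.1 + 1) / (q.1 + 1).factorial) *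
      (p.2 ^ (q.2 + 1) / (q.2 + 1).factorial)) +
    ε * (((q.1 : ℝ) + 2) * ((p.1 ^ (q.1 + 2) / (q.1 + 2).factorial) *
      (p.2 ^ q.2 / q.2.factorial))) +
    ε * (((q.2 : ℝ) + 2) * ((p.1 ^ q.1 / q.1.factorial) *
      (p.2 ^ (q.2 + 2) / (q.2 + 2).factorial)))) with hG
  have hi : ∀ q : ℕ × ℕ, Integrable (fun p : ℝ × ℝ =>
    ((2 + 2 * ε) * ((p.1 ^ (q.1 + 1) / (q.1 + 1).factorial) *
      (p.2 ^ (q.2 + 1) / (q.2 + 1).factorial)) +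
    ε * (((q.1 : ℝ) + 2) * ((p.1 ^ (q.1 + 2) / (q.1 + 2).factorial) *
      (p.2 ^ q.2 / q.2.factorial))) +
    ε * (((q.2 : ℝ) + 2) * ((p.1 ^ q.1 / q.1.factorial) *
      (p.2 ^ (q.2 + 2) / (q.2 + 2).factorial))))) (ν.prod ν) := fun q =>
    (((h.integrable_mul_pow _ _).const_mul _).add
      (((h.integrable_mul_pow _ _).const_mul _).const_mul _)).add
      (((h.integrable_mul_pow _ _).const_mul _).const_mul _)
  have hle : ∫ p, (2 + ε * v (p.1 / p.2)) *
      ∑ q ∈ Finset.HasAntidiagonal.antidiagonal n, (p.1 ^ (q.1 + 1) / (q.1 + 1).factorial) *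
      (p.2 ^ (q.2 + 1) / (q.2 + 1).factorial) ∂(ν.prod ν) ≤ ∫ p, G p ∂(ν.prod ν) := by
    refine integral_mono_ae k.1 (integrable_finsetSum _ fun q _ => hi q) ?_
    filter_upwards [h.ae_prod_pos] with p hp
    obtain ⟨hy, hz⟩ := hp
    have hv := h.v_le (p.1 / p.2) (div_pos hy hz)
    rw [inv_div] at hv
    simp only [hG]
    rw [Finset.mul_sum]
    refine Finset.sum_le_sum fun q _ => ?_
    generalize p.1 = y at *
    generalize p.2 = z at *
    obtain ⟨i, j⟩ := q
    simp only
    -- One power moves from z to y, which changes the factorials by (i+2)/(j+1); the denominator j+1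
    -- is discarded.
    have e1 : y / z * ((y ^ (i + 1) / (i + 1).factorial) * (z ^ (j + 1) / (j + 1).factorial)) ≤
        ((i : ℝ) + 2) * ((y ^ (i + 2) / (i + 2).factorial) * (z ^ j / j.factorial)) := by
      have : y / z * ((y ^ (i + 1) / (i + 1).factorial) * (z ^ (j + 1) / (j + 1).factorial)) =
          ((i : ℝ) + 2) * ((y ^ (i + 2) / (i + 2).factorial) * (z ^ j / j.factorial)) *
            (1 / (j + 1)) := by
        rw [Nat.factorial_succ (i + 1), Nat.factorial_succ j]
        push_cast
        field_simp
        ring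
      rw [this]
      refine mul_le_of_le_one_right (by positivity) ?_
      rw [div_le_one (by positivity)]
      have : (0 : ℝ) ≤ j := by positivity
      linarith
    have e2 : z / y * ((y ^ (i + 1) / (i + 1).factorial) * (z ^ (j + 1) / (j + 1).factorial)) ≤
        ((j : ℝ) + 2) * ((y ^ i / i.factorial) * (z ^ (j + 2) / (j + 2).factorial)) := by
      have : z / y * ((y ^ (i + 1) / (i + 1).factorial) * (z ^ (j + 1) / (j + 1).factorial)) =
          ((j : ℝ) + 2) * ((y ^ i / i.factorial) * (z ^ (j + 2) / (j + 2).factorial)) *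
            (1 / (i + 1)) := by
        rw [Nat.factorial_succ (j + 1), Nat.factorial_succ i]
        push_cast
        field_simp
        ring
      rw [this]
      refine mul_le_of_le_one_right (by positivity) ?_
      rw [div_le_one (by positivity)]
      have : (0 : ℝ) ≤ i := by positivity
      linarith
    have hT : 0 ≤ (y ^ (i + 1) / (i + 1).factorial) * (z ^ (j + 1) / (j + 1).factorial) := by
      positivity
    set T := (y ^ (i + 1) / (i + 1).factorial) * (z ^ (j + 1) / (j + 1).factorial)
    have e3 : (2 + ε * v (y / z)) * T ≤ (2 + ε * (2 + y / z + z / y)) * T := by gcongr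
    have e4 := mul_le_mul_of_nonneg_left e1 hεp.le
    have e5 := mul_le_mul_of_nonneg_left e2 hεp.le
    linarith
  have hint : ∫ p, G p ∂(ν.prod ν) = (2 + 2 * ε) * S +
      2 * ε * ∑ q ∈ Finset.HasAntidiagonal.antidiagonal n,
        ((q.1 : ℝ) + 2) * (normMoment ν (q.1 + 2) * normMoment ν q.2) := by
    simp only [hG]
    rw [integral_finsetSum _ fun q _ => hi q]
    have : ∀ q : ℕ × ℕ, ∫ p : ℝ × ℝ, ((2 + 2 * ε) * ((p.1 ^ (q.1 + 1) / (q.1 + 1).factorial) *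
      (p.2 ^ (q.2 + 1) / (q.2 + 1).factorial)) +
      ε * (((q.1 : ℝ) + 2) * ((p.1 ^ (q.1 + 2) / (q.1 + 2).factorial) *
        (p.2 ^ q.2 / q.2.factorial))) +
      ε * (((q.2 : ℝ) + 2) * ((p.1 ^ q.1 / q.1.factorial) *
        (p.2 ^ (q.2 + 2) / (q.2 + 2).factorial)))) ∂(ν.prod ν) =
      (2 + 2 * ε) * (normMoment ν (q.1 + 1) * normMoment ν (q.2 + 1)) +
      ε * (((q.1 : ℝ) + 2) * (normMoment ν (q.1 + 2) * normMoment ν q.2)) +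
      ε * (((q.2 : ℝ) + 2) * (normMoment ν q.1 * normMoment ν (q.2 + 2))) := by
      intro q
      rw [integral_add, integral_add, integral_const_mul, integral_const_mul, integral_const_mul,
        integral_const_mul, integral_const_mul, h.integral_mul_pow, h.integral_mul_pow,
        h.integral_mul_pow]
      · exact (h.integrable_mul_pow _ _).const_mul _
      · exact ((h.integrable_mul_pow _ _).const_mul _).const_mul _
      · exact ((h.integrable_mul_pow _ _).const_mul _).add
          (((h.integrable_mul_pow _ _).const_mul _).const_mul _)
      · exact ((h.integrable_mul_pow _ _).const_mul _).const_mul _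
    simp_rw [this]
    rw [Finset.sum_add_distrib, Finset.sum_add_distrib, ← Finset.mul_sum, ← Finset.mul_sum,
      ← Finset.mul_sum]
    have sw : ∑ q ∈ Finset.HasAntidiagonal.antidiagonal n,
        ((q.2 : ℝ) + 2) * (normMoment ν q.1 * normMoment ν (q.2 + 2)) =
        ∑ q ∈ Finset.HasAntidiagonal.antidiagonal n,
        ((q.1 : ℝ) + 2) * (normMoment ν (q.1 + 2) * normMoment ν q.2) := by
      rw [← Finset.Nat.sum_antidiagonal_swap]
      refine Finset.sum_congr rfl fun q _ => ?_
      simp only [Prod.fst_swap, Prod.snd_swap]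
      ring
    rw [sw]
    ring
  -- The term with second index 0 contains the top moment times the mass, which is at most 1, and
  -- n+2 ≤ 2(n+1). The other terms are terms of S with coefficient at most n+1.
  have hsum : ∑ q ∈ Finset.HasAntidiagonal.antidiagonal n,
        ((q.1 : ℝ) + 2) * (normMoment ν (q.1 + 2) * normMoment ν q.2) ≤
      2 * (n + 1) * normMoment ν (n + 2) + (n + 1) * S := by
    rcases n with _ | n
    · simp [hS]
      nlinarith [h0 2, h0 1, mul_nonneg (h0 1) (h0 1)]
    · rw [Finset.Nat.antidiagonal_succ', Finset.sum_cons, Finset.sum_map]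
      refine add_le_add ?_ ?_
      · simp only
        have := h0 (n + 1 + 2)
        push_cast
        have e : ((n : ℝ) + 1 + 2) * (normMoment ν (n + 1 + 2) * normMoment ν 0) ≤
            ((n : ℝ) + 1 + 2) * (normMoment ν (n + 1 + 2) * 1) := by gcongr
        have : (0 : ℝ) ≤ (n + 1) * normMoment ν (n + 1 + 2) := by positivity
        linarith
      · rw [hS, Finset.Nat.antidiagonal_succ, Finset.sum_cons, Finset.sum_map, mul_add,
          Finset.mul_sum]
        refine le_add_of_nonneg_of_le (mul_nonneg (by positivity) (mul_nonneg (h0 _) (h0 _))) ?_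
        refine Finset.sum_le_sum fun q hq => ?_
        rw [Finset.HasAntidiagonal.mem_antidiagonal] at hq
        simp only [Function.Embedding.prodMap, Function.Embedding.coeFn_mk, Prod.map,
          Function.Embedding.refl_apply, Nat.succ_eq_add_one]
        refine mul_le_mul_of_nonneg_right ?_ (mul_nonneg (h0 _) (h0 _))
        have : (q.1 : ℝ) ≤ n := by exact_mod_cast (by omega : q.1 ≤ n)
        push_cast
        linarith
  rw [k.2, hint] at hle
  have hS0 : 0 ≤ S := Finset.sum_nonneg fun q _ => mul_nonneg (h0 _) (h0 _)
  have ha := h0 (n + 2)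
  have hn : (0 : ℝ) ≤ n := by positivity
  set a := normMoment ν (n + 2)
  have e1 : 2 * ε * (∑ q ∈ Finset.HasAntidiagonal.antidiagonal n,
        ((q.1 : ℝ) + 2) * (normMoment ν (q.1 + 2) * normMoment ν q.2)) ≤
      2 * ε * (2 * (n + 1) * a + (n + 1) * S) := by gcongr
  have e2 : 2 * ε * (2 * (n + 1) * a + (n + 1) * S) ≤
      2 * (1 / 10) * (2 * (n + 1) * a + (n + 1) * S) := by gcongr
  have e3 : (2 + 2 * ε) * S ≤ (2 + 2 * (1 / 10)) * S := by gcongr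
  have e4 : 0 ≤ n * S := by positivity
  -- With ε ≤ 1/10: 2 - 4/10 = 8/5 remains on the left and at most 12/5 (n+1)S on the right, whence
  -- the ratio 3/2.
  have e5 : 8 / 5 * ((n + 1 : ℝ) * a) ≤ 8 / 5 * ((n + 1 : ℝ) * (3 / 2 * S)) := by nlinarith
  exact le_of_mul_le_mul_left (le_of_mul_le_mul_left e5 (by norm_num)) (by positivity)

/-- Put x for l times the first moment. The partial sums satisfy G_{N+1} ≤ x + (3/2)G_N², and the
interval [0, 2x] is invariant under this recursion because 6x² ≤ x. -/
lemma sum_normMoment_le (h : IsProfileMeasure ε v ν) (hε : ε ≤ 1 / 10) {l : ℝ} (hl : 0 ≤ l)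
    (hl' : 8 * (l * normMoment ν 1) ≤ 1) (N : ℕ) :
    ∑ k ∈ Finset.range N, l ^ (k + 1) * normMoment ν (k + 1) ≤ 2 * (l * normMoment ν 1) := by
  have h0 := h.normMoment_nonneg
  have hnn : ∀ i, 0 ≤ l ^ (i + 1) * normMoment ν (i + 1) := fun i =>
    mul_nonneg (pow_nonneg hl _) (h0 _)
  induction N with
  | zero => simp; exact mul_nonneg hl (h0 1)
  | succ N ih =>
    rw [Finset.sum_range_succ']
    have e : ∑ k ∈ Finset.range N, l ^ (k + 1 + 1) * normMoment ν (k + 1 + 1) ≤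
        3 / 2 * ∑ k ∈ Finset.range N, ∑ p ∈ Finset.HasAntidiagonal.antidiagonal k,
          (l ^ (p.1 + 1) * normMoment ν (p.1 + 1)) * (l ^ (p.2 + 1) * normMoment ν (p.2 + 1)) := by
      rw [Finset.mul_sum]
      refine Finset.sum_le_sum fun k _ => ?_
      have := mul_le_mul_of_nonneg_left (h.moment_le_sum hε k) (pow_nonneg hl (k + 2))
      refine this.trans (le_of_eq ?_)
      rw [Finset.mul_sum, Finset.mul_sum, Finset.mul_sum]
      refine Finset.sum_congr rfl fun p hp => ?_
      rw [Finset.HasAntidiagonal.mem_antidiagonal] at hp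
      rw [← hp]
      ring
    have e2 := sum_range_sum_antidiagonal_le hnn N
    have hs : 0 ≤ ∑ k ∈ Finset.range N, l ^ (k + 1) * normMoment ν (k + 1) :=
      Finset.sum_nonneg fun i _ => hnn i
    set G := ∑ k ∈ Finset.range N, l ^ (k + 1) * normMoment ν (k + 1)
    simp only [zero_add, pow_one]
    nlinarith

/-- Otherwise the preceding bound with l = 3 would sum the exponential series of ∫ e^{3x} dν,
against `exp_not_integrable`. -/
lemma le_normMoment_one (h : IsProfileMeasure ε v ν) (hε : ε ≤ 1 / 10) :
    1 / 24 ≤ normMoment ν 1 := by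
  have := h.finite
  by_contra hc
  push Not at hc
  refine h.exp_not_integrable ?_
  have hb := h.sum_normMoment_le hε (l := 3) (by norm_num) (by linarith)
  have h0 := h.normMoment_nonneg
  have hs : Summable fun k => (3 : ℝ) ^ (k + 1) * normMoment ν (k + 1) :=
    summable_of_sum_range_le (fun i => mul_nonneg (by positivity) (h0 _)) hb
  have hs' : Summable fun k => (3 : ℝ) ^ k * normMoment ν k := (summable_nat_add_iff 1).1 hs
  have e : ∀ x : ℝ, HasSum (fun k : ℕ => (3 * x) ^ k / (k.factorial : ℝ)) (Real.exp (3 * x)) := by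
    intro x
    rw [Real.exp_eq_exp_ℝ]
    exact NormedSpace.expSeries_div_hasSum_exp (3 * x)
  refine ⟨by fun_prop, ?_⟩
  rw [hasFiniteIntegral_iff_ofReal (Eventually.of_forall fun x => (Real.exp_pos _).le)]
  have e2 : ∫⁻ x, ENNReal.ofReal (Real.exp (3 * x)) ∂ν =
      ∑' k : ℕ, ENNReal.ofReal (3 ^ k * normMoment ν k) := by
    have : ∫⁻ x, ENNReal.ofReal (Real.exp (3 * x)) ∂ν =
        ∫⁻ x, ∑' k : ℕ, ENNReal.ofReal ((3 * x) ^ k / (k.factorial : ℝ)) ∂ν := by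
      refine lintegral_congr_ae ?_
      filter_upwards [h.pos] with x hx
      rw [← (e x).tsum_eq, ENNReal.ofReal_tsum_of_nonneg (fun k => by positivity) (e x).summable]
    rw [this, lintegral_tsum (fun k => by fun_prop)]
    congr 1
    ext k
    rw [normMoment, ← integral_const_mul, ofReal_integral_eq_lintegral_ofReal
      ((h.integrable_pow_div k).const_mul _)]
    · refine lintegral_congr fun x => ?_
      rw [mul_pow]; congr 1; ring
    · filter_upwards [h.pos] with x hx
      show 0 ≤ 3 ^ k * (x ^ k / k.factorial)
      positivity
  rw [e2, ← ENNReal.ofReal_tsum_of_nonneg (fun k => mul_nonneg (by positivity) (h0 _)) hs']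
  exact ENNReal.ofReal_lt_top

end IsProfileMeasure
end SelfSim
end

/-! ### Laplace transform of the profile: lower bounds for the mass and the tail. -/

noncomputable section

namespace SelfSim

/-- The desingularized Laplace transform `∫ (1 - e^{-q x}) dν`. -/
def bernsteinTransform (ν : Measure ℝ) (q : ℝ) : ℝ := ∫ x, (1 - Real.exp (-(q * x))) ∂ν

namespace IsProfileMeasure

variable {ε : ℝ} {v : ℝ → ℝ} {ν : Measure ℝ}

lemma integrable_id (h : IsProfileMeasure ε v ν) : Integrable (fun x : ℝ => x) ν := by
  simpa using h.integrable_pow 1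

lemma normMoment_one (_h : IsProfileMeasure ε v ν) : normMoment ν 1 = ∫ x, x ∂ν := by
  simp [normMoment]

lemma integrable_exp_neg (h : IsProfileMeasure ε v ν) {q : ℝ} (hq : 0 ≤ q) :
    Integrable (fun x : ℝ => Real.exp (-(q * x))) ν := by
  have := h.finite
  refine (integrable_const (1 : ℝ)).mono' (by fun_prop) ?_
  filter_upwards [h.pos] with x hx
  rw [Real.norm_of_nonneg (Real.exp_pos _).le, Real.exp_le_one_iff]
  have := mul_nonneg hq hx.le
  linarith

lemma integrable_one_sub_exp (h : IsProfileMeasure ε v ν) {q : ℝ} (hq : 0 ≤ q) :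
    Integrable (fun x : ℝ => 1 - Real.exp (-(q * x))) ν := by
  have := h.finite
  exact (integrable_const (1 : ℝ)).sub (h.integrable_exp_neg hq)

lemma hasDerivAt_bernsteinTransform (h : IsProfileMeasure ε v ν) {q : ℝ} (hq : 0 < q) :
    HasDerivAt (bernsteinTransform ν) (∫ x, x * Real.exp (-(q * x)) ∂ν) q := by
  have := h.finite
  refine (hasDerivAt_integral_of_dominated_loc_of_deriv_le (μ := ν)
    (F := fun q x => 1 - Real.exp (-(q * x))) (F' := fun q x => x * Real.exp (-(q * x)))
    (bound := fun x => x) (Ioi_mem_nhds hq)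
    (Eventually.of_forall fun q => by fun_prop) (h.integrable_one_sub_exp hq.le) (by fun_prop)
    ?_ h.integrable_id ?_).2
  · filter_upwards [h.pos] with x hx r hr
    rw [Real.norm_of_nonneg (mul_nonneg hx.le (Real.exp_pos _).le)]
    refine mul_le_of_le_one_right hx.le ?_
    rw [Real.exp_le_one_iff]
    have := mul_pos (mem_Ioi.1 hr) hx
    linarith
  · refine Eventually.of_forall fun x r _ => ?_
    have := ((((hasDerivAt_id' r).mul_const x).fun_neg).exp).const_sub 1
    convert this using 1
    ring

/-- For g(x) = e^{-qx} - 1 the bracket factorizes as (1 - e^{-qy})(1 - e^{-qz}), so the constant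
kernel gives the Riccati equation F - qF' = F² for the transform F. In the perturbation, y/z is
cancelled by 1 - e^{-qz} ≤ qz. -/
lemma bernstein_ode (h : IsProfileMeasure ε v ν) {q : ℝ} (hq : 0 < q) :
    bernsteinTransform ν q - q * ∫ x, x * Real.exp (-(q * x)) ∂ν ≤
      bernsteinTransform ν q ^ 2 +
        ε * (bernsteinTransform ν q ^ 2 + normMoment ν 1 * q) := by
  have := h.finite
  have hεp := h.eps_pos
  have hxe : Integrable (fun x => x * Real.exp (-(q * x))) ν := by
    refine h.integrable_id.mono' (by fun_prop) ?_
    filter_upwards [h.pos] with x hx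
    rw [Real.norm_of_nonneg (mul_nonneg hx.le (Real.exp_pos _).le)]
    refine mul_le_of_le_one_right hx.le ?_
    rw [Real.exp_le_one_iff]
    have := mul_pos hq hx
    linarith
  have hi := h.integrable_one_sub_exp hq.le
  have hsimp : ∀ x : ℝ, 0 < x → x ^ 2 *
      ((1 - Real.exp (-(q * x)) - q * (x * Real.exp (-(q * x)))) / x ^ 2) =
      1 - Real.exp (-(q * x)) - q * (x * Real.exp (-(q * x))) := fun x hx => by field_simp
  have key := h.weak_identity (Ψ := fun x => (Real.exp (-(q * x)) - 1) / x)
    (φ := fun x => (1 - Real.exp (-(q * x)) - q * (x * Real.exp (-(q * x)))) / x ^ 2)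
    (G := fun y z => (1 - Real.exp (-(q * y))) * (1 - Real.exp (-(q * z))))
    (fun x hx => by
      have := (((((hasDerivAt_id' x).const_mul q).fun_neg).exp).sub_const 1).fun_div
        (hasDerivAt_id' x) hx.ne'
      refine this.congr_deriv ?_
      field_simp
      ring)
    (fun x hx => by
      refine div_nonneg ?_ (sq_nonneg x)
      have h1 := Real.add_one_le_exp (q * x)
      have h2 : Real.exp (-(q * x)) * Real.exp (q * x) = 1 := by
        rw [← Real.exp_add]; simp
      have h3 := Real.exp_pos (-(q * x))
      nlinarith)
    (by fun_prop) (by fun_prop)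
    ((hi.sub (hxe.const_mul q)).congr (by
      filter_upwards [h.pos] with x hx
      simp only [Pi.sub_apply]
      rw [hsimp x hx]))
    (fun y z hy hz => by
      have e : Real.exp (-(q * (y + z))) = Real.exp (-(q * y)) * Real.exp (-(q * z)) := by
        rw [← Real.exp_add]; ring_nf
      rw [e]
      field_simp
      ring)
  have e1 : ∫ x, x ^ 2 * ((1 - Real.exp (-(q * x)) - q * (x * Real.exp (-(q * x)))) / x ^ 2) ∂ν
      = bernsteinTransform ν q - q * ∫ x, x * Real.exp (-(q * x)) ∂ν := by
    rw [bernsteinTransform, ← integral_const_mul, ← integral_sub hi (hxe.const_mul q)]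
    refine integral_congr_ae ?_
    filter_upwards [h.pos] with x hx
    exact hsimp x hx
  have hle : ∫ p : ℝ × ℝ, (2 + ε * v (p.1 / p.2)) *
      ((1 - Real.exp (-(q * p.1))) * (1 - Real.exp (-(q * p.2)))) ∂(ν.prod ν) ≤
      ∫ p : ℝ × ℝ, ((2 + 2 * ε) * ((1 - Real.exp (-(q * p.1))) * (1 - Real.exp (-(q * p.2)))) +
        (ε * q) * (p.1 * 1) + (ε * q) * (1 * p.2)) ∂(ν.prod ν) := by
    refine integral_mono_ae key.1 ((((hi.mul_prod hi).const_mul _).add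
      ((h.integrable_id.mul_prod (integrable_const (1 : ℝ))).const_mul _)).add
      (((integrable_const (1 : ℝ)).mul_prod h.integrable_id).const_mul _)) ?_
    filter_upwards [h.ae_prod_pos] with p hp
    obtain ⟨hy, hz⟩ := hp
    have hv := h.v_le (p.1 / p.2) (div_pos hy hz)
    rw [inv_div] at hv
    generalize p.1 = y at *
    generalize p.2 = z at *
    have bd : ∀ x : ℝ, 0 < x → 0 ≤ 1 - Real.exp (-(q * x)) ∧ 1 - Real.exp (-(q * x)) ≤ 1 ∧
        (1 - Real.exp (-(q * x))) ≤ q * x := by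
      intro x hx
      have h1 := Real.add_one_le_exp (-(q * x))
      have h2 := Real.exp_pos (-(q * x))
      have h3 : Real.exp (-(q * x)) ≤ 1 := by
        rw [Real.exp_le_one_iff]; have := mul_pos hq hx; linarith
      exact ⟨by linarith, by linarith, by linarith⟩
    obtain ⟨ay, by1, cy⟩ := bd y hy
    obtain ⟨az, bz1, cz⟩ := bd z hz
    set Y := 1 - Real.exp (-(q * y))
    set Z := 1 - Real.exp (-(q * z))
    have e1 : y / z * (Y * Z) ≤ q * y := by
      calc y / z * (Y * Z) ≤ y / z * (1 * (q * z)) := by gcongr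
        _ = q * y := by field_simp
    have e2 : z / y * (Y * Z) ≤ q * z := by
      calc z / y * (Y * Z) ≤ z / y * ((q * y) * 1) := by gcongr
        _ = q * z := by field_simp
    have e3 : (2 + ε * v (y / z)) * (Y * Z) ≤ (2 + ε * (2 + y / z + z / y)) * (Y * Z) := by gcongr
    have e4 := mul_le_mul_of_nonneg_left e1 hεp.le
    have e5 := mul_le_mul_of_nonneg_left e2 hεp.le
    linarith
  rw [key.2, e1] at hle
  have hP : ∫ p : ℝ × ℝ, ((2 + 2 * ε) * ((1 - Real.exp (-(q * p.1))) *
      (1 - Real.exp (-(q * p.2)))) + (ε * q) * (p.1 * 1) + (ε * q) * (1 * p.2)) ∂(ν.prod ν) =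
      (2 + 2 * ε) * bernsteinTransform ν q ^ 2 + 2 * (ε * q * (normMoment ν 1 * ν.real univ)) := by
    have i1 := (hi.mul_prod hi).const_mul (2 + 2 * ε)
    have i2 := (h.integrable_id.mul_prod (integrable_const (1 : ℝ) (μ := ν))).const_mul (ε * q)
    have i3 := ((integrable_const (1 : ℝ) (μ := ν)).mul_prod h.integrable_id).const_mul (ε * q)
    have i12 : Integrable (fun p : ℝ × ℝ => (2 + 2 * ε) * ((1 - Real.exp (-(q * p.1))) *
      (1 - Real.exp (-(q * p.2)))) + (ε * q) * (p.1 * 1)) (ν.prod ν) := i1.add i2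
    rw [integral_add i12 i3, integral_add i1 i2, integral_const_mul, integral_const_mul,
      integral_const_mul,
      integral_prod_mul (fun x : ℝ => 1 - Real.exp (-(q * x)))
        (fun x : ℝ => 1 - Real.exp (-(q * x))),
      integral_prod_mul (fun x : ℝ => x) (fun _ : ℝ => (1 : ℝ)),
      integral_prod_mul (fun _ : ℝ => (1 : ℝ)) (fun x : ℝ => x), h.normMoment_one]
    simp [bernsteinTransform]
    ring
  rw [hP] at hle
  have h0 := h.normMoment_nonneg 1
  have hM := h.mass_le_one
  have : ε * q * (normMoment ν 1 * ν.real univ) ≤ ε * q * (normMoment ν 1 * 1) := by gcongr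
  linarith

lemma bernstein_le_mass (h : IsProfileMeasure ε v ν) {q : ℝ} (hq : 0 ≤ q) :
    bernsteinTransform ν q ≤ ν.real univ := by
  have := h.finite
  have e : ν.real univ = ∫ _ : ℝ, (1 : ℝ) ∂ν := by simp
  rw [e]
  refine integral_mono (h.integrable_one_sub_exp hq) (integrable_const _) fun x => ?_
  have := Real.exp_pos (-(q * x))
  simp only
  linarith

lemma bernstein_mono (h : IsProfileMeasure ε v ν) {p q : ℝ} (hp : 0 ≤ p) (hq : p ≤ q) :
    bernsteinTransform ν p ≤ bernsteinTransform ν q := by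
  refine integral_mono_ae (h.integrable_one_sub_exp hp)
    (h.integrable_one_sub_exp (hp.trans hq)) ?_
  filter_upwards [h.pos] with x hx
  have : Real.exp (-(q * x)) ≤ Real.exp (-(p * x)) := by
    rw [Real.exp_le_exp]
    have := mul_le_mul_of_nonneg_right hq hx.le
    linarith
  linarith

lemma normMoment_two_le (h : IsProfileMeasure ε v ν) (hε : ε ≤ 1 / 10) :
    normMoment ν 2 ≤ 3 / 2 * normMoment ν 1 ^ 2 := by
  have := h.moment_le_sum hε 0
  simpa [sq] using this

lemma le_bernstein (h : IsProfileMeasure ε v ν) {q : ℝ} (hq : 0 ≤ q) :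
    q * normMoment ν 1 - q ^ 2 * normMoment ν 2 ≤ bernsteinTransform ν q := by
  rw [normMoment, normMoment, ← integral_const_mul, ← integral_const_mul, bernsteinTransform,
    ← integral_sub ((h.integrable_pow_div 1).const_mul _) ((h.integrable_pow_div 2).const_mul _)]
  refine integral_mono_ae (((h.integrable_pow_div 1).const_mul _).sub
    ((h.integrable_pow_div 2).const_mul _)) (h.integrable_one_sub_exp hq) ?_
  filter_upwards [h.pos] with x hx
  have h2 := Real.quadratic_le_exp_of_nonneg (mul_nonneg hq hx.le)
  have h3 : Real.exp (-(q * x)) * Real.exp (q * x) = 1 := by rw [← Real.exp_add]; simp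
  have h4 := Real.exp_pos (-(q * x))
  have hu := mul_nonneg hq hx.le
  suffices q * x - (q * x) ^ 2 / 2 ≤ 1 - Real.exp (-(q * x)) by
    refine le_trans (le_of_eq ?_) this
    simp
    ring
  set u := q * x
  have h5 : Real.exp (-u) * (1 + u + u ^ 2 / 2) ≤ 1 := by
    calc _ ≤ Real.exp (-u) * Real.exp u := by gcongr
      _ = 1 := h3
  by_contra hc
  push Not at hc
  have h6 : 1 - u + u ^ 2 / 2 < Real.exp (-u) := by linarith
  have h7 : (1 - u + u ^ 2 / 2) * (1 + u + u ^ 2 / 2) < Real.exp (-u) * (1 + u + u ^ 2 / 2) := by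
    apply mul_lt_mul_of_pos_right h6; positivity
  nlinarith [pow_nonneg hu 4]

/-- For the constant kernel q/F(q) - q is constant. Here its derivative is at most ε(1 + mq/F²),
with m the first moment, so it stays of order 1/m up to Q = 200/m, which forces F(Q) close to 1. The
small bound on ε compensates the length of this interval. -/
lemma bernstein_lower (h : IsProfileMeasure ε v ν) (hε : ε ≤ 1 / 10 ^ 7) :
    200 / 203 ≤ bernsteinTransform ν (200 / normMoment ν 1) := by
  have hεp := h.eps_pos
  have hm := h.le_normMoment_one (hε.trans (by norm_num))
  have hm2 := h.normMoment_two_le (hε.trans (by norm_num))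
  set m := normMoment ν 1 with hmdef
  have hmp : 0 < m := by linarith
  set g := bernsteinTransform ν with hg
  -- Here the second-order bound F(q) ≥ qm - (3/2)(qm)² gives 1/3 - 1/6 = 1/6.
  set q₀ := 1 / (3 * m) with hq₀
  have hq₀p : 0 < q₀ := by positivity
  have g0 : 1 / 6 ≤ g q₀ := by
    have h1 := h.le_bernstein hq₀p.le
    have h2 : q₀ * m = 1 / 3 := by rw [hq₀]; field_simp
    have h3 : q₀ ^ 2 * normMoment ν 2 ≤ q₀ ^ 2 * (3 / 2 * m ^ 2) := by gcongr
    have h4 : q₀ ^ 2 * (3 / 2 * m ^ 2) = 3 / 2 * (q₀ * m) ^ 2 := by ring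
    rw [h4, h2] at h3
    rw [← hmdef, h2] at h1
    linarith
  have gpos : ∀ q, q₀ ≤ q → 1 / 6 ≤ g q := fun q hq => g0.trans (h.bernstein_mono hq₀p.le hq)
  set Q := 200 / m with hQ
  have hqQ : q₀ ≤ Q := by
    rw [hq₀, hQ, div_le_div_iff₀ (by positivity) hmp]; linarith
  have hder : ∀ q, q₀ ≤ q → HasDerivAt (fun q => q / g q - q)
      ((1 * g q - q * ∫ x, x * Real.exp (-(q * x)) ∂ν) / g q ^ 2 - 1) q := by
    intro q hq
    have := gpos q hq
    exact ((hasDerivAt_id' q).fun_div (h.hasDerivAt_bernsteinTransform (hq₀p.trans_le hq))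
      (by linarith)).fun_sub (hasDerivAt_id' q)
  -- On this interval mq ≤ 200 and 1/F² ≤ 36.
  have hC := (convex_Icc q₀ Q).image_sub_le_mul_sub_of_deriv_le (f := fun q => q / g q - q)
    (C := ε * (1 + 36 * 200))
    (fun q hq => (hder q hq.1).continuousAt.continuousWithinAt)
    (fun q hq => (hder q (by rw [interior_Icc] at hq; exact hq.1.le)).differentiableAt.differentiableWithinAt)
    (fun q hq => by
      rw [interior_Icc] at hq
      rw [(hder q hq.1.le).deriv]
      have h1 := h.bernstein_ode (hq₀p.trans hq.1)
      have h2 := gpos q hq.1.le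
      rw [← hg, ← hmdef] at h1
      have h3 : m * q ≤ 200 := by
        have := hq.2.le
        rw [hQ, le_div_iff₀ hmp] at this
        linarith
      rw [sub_le_iff_le_add, div_le_iff₀ (by positivity)]
      have h4 : (1 / 6) ^ 2 ≤ g q ^ 2 := by gcongr
      have h5 : ε * (m * q) ≤ ε * (200 * (36 * g q ^ 2)) := by
        apply mul_le_mul_of_nonneg_left _ hεp.le
        linarith
      linarith)
    q₀ (left_mem_Icc.2 hqQ) Q (right_mem_Icc.2 hqQ) hqQ
  have hk0 : q₀ / g q₀ - q₀ ≤ 2 / m := by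
    have : q₀ / g q₀ ≤ q₀ / (1 / 6) := by gcongr
    have e : q₀ / (1 / 6) = 2 / m := by rw [hq₀]; field_simp; norm_num
    linarith
  have hlast : ε * (1 + 36 * 200) * (Q - q₀) ≤ 1 / m := by
    calc ε * (1 + 36 * 200) * (Q - q₀) ≤ ε * (1 + 36 * 200) * Q := by gcongr; linarith
      _ ≤ 1 / 10 ^ 7 * (1 + 36 * 200) * Q := by gcongr
      _ = (1 / 10 ^ 7 * (1 + 36 * 200) * 200) * (1 / m) := by rw [hQ]; ring
      _ ≤ 1 * (1 / m) := by gcongr; norm_num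
      _ = 1 / m := one_mul _
  have hfin : Q / g Q - Q ≤ 3 / m := by
    have : 3 / m = 2 / m + 1 / m := by ring
    linarith
  have hgQ := gpos Q hqQ
  have h5 : Q / g Q ≤ 203 / m := by
    have : 203 / m = Q + 3 / m := by rw [hQ]; ring
    linarith
  rw [hQ, div_div, div_le_div_iff₀ (by positivity) hmp] at h5
  rw [div_le_iff₀ (by norm_num)]
  nlinarith

lemma mass_ge (h : IsProfileMeasure ε v ν) (hε : ε ≤ 1 / 10 ^ 7) : 7 / 8 ≤ ν.real univ := by
  have h1 := h.bernstein_lower hε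
  have hm := h.le_normMoment_one (hε.trans (by norm_num))
  have h2 := h.bernstein_le_mass (q := 200 / normMoment ν 1) (by positivity)
  linarith

/-- For x ≤ 1/4800 one has Qx ≤ 1, so e^{-Qx} ≥ 1/e there; but the integral of e^{-Qx} is the mass
minus F(Q), at most 3/203. Hence little mass lies near 0. -/
lemma tail_ge (h : IsProfileMeasure ε v ν) (hε : ε ≤ 1 / 10 ^ 7) :
    13 / 16 ≤ ν.real (Ioi (1 / 4800)) := by
  have := h.finite
  have h1 := h.bernstein_lower hε
  have hm := h.le_normMoment_one (hε.trans (by norm_num))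
  have hM := h.mass_ge hε
  have hM1 := h.mass_le_one
  set Q := 200 / normMoment ν 1 with hQ
  have hQ0 : 0 ≤ Q := by positivity
  have hQ1 : Q ≤ 4800 := by
    rw [hQ, div_le_iff₀ (by linarith)]; linarith
  have e1 : Real.exp (-1) * ν.real (Iic (1 / 4800)) ≤ ν.real univ - bernsteinTransform ν Q := by
    have e : ν.real univ - bernsteinTransform ν Q = ∫ x, Real.exp (-(Q * x)) ∂ν := by
      rw [bernsteinTransform, integral_sub (integrable_const _) (h.integrable_exp_neg hQ0)]
      simp
    rw [e]
    have e2 : Real.exp (-1) * ν.real (Iic (1 / 4800)) =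
        ∫ x, (Iic (1 / 4800 : ℝ)).indicator (fun _ => Real.exp (-1)) x ∂ν := by
      rw [integral_indicator_const _ measurableSet_Iic, smul_eq_mul, mul_comm]
    rw [e2]
    refine integral_mono_ae ((integrable_const _).indicator measurableSet_Iic)
      (h.integrable_exp_neg hQ0) ?_
    filter_upwards [h.pos] with x hx
    by_cases hx2 : x ∈ Iic (1 / 4800 : ℝ)
    · rw [indicator_of_mem hx2, Real.exp_le_exp]
      have : Q * x ≤ 4800 * (1 / 4800) := by gcongr; exact hx2
      linarith
    · rw [indicator_of_notMem hx2]; positivity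
  have e3 : ν.real (Iic (1 / 4800)) + ν.real (Ioi (1 / 4800)) = ν.real univ := by
    rw [← compl_Iic]; exact measureReal_add_measureReal_compl measurableSet_Iic
  have e4 : 1 / 3 ≤ Real.exp (-1) := by
    rw [Real.exp_neg, one_div]
    exact inv_anti₀ (Real.exp_pos 1) (by linarith [Real.exp_one_lt_d9])
  have e5 : 0 ≤ ν.real (Iic (1 / 4800)) := measureReal_nonneg
  nlinarith

end IsProfileMeasure
end SelfSim
end

/-! ### Negative moments. -/

noncomputable section

namespace SelfSim

lemma measurable_lintegral_Ioo {φ : ℝ → ENNReal} (hφ : Measurable φ) :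
    Measurable fun p : ℝ × ℝ => ∫⁻ x in Ioo p.1 (p.1 + p.2), φ x := by
  have : (fun p : ℝ × ℝ => ∫⁻ x in Ioo p.1 (p.1 + p.2), φ x) =
      fun p : ℝ × ℝ => ∫⁻ x, {q : (ℝ × ℝ) × ℝ | q.1.1 < q.2 ∧ q.2 < q.1.1 + q.1.2}.indicator
        (fun q => φ q.2) (p, x) := by
    ext p
    rw [← lintegral_indicator measurableSet_Ioo]
    rfl
  rw [this]
  have m1 : MeasurableSet {q : (ℝ × ℝ) × ℝ | q.1.1 < q.2} :=
    measurableSet_lt (by fun_prop) (by fun_prop)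
  have m2 : MeasurableSet {q : (ℝ × ℝ) × ℝ | q.2 < q.1.1 + q.1.2} :=
    measurableSet_lt (by fun_prop) (by fun_prop)
  exact ((hφ.comp measurable_snd).indicator (m1.inter m2)).lintegral_prod_right'

namespace IsProfileMeasure

variable {ε : ℝ} {v : ℝ → ℝ} {ν : Measure ℝ}

/-- Test with x^{-2-α} cut off at δ and keep only the constant 2 of the kernel. For z > r the inner
integral, multiplied by y(1+α), is at least y^{-α} - r^{-α}, so the moment times the tail mass 13/16
is at most (1+α)/2 ≤ 3/4 times the same moment plus r^{-α}. The difference 1/16 gives the constant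
16. -/
lemma neg_moment_truncated (h : IsProfileMeasure ε v ν) (hε : ε ≤ 1 / 10 ^ 7) {α : ℝ}
    (hα : 0 < α) (hα2 : α < 1 / 2) {δ : ℝ} (hδ : 0 < δ) :
    ∫⁻ x in Ioi δ, ENNReal.ofReal (x ^ (-α)) ∂ν ≤ ENNReal.ofReal (16 * (1 / 4800) ^ (-α)) := by
  have := h.finite
  have hεp := h.eps_pos
  have hv := h.measurable_v
  set r : ℝ := 1 / 4800 with hr
  have hrp : 0 < r := by norm_num [hr]
  have hm1 : Measurable fun x : ℝ => x ^ (-α) := by fun_prop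
  have hm2 : Measurable fun x : ℝ => x ^ (-2 - α) := by fun_prop
  set φ : ℝ → ENNReal := (Ioi δ).indicator fun x => ENNReal.ofReal (x ^ (-2 - α)) with hφ
  have hφm : Measurable φ := (hm2.ennreal_ofReal).indicator measurableSet_Ioi
  have eq := h.equation φ hφm
  set M := ∫⁻ x in Ioi δ, ENNReal.ofReal (x ^ (-α)) ∂ν with hM
  have hL : ∫⁻ x, ENNReal.ofReal (x ^ 2) * φ x ∂ν = M := by
    rw [hM, ← lintegral_indicator measurableSet_Ioi]
    refine lintegral_congr fun x => ?_
    by_cases hx : x ∈ Ioi δ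
    · rw [indicator_of_mem hx, hφ, indicator_of_mem hx, ← ENNReal.ofReal_mul (sq_nonneg x)]
      congr 1
      have hx0 : 0 < x := hδ.trans hx
      rw [← Real.rpow_natCast x 2, ← Real.rpow_add hx0]
      congr 1; push_cast; ring
    · rw [indicator_of_notMem hx, hφ, indicator_of_notMem hx, mul_zero]
  -- The cutoff makes the moment finite, without which it could not be absorbed; the bound itself
  -- does not depend on δ.
  have hMfin : M ≠ ⊤ := by
    refine ne_top_of_le_ne_top (b := ENNReal.ofReal (δ ^ (-α)) * ν univ) ?_ ?_
    · exact ENNReal.mul_ne_top ENNReal.ofReal_ne_top (measure_ne_top _ _)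
    · rw [← lintegral_const, hM]
      refine (setLIntegral_mono measurable_const fun x hx => ?_).trans (setLIntegral_le_lintegral _ _)
      exact ENNReal.ofReal_le_ofReal (Real.rpow_le_rpow_of_nonpos hδ (le_of_lt hx) (by linarith))
  have pt : ∀ᵐ p ∂(ν.prod ν),
      ((Ioi δ).indicator (fun x => ENNReal.ofReal (x ^ (-α))) p.1) *
        ((Ioi r).indicator 1 p.2) ≤
      ENNReal.ofReal ((1 + α) / 2) * (ENNReal.ofReal (p.1 * (2 + ε * v (p.1 / p.2))) *
        ∫⁻ x in Ioo p.1 (p.1 + p.2), φ x) + ENNReal.ofReal (r ^ (-α)) := by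
    filter_upwards [h.ae_prod_pos] with p hp
    obtain ⟨hy, hz⟩ := hp
    have hv := h.v_nonneg (p.1 / p.2) (div_pos hy hz)
    generalize p.1 = y at *
    generalize p.2 = z at *
    by_cases hyδ : y ∈ Ioi δ
    swap
    · rw [indicator_of_notMem hyδ, zero_mul]; exact zero_le
    by_cases hzr : z ∈ Ioi r
    swap
    · rw [indicator_of_notMem hzr, mul_zero]; exact zero_le
    rw [indicator_of_mem hyδ, indicator_of_mem hzr, Pi.one_apply, mul_one]
    have hin : ∫⁻ x in Ioo y (y + z), φ x =
        ENNReal.ofReal ((y ^ (-1 - α) - (y + z) ^ (-1 - α)) / (1 + α)) := by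
      have := lintegral_Ioo_of_hasDerivAt (Ψ := fun x => x ^ (-1 - α) / (-1 - α))
        (φ := fun x => x ^ (-2 - α)) (fun x hx => by
          have := (Real.hasDerivAt_rpow_const (p := -1 - α) (Or.inl hx.ne')).div_const (-1 - α)
          refine this.congr_deriv ?_
          have : (-1 - α) ≠ 0 := by linarith
          field_simp
          congr 1; ring) (fun x hx => by positivity) hy (z := y + z) (by linarith)
      calc ∫⁻ x in Ioo y (y + z), φ x = ∫⁻ x in Ioo y (y + z), ENNReal.ofReal (x ^ (-2 - α)) := by
            refine setLIntegral_congr_fun measurableSet_Ioo fun x hx => ?_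
            rw [hφ]
            exact indicator_of_mem (show x ∈ Ioi δ from lt_trans hyδ hx.1) _
        _ = _ := by
            rw [this]; congr 1
            have h1 : (-1 - α) ≠ 0 := by linarith
            have h2 : (1 + α) ≠ 0 := by linarith
            rw [show -1 - α = -(1 + α) by ring, div_neg, div_neg]
            ring
    have hdec : (y + z) ^ (-1 - α) ≤ y ^ (-1 - α) :=
      Real.rpow_le_rpow_of_nonpos hy (by linarith) (by linarith)
    rw [hin, ← ENNReal.ofReal_mul (by positivity), ← ENNReal.ofReal_mul (by positivity),
      ← ENNReal.ofReal_add _ (by positivity)]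
    swap
    · have : 0 ≤ (y ^ (-1 - α) - (y + z) ^ (-1 - α)) / (1 + α) :=
        div_nonneg (by linarith) (by linarith)
      positivity
    refine ENNReal.ofReal_le_ofReal ?_
    have e1 : (1 + α) / 2 * (y * (2 + ε * v (y / z)) *
        ((y ^ (-1 - α) - (y + z) ^ (-1 - α)) / (1 + α))) =
        (1 + ε * v (y / z) / 2) * (y * (y ^ (-1 - α) - (y + z) ^ (-1 - α))) := by
      field_simp
    have e2 : 0 ≤ y * (y ^ (-1 - α) - (y + z) ^ (-1 - α)) := mul_nonneg hy.le (by linarith)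
    have e3 : y * (y ^ (-1 - α) - (y + z) ^ (-1 - α)) ≤
        (1 + ε * v (y / z) / 2) * (y * (y ^ (-1 - α) - (y + z) ^ (-1 - α))) :=
      le_mul_of_one_le_left e2 (by have : 0 ≤ ε * v (y / z) := by positivity
                                   linarith)
    have e4 : y * y ^ (-1 - α) = y ^ (-α) := by
      nth_rewrite 1 [← Real.rpow_one y]
      rw [← Real.rpow_add hy]; congr 1; ring
    have e5 : y * (y + z) ^ (-1 - α) ≤ r ^ (-α) := by
      calc y * (y + z) ^ (-1 - α) ≤ (y + z) * (y + z) ^ (-1 - α) := by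
            gcongr; linarith
        _ = (y + z) ^ (-α) := by
            nth_rewrite 1 [← Real.rpow_one (y + z)]
            rw [← Real.rpow_add (by positivity)]; congr 1; ring
        _ ≤ r ^ (-α) := Real.rpow_le_rpow_of_nonpos hrp
            (by have := mem_Ioi.1 hzr; linarith) (by linarith)
    rw [e1]
    linarith
  have hI := lintegral_mono_ae pt
  have hmI := measurable_lintegral_Ioo hφm
  have hm3 : Measurable fun x : ℝ => (Ioi δ).indicator (fun x => ENNReal.ofReal (x ^ (-α))) x :=
    (hm1.ennreal_ofReal).indicator measurableSet_Ioi
  have hm4 : Measurable fun x : ℝ => (Ioi r).indicator (1 : ℝ → ENNReal) x :=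
    measurable_one.indicator measurableSet_Ioi
  rw [lintegral_prod_mul hm3.aemeasurable hm4.aemeasurable, lintegral_add_right _ (by fun_prop),
    lintegral_const_mul _ (by fun_prop), lintegral_prod _ (by fun_prop), ← eq, hL,
    lintegral_indicator measurableSet_Ioi, lintegral_indicator_one measurableSet_Ioi,
    lintegral_const, ← hM] at hI
  have hT := h.tail_ge hε
  have hM1 := h.mass_le_one
  have hI' := ENNReal.toReal_mono (by
    refine ENNReal.add_ne_top.2 ⟨ENNReal.mul_ne_top ENNReal.ofReal_ne_top hMfin,
      ENNReal.mul_ne_top ENNReal.ofReal_ne_top (measure_ne_top _ _)⟩) hI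
  rw [ENNReal.toReal_mul, ENNReal.toReal_add (ENNReal.mul_ne_top ENNReal.ofReal_ne_top hMfin)
    (ENNReal.mul_ne_top ENNReal.ofReal_ne_top (measure_ne_top _ _)), ENNReal.toReal_mul,
    ENNReal.toReal_mul, ENNReal.toReal_ofReal (by positivity),
    ENNReal.toReal_ofReal (by positivity)] at hI'
  have huniv : ((ν.prod ν) univ).toReal ≤ 1 := by
    rw [← univ_prod_univ, Measure.prod_prod, ENNReal.toReal_mul]
    exact mul_le_one₀ hM1 measureReal_nonneg hM1
  rw [← ENNReal.ofReal_toReal hMfin]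
  refine ENNReal.ofReal_le_ofReal ?_
  have hM0 : 0 ≤ M.toReal := ENNReal.toReal_nonneg
  have e1 : M.toReal * (13 / 16) ≤ M.toReal * (ν (Ioi r)).toReal :=
    mul_le_mul_of_nonneg_left hT hM0
  have e2 : r ^ (-α) * ((ν.prod ν) univ).toReal ≤ r ^ (-α) * 1 := by gcongr
  have e3 : (1 + α) / 2 * M.toReal ≤ 3 / 4 * M.toReal :=
    mul_le_mul_of_nonneg_right (by linarith) hM0
  linarith

lemma neg_moment (h : IsProfileMeasure ε v ν) (hε : ε ≤ 1 / 10 ^ 7) {α : ℝ}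
    (hα : 0 < α) (hα2 : α < 1 / 2) :
    Integrable (fun x => x ^ (-α)) ν ∧ ∫ x, x ^ (-α) ∂ν ≤ 16 * (1 / 4800) ^ (-α) := by
  have hm1 : Measurable fun x : ℝ => x ^ (-α) := by fun_prop
  have nn : 0 ≤ᵐ[ν] fun x : ℝ => x ^ (-α) := by
    filter_upwards [h.pos] with x hx
    exact Real.rpow_nonneg hx.le _
  have key : ∫⁻ x, ENNReal.ofReal (x ^ (-α)) ∂ν ≤ ENNReal.ofReal (16 * (1 / 4800) ^ (-α)) := by
    have e : ∫⁻ x, ENNReal.ofReal (x ^ (-α)) ∂ν =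
        ∫⁻ x in ⋃ n : ℕ, Ioi (1 / ((n : ℝ) + 1)), ENNReal.ofReal (x ^ (-α)) ∂ν := by
      rw [Measure.restrict_eq_self_of_ae_mem]
      filter_upwards [h.pos] with x hx
      obtain ⟨n, hn⟩ := exists_nat_one_div_lt hx
      exact mem_iUnion.2 ⟨n, hn⟩
    rw [e, setLIntegral_iUnion_of_directed]
    · exact iSup_le fun n => h.neg_moment_truncated hε hα hα2 (by positivity)
    · refine Monotone.directed_le ?_
      intro m n hmn
      refine Ioi_subset_Ioi ?_
      have : (m : ℝ) ≤ n := by exact_mod_cast hmn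
      gcongr
  refine ⟨⟨hm1.aestronglyMeasurable, ?_⟩, ?_⟩
  · rw [hasFiniteIntegral_iff_ofReal nn]
    exact key.trans_lt ENNReal.ofReal_lt_top
  · rw [integral_eq_lintegral_of_nonneg_ae nn hm1.aestronglyMeasurable]
    exact ENNReal.toReal_le_of_le_ofReal (by positivity) key

end IsProfileMeasure

/-! ### From normalized profiles to profile measures. -/

/-- The measure `f(x) dx` on `(0, ∞)`. -/
def profileMeasure (f : ℝ → ℝ) : Measure ℝ :=
  (volume.restrict (Ioi (0 : ℝ))).withDensity fun x => ENNReal.ofReal (f x)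

/-- The restriction of `W(·, 1)` to `(0, ∞)`. -/
def ratioKernel (w : ℂ → ℂ) : ℝ → ℝ := (Ioi (0 : ℝ)).piecewise (fun r => (w r).re) 0

lemma measurable_ratioKernel {α : ℝ} {W : ℝ → ℝ → ℝ} {w : ℂ → ℂ} (hK : IsAdmissibleKernel α W w) :
    Measurable (ratioKernel w) := by
  classical
  refine ContinuousOn.measurable_piecewise ?_ continuousOn_const measurableSet_Ioi
  refine Complex.continuous_re.comp_continuousOn ?_
  refine hK.analytic.continuousOn.comp Complex.continuous_ofReal.continuousOn ?_
  intro x hx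
  exact Complex.ofReal_mem_slitPlane.2 hx

lemma ratioKernel_eq {α : ℝ} {W : ℝ → ℝ → ℝ} {w : ℂ → ℂ} (hK : IsAdmissibleKernel α W w) {y z : ℝ}
    (hy : 0 < y) (hz : 0 < z) : ratioKernel w (y / z) = W y z := by
  have h0 : 0 < y / z := div_pos hy hz
  rw [ratioKernel, piecewise_eq_of_mem _ _ _ (mem_Ioi.2 h0), hK.extends_W _ h0, Complex.ofReal_re]
  have := hK.homogeneous z (y / z) 1 hz h0 one_pos
  rw [mul_one, mul_div_cancel₀ _ hz.ne'] at this
  exact this.symm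

lemma rpow_le_one_add {r α : ℝ} (hr : 0 < r) (h0 : 0 ≤ α) (h1 : α ≤ 1) : r ^ α ≤ 1 + r := by
  rcases le_total r 1 with h | h
  · have := Real.rpow_le_one hr.le h h0
    linarith
  · have := Real.rpow_le_rpow_of_exponent_le h h1
    rw [Real.rpow_one] at this
    linarith

section

variable {α ε : ℝ} {W : ℝ → ℝ → ℝ} {w : ℂ → ℂ} {f : ℝ → ℝ}

lemma IsNormalizedProfile.integrableOn (hf : IsNormalizedProfile ε W f) :
    IntegrableOn f (Ioi 0) := by
  have h1 : IntegrableOn f (Ioc 0 1) :=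
    (hf.locallyIntegrable.integrableOn_compact_subset (Icc_subset_Ici_self (a := (1 : ℝ)) (b := (0 : ℝ)))
      isCompact_Icc).mono_set Ioc_subset_Icc_self
  have hm : AEStronglyMeasurable f (volume.restrict (Ioi 1)) :=
    (hf.locallyIntegrable.aestronglyMeasurable).mono_measure
      (Measure.restrict_mono (Ioi_subset_Ici_self.trans (Ici_subset_Ici.2 zero_le_one)) le_rfl)
  have h2 : IntegrableOn f (Ioi 1) := by
    refine Integrable.mono' ((hf.finite_mass.mono_set (Ioi_subset_Ioi zero_le_one)).norm) hm ?_
    filter_upwards [ae_restrict_mem measurableSet_Ioi] with x hx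
    rw [norm_mul]
    refine le_mul_of_one_le_left (norm_nonneg _) ?_
    rw [Real.norm_of_nonneg (by linarith [mem_Ioi.1 hx])]
    exact le_of_lt hx
  rw [← Ioc_union_Ioi_eq_Ioi (zero_le_one (α := ℝ))]
  exact h1.union h2

lemma IsNormalizedProfile.aemeasurable (hf : IsNormalizedProfile ε W f) :
    AEMeasurable (fun x => ENNReal.ofReal (f x)) (volume.restrict (Ioi 0)) :=
  hf.integrableOn.aestronglyMeasurable.aemeasurable.ennreal_ofReal

lemma IsNormalizedProfile.ae_pos (_hf : IsNormalizedProfile ε W f) :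
    ∀ᵐ x ∂(profileMeasure f), 0 < x :=
  (withDensity_absolutelyContinuous _ _).ae_le (ae_restrict_mem measurableSet_Ioi)

lemma IsNormalizedProfile.integrable_iff {E : Type*} [NormedAddCommGroup E] [NormedSpace ℝ E]
    (hf : IsNormalizedProfile ε W f) {g : ℝ → E} :
    Integrable g (profileMeasure f) ↔ IntegrableOn (fun x => f x • g x) (Ioi 0) := by
  rw [profileMeasure, integrable_withDensity_iff_integrable_smul₀' hf.aemeasurable
    (Eventually.of_forall fun x => ENNReal.ofReal_lt_top)]
  refine integrable_congr ?_
  filter_upwards [hf.nonneg] with x hx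
  rw [ENNReal.toReal_ofReal hx]

lemma IsNormalizedProfile.integral_eq {E : Type*} [NormedAddCommGroup E] [NormedSpace ℝ E]
    (hf : IsNormalizedProfile ε W f) (g : ℝ → E) :
    ∫ x, g x ∂(profileMeasure f) = ∫ x in Ioi 0, f x • g x := by
  rw [profileMeasure, integral_withDensity_eq_integral_toReal_smul₀ hf.aemeasurable
    (Eventually.of_forall fun x => ENNReal.ofReal_lt_top)]
  refine integral_congr_ae ?_
  filter_upwards [hf.nonneg] with x hx
  rw [ENNReal.toReal_ofReal hx]

lemma IsNormalizedProfile.exp_bounds (hf : IsNormalizedProfile ε W f) :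
    ∃ X : ℝ, 0 < X ∧ ∀ᵐ x ∂volume.restrict (Ioi (0 : ℝ)), X ≤ x →
      Real.exp (-2 * x) ≤ f x ∧ f x ≤ Real.exp (-(3 / 4) * x) := by
  have h1 := hf.decay (Ioo_mem_nhds (show (3 / 4 : ℝ) < 1 by norm_num) (one_lt_two))
  rw [mem_map, mem_inf_iff_superset] at h1
  obtain ⟨t, ht, u, hu, hsub⟩ := h1
  obtain ⟨X, hX⟩ := mem_atTop_sets.1 ht
  refine ⟨max X 1, by positivity, ?_⟩
  filter_upwards [hf.nonneg, ae_restrict_of_ae hu] with x hx hxu hXx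
  have hx1 : 0 < x := lt_of_lt_of_le one_pos ((le_max_right _ _).trans hXx)
  have hm := hsub ⟨hX x ((le_max_left _ _).trans hXx), hxu⟩
  rw [mem_preimage, mem_Ioo, lt_div_iff₀ hx1, div_lt_iff₀ hx1] at hm
  -- Since `Real.log 0 = 0`, a zero of f would make the quotient 0, outside (3/4, 2).
  have hfx : 0 < f x := by
    rcases hx.lt_or_eq with h | h
    · exact h
    · rw [← h] at hm
      simp at hm
      linarith
  rw [← Real.le_log_iff_exp_le hfx, ← Real.log_le_iff_le_exp hfx]
  constructor <;> linarith

/-- Tonelli: the domain 0 < y < x, z > x - y of the equation is, for fixed positive y and z, the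
interval y < x < y + z. A measurable version of the density is used to make the triple integrand
measurable. -/
lemma IsNormalizedProfile.lintegral_eq (hK : IsAdmissibleKernel α W w)
    (hf : IsNormalizedProfile ε W f) (hε : 0 < ε) (φ : ℝ → ENNReal) (hφ : Measurable φ) :
    ∫⁻ x, ENNReal.ofReal (x ^ 2) * φ x ∂(profileMeasure f) =
      ∫⁻ y, ∫⁻ z, ENNReal.ofReal (y * (2 + ε * ratioKernel w (y / z))) *
        (∫⁻ x in Ioo y (y + z), φ x) ∂(profileMeasure f) ∂(profileMeasure f) := by
  have hv := measurable_ratioKernel hK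
  obtain ⟨ρ, hρm, hρ⟩ := hf.aemeasurable
  have hν : profileMeasure f = (volume.restrict (Ioi (0 : ℝ))).withDensity ρ :=
    withDensity_congr_ae hρ
  set A : ℝ → ℝ → ENNReal := fun y z =>
    ENNReal.ofReal (y * (2 + ε * ratioKernel w (y / z))) * (ρ y * ρ z) with hA
  have hAm : Measurable fun p : ℝ × ℝ => A p.1 p.2 := by
    simp only [hA]; fun_prop
  have hρ' : ∀ᵐ x, x ∈ Ioi (0 : ℝ) → ENNReal.ofReal (f x) = ρ x :=
    (ae_restrict_iff' measurableSet_Ioi).1 hρ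
  have hf' : ∀ᵐ x, x ∈ Ioi (0 : ℝ) → 0 ≤ f x := (ae_restrict_iff' measurableSet_Ioi).1 hf.nonneg
  have step1 : ∀ᵐ x ∂volume.restrict (Ioi (0 : ℝ)), ENNReal.ofReal (x ^ 2) * ρ x =
      ∫⁻ y in Ioo 0 x, ∫⁻ z in Ioi (x - y), A y z := by
    filter_upwards [hf.equation, hρ] with x hx hxρ
    rw [← hxρ, ← ENNReal.ofReal_mul (sq_nonneg x), hx]
    refine lintegral_congr_ae ?_
    filter_upwards [ae_restrict_mem measurableSet_Ioo, ae_restrict_of_ae hρ',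
      ae_restrict_of_ae hf'] with y hy hyρ hyf
    refine lintegral_congr_ae ?_
    filter_upwards [ae_restrict_mem measurableSet_Ioi, ae_restrict_of_ae hρ',
      ae_restrict_of_ae hf'] with z hz hzρ hzf
    have hz0 : 0 < z := lt_trans (by linarith [hy.2]) hz
    have hy0 := hy.1
    have hyf' := hyf hy0
    have hW := hK.nonneg y z hy0 hz0
    simp only [hA]
    rw [ratioKernel_eq hK hy0 hz0, ← hyρ hy0, ← hzρ hz0, ← ENNReal.ofReal_mul hyf',
      ← ENNReal.ofReal_mul (by positivity)]
    congr 1; ring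
  set S : Set (ℝ × ℝ × ℝ) := {q | 0 < q.2.1 ∧ q.2.1 < q.1 ∧ q.1 - q.2.1 < q.2.2} with hS
  have hSm : MeasurableSet S := by
    have m1 : MeasurableSet {q : ℝ × ℝ × ℝ | 0 < q.2.1} :=
      measurableSet_lt (by fun_prop) (by fun_prop)
    have m2 : MeasurableSet {q : ℝ × ℝ × ℝ | q.2.1 < q.1} :=
      measurableSet_lt (by fun_prop) (by fun_prop)
    have m3 : MeasurableSet {q : ℝ × ℝ × ℝ | q.1 - q.2.1 < q.2.2} :=
      measurableSet_lt (by fun_prop) (by fun_prop)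
    exact m1.inter (m2.inter m3)
  have hT0 : Measurable (S.indicator (fun q : ℝ × ℝ × ℝ => A q.2.1 q.2.2)) :=
    (hAm.comp measurable_snd).indicator hSm
  have hTm : Measurable (S.indicator (fun q : ℝ × ℝ × ℝ => φ q.1 * A q.2.1 q.2.2)) :=
    ((hφ.comp measurable_fst).mul (hAm.comp measurable_snd)).indicator hSm
  set T : ℝ → ℝ → ℝ → ENNReal := fun x y z =>
    S.indicator (fun q => φ q.1 * A q.2.1 q.2.2) (x, y, z) with hT
  have hin : ∀ x, ∫⁻ y, ∫⁻ z, T x y z = φ x * ∫⁻ y in Ioo 0 x, ∫⁻ z in Ioi (x - y), A y z := by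
    intro x
    have e1 : ∀ y, (Ioo 0 x).indicator (fun y => ∫⁻ z in Ioi (x - y), A y z) y =
        ∫⁻ z, S.indicator (fun q => A q.2.1 q.2.2) (x, y, z) := by
      intro y
      by_cases hy : y ∈ Ioo 0 x
      · rw [indicator_of_mem hy, ← lintegral_indicator measurableSet_Ioi]
        refine lintegral_congr fun z => ?_
        simp only [indicator, hS, mem_Ioi, mem_ofPred_eq]
        simp [hy.1, hy.2]
      · rw [indicator_of_notMem hy]
        symm
        rw [lintegral_eq_zero_of_ae_eq_zero]
        refine Eventually.of_forall fun z => ?_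
        refine indicator_of_notMem (fun hm => hy ⟨hm.1, hm.2.1⟩) _
    have hm2 : ∀ y, Measurable fun z => S.indicator (fun q => A q.2.1 q.2.2) (x, y, z) := fun y =>
      hT0.comp (by fun_prop)
    have hm3 : Measurable fun y => ∫⁻ z, S.indicator (fun q => A q.2.1 q.2.2) (x, y, z) :=
      Measurable.lintegral_prod_right' (f := fun p : ℝ × ℝ =>
        S.indicator (fun q => A q.2.1 q.2.2) (x, p.1, p.2))
        (hT0.comp (measurable_const.prodMk measurable_id))
    rw [← lintegral_indicator measurableSet_Ioo, lintegral_congr e1, ← lintegral_const_mul _ hm3]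
    refine lintegral_congr fun y => ?_
    rw [← lintegral_const_mul _ (hm2 y)]
    refine lintegral_congr fun z => ?_
    simp only [hT, indicator]
    split_ifs <;> simp
  have step2 : ∫⁻ x, ENNReal.ofReal (x ^ 2) * φ x ∂(profileMeasure f) =
      ∫⁻ x, ∫⁻ y, ∫⁻ z, T x y z := by
    rw [hν, lintegral_withDensity_eq_lintegral_mul _ hρm (by fun_prop)]
    have : ∫⁻ x in Ioi (0 : ℝ), (ρ * fun x => ENNReal.ofReal (x ^ 2) * φ x) x =
        ∫⁻ x in Ioi (0 : ℝ), φ x * ∫⁻ y in Ioo 0 x, ∫⁻ z in Ioi (x - y), A y z := by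
      refine lintegral_congr_ae ?_
      filter_upwards [step1] with x hx
      rw [← hx, Pi.mul_apply]; ring
    rw [this, ← lintegral_indicator measurableSet_Ioi]
    refine lintegral_congr fun x => ?_
    rw [hin]
    by_cases hx : x ∈ Ioi (0 : ℝ)
    · rw [indicator_of_mem hx]
    · rw [indicator_of_notMem hx, Ioo_eq_empty hx]
      simp
  have swap1 : ∫⁻ x, ∫⁻ y, ∫⁻ z, T x y z = ∫⁻ y, ∫⁻ x, ∫⁻ z, T x y z := by
    refine lintegral_lintegral_swap (Measurable.aemeasurable ?_)
    exact Measurable.lintegral_prod_right' (f := fun p : (ℝ × ℝ) × ℝ =>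
        S.indicator (fun q => φ q.1 * A q.2.1 q.2.2) (p.1.1, p.1.2, p.2))
        (hTm.comp ((measurable_fst.comp measurable_fst).prodMk
          ((measurable_snd.comp measurable_fst).prodMk measurable_snd)))
  have swap2 : ∀ y, ∫⁻ x, ∫⁻ z, T x y z = ∫⁻ z, ∫⁻ x, T x y z := by
    intro y
    refine lintegral_lintegral_swap (Measurable.aemeasurable ?_)
    exact hTm.comp (g := S.indicator (fun q : ℝ × ℝ × ℝ => φ q.1 * A q.2.1 q.2.2))
      (f := fun p : ℝ × ℝ => (p.1, y, p.2)) (by fun_prop)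
  have hI := measurable_lintegral_Ioo hφ
  have hh : Measurable fun p : ℝ × ℝ =>
      ENNReal.ofReal (p.1 * (2 + ε * ratioKernel w (p.1 / p.2))) *
        ∫⁻ x in Ioo p.1 (p.1 + p.2), φ x := by fun_prop
  have hy1 : ∀ y, Measurable fun z => ENNReal.ofReal (y * (2 + ε * ratioKernel w (y / z))) *
        ∫⁻ x in Ioo y (y + z), φ x := fun y => hh.comp (measurable_const.prodMk measurable_id)
  have inner : ∀ y z, 0 < y → ∫⁻ x, T x y z = (Ioi 0).indicator (fun z => ρ y * (ρ z *
      (ENNReal.ofReal (y * (2 + ε * ratioKernel w (y / z))) *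
        ∫⁻ x in Ioo y (y + z), φ x))) z := by
    intro y z hy
    have e1 : ∫⁻ x, T x y z = ∫⁻ x in Ioo y (y + z), φ x * A y z := by
      rw [← lintegral_indicator measurableSet_Ioo]
      refine lintegral_congr fun x => ?_
      simp only [hT, hS, indicator, mem_ofPred_eq, mem_Ioo, hy, true_and]
      refine if_congr (and_congr_right fun _ => ?_) rfl rfl
      constructor <;> intro <;> linarith
    rw [e1, lintegral_mul_const _ hφ]
    by_cases hz : z ∈ Ioi (0 : ℝ)
    · rw [indicator_of_mem hz]
      simp only [hA]
      ring
    · rw [indicator_of_notMem hz, Ioo_eq_empty (by rw [mem_Ioi] at hz; linarith)]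
      simp
  rw [step2, swap1, hν, lintegral_withDensity_eq_lintegral_mul _ hρm]
  · rw [← lintegral_indicator measurableSet_Ioi]
    refine lintegral_congr fun y => ?_
    rw [swap2]
    by_cases hy : y ∈ Ioi (0 : ℝ)
    · rw [indicator_of_mem hy, lintegral_congr fun z => inner y z hy,
        lintegral_indicator measurableSet_Ioi, Pi.mul_apply,
        lintegral_withDensity_eq_lintegral_mul _ hρm (hy1 y),
        ← lintegral_const_mul _ (hρm.mul (hy1 y))]
      rfl
    · rw [indicator_of_notMem hy, lintegral_eq_zero_of_ae_eq_zero]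
      refine Eventually.of_forall fun z => ?_
      show ∫⁻ x, T x y z = 0
      rw [lintegral_eq_zero_of_ae_eq_zero]
      refine Eventually.of_forall fun x => ?_
      exact indicator_of_notMem (fun hm => hy hm.1) _
  · exact (hh.lintegral_prod_right' (ν := (volume.restrict (Ioi (0 : ℝ))).withDensity ρ))

lemma IsNormalizedProfile.isProfileMeasure (hα : 0 < α) (hα2 : α < 1 / 2)
    (hK : IsAdmissibleKernel α W w) (hf : IsNormalizedProfile ε W f) (hε : 0 < ε) :
    IsProfileMeasure ε (ratioKernel w) (profileMeasure f) where
  finite := by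
    refine ⟨?_⟩
    rw [profileMeasure, withDensity_apply _ MeasurableSet.univ, Measure.restrict_univ]
    exact (hasFiniteIntegral_iff_ofReal hf.nonneg).1 hf.integrableOn.2
  pos := hf.ae_pos
  eps_pos := hε
  measurable_v := measurable_ratioKernel hK
  v_nonneg := fun r hr => by
    have := ratioKernel_eq hK hr one_pos
    rw [div_one] at this
    rw [this]; exact hK.nonneg _ _ hr one_pos
  v_le := fun r hr => by
    have := ratioKernel_eq hK hr one_pos
    rw [div_one] at this
    rw [this]
    have h1 := hK.le_powers r 1 hr one_pos
    have h2 := rpow_le_one_add hr hα.le (by linarith)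
    have h3 := rpow_le_one_add (inv_pos.2 hr) hα.le (by linarith)
    rw [div_one, one_div] at h1
    linarith
  v_inv := fun r hr => by
    have h1 := ratioKernel_eq hK hr one_pos
    have h2 := ratioKernel_eq hK one_pos hr
    rw [div_one] at h1
    rw [one_div] at h2
    rw [h1, h2, hK.symmetric _ _ one_pos hr]
  equation := hf.lintegral_eq hK hε
  exp_integrable := by
    obtain ⟨X, hX, hb⟩ := hf.exp_bounds
    rw [hf.integrable_iff]
    have hg : IntegrableOn (fun x => Real.exp (-(1 / 4) * x)) (Ioi 0) :=
      exp_neg_integrableOn_Ioi 0 (by norm_num)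
    refine Integrable.mono' ((hf.integrableOn.const_mul (Real.exp (X / 2))).add hg)
      (hf.integrableOn.aestronglyMeasurable.smul (by fun_prop)) ?_
    filter_upwards [hb, hf.nonneg] with x hx hfx
    rw [norm_smul, Real.norm_of_nonneg hfx, Real.norm_of_nonneg (Real.exp_pos _).le, Pi.add_apply]
    rcases le_total X x with h | h
    · have h1 := (hx h).2
      have h2 : f x * Real.exp (x / 2) ≤ Real.exp (-(1 / 4) * x) := by
        calc f x * Real.exp (x / 2) ≤ Real.exp (-(3 / 4) * x) * Real.exp (x / 2) := by gcongr
          _ = Real.exp (-(1 / 4) * x) := by rw [← Real.exp_add]; congr 1; ring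
      have h3 : 0 ≤ Real.exp (X / 2) * f x := by positivity
      linarith
    · have h2 : f x * Real.exp (x / 2) ≤ Real.exp (X / 2) * f x := by
        rw [mul_comm]; gcongr
      have := Real.exp_pos (-(1 / 4) * x)
      linarith
  exp_not_integrable := by
    obtain ⟨X, hX, hb⟩ := hf.exp_bounds
    rw [hf.integrable_iff]
    intro hi
    have h1 : IntegrableOn (fun _ : ℝ => (1 : ℝ)) (Ioi X) := by
      refine Integrable.mono' (hi.mono_set (Ioi_subset_Ioi hX.le)) (by fun_prop) ?_
      filter_upwards [ae_restrict_of_ae_restrict_of_subset (Ioi_subset_Ioi hX.le) hb,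
        ae_restrict_mem measurableSet_Ioi] with x hx hxX
      have h1 := (hx (le_of_lt hxX)).1
      have hx0 : 0 < x := hX.trans hxX
      rw [norm_one, smul_eq_mul]
      calc (1 : ℝ) ≤ Real.exp x := Real.one_le_exp hx0.le
        _ = Real.exp (-2 * x) * Real.exp (3 * x) := by rw [← Real.exp_add]; congr 1; ring
        _ ≤ f x * Real.exp (3 * x) := by gcongr
    rw [integrableOn_const_iff] at h1
    simp at h1

lemma IsNormalizedProfile.kappa_eq (hf : IsNormalizedProfile ε W f) :
    kappa (muOf f) = 2 * (profileMeasure f).real univ - 2 := by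
  have : (profileMeasure f).real univ = ∫ x, (1 : ℝ) ∂(profileMeasure f) := by simp
  rw [this, hf.integral_eq, kappa, ← integral_const_mul]
  congr 2
  ext z
  rw [muOf, smul_eq_mul, mul_one, mul_assoc, mul_assoc, ← Real.exp_add]
  simp

lemma IsNormalizedProfile.betaW_eq (hf : IsNormalizedProfile ε W f) (y : ℂ) :
    betaW w (muOf f) y = ∫ z, w (y / z) ∂(profileMeasure f) := by
  rw [hf.integral_eq, betaW]
  congr 1
  ext z
  rw [muOf, Complex.real_smul, mul_assoc, ← Complex.ofReal_mul, mul_assoc, ← Real.exp_add]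
  simp [mul_comm]

end

end SelfSim
end

/-! ### Uniform size, analyticity and positivity of b = εβ_W. -/

noncomputable section

namespace SelfSim

/-- The properties of `b = ε β_W` on which the estimate of `H₀` depends. -/
structure IsRate (α C c ε : ℝ) (b : ℂ → ℂ) : Prop where
  diff : DifferentiableOn ℂ b Complex.slitPlane
  bound : ∀ x ∈ Complex.slitPlane, ‖b x‖ ≤ C * ε * (‖x‖ ^ (-α) + ‖x‖ ^ α)
  lower : ∀ x : ℂ, x.re = 0 → x ≠ 0 → ‖x‖ ≤ 1 →
    c * ε * ‖x‖ ^ (-α) - C * ε * ‖x‖ ≤ (b x).re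

lemma div_ofReal_mem_slitPlane {x : ℂ} (hx : x ∈ Complex.slitPlane) {z : ℝ} (hz : 0 < z) :
    x / (z : ℂ) ∈ Complex.slitPlane := by
  rw [Complex.mem_slitPlane_iff] at hx ⊢
  rw [Complex.div_ofReal_re, Complex.div_ofReal_im]
  rcases hx with h | h
  · exact Or.inl (div_pos h hz)
  · exact Or.inr (div_ne_zero h hz.ne')

lemma mem_slitPlane_of_re_eq_zero {x : ℂ} (hx : x.re = 0) (hx0 : x ≠ 0) :
    x ∈ Complex.slitPlane := by
  rw [Complex.mem_slitPlane_iff]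
  refine Or.inr fun h => hx0 ?_
  exact Complex.ext hx h

lemma norm_div_ofReal (x : ℂ) {z : ℝ} (hz : 0 < z) : ‖x / (z : ℂ)‖ = ‖x‖ / z := by
  rw [norm_div, Complex.norm_real, Real.norm_of_nonneg hz.le]

section

variable {α : ℝ} {W : ℝ → ℝ → ℝ} {w : ℂ → ℂ}

lemma IsAdmissibleKernel.exists_growth (hK : IsAdmissibleKernel α W w) :
    ∃ C : ℝ, 1 ≤ C ∧ ∀ x ∈ Complex.slitPlane, ∀ z : ℝ, 0 < z →
      ‖w (x / z)‖ ≤ C * (‖x‖ ^ (-α) * z ^ α + ‖x‖ ^ α * z ^ (-α)) := by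
  obtain ⟨C, hC⟩ := hK.growth
  refine ⟨max C 1, le_max_right _ _, fun x hx z hz => ?_⟩
  have hx0 : 0 < ‖x‖ := norm_pos_iff.2 (Complex.slitPlane_ne_zero hx)
  refine (hC _ (div_ofReal_mem_slitPlane hx hz)).trans ?_
  rw [norm_div_ofReal x hz]
  have e : 1 / (‖x‖ / z) ^ α + (‖x‖ / z) ^ α = ‖x‖ ^ (-α) * z ^ α + ‖x‖ ^ α * z ^ (-α) := by
    rw [Real.div_rpow hx0.le hz.le, Real.rpow_neg hx0.le, Real.rpow_neg hz.le]
    have := Real.rpow_pos_of_pos hx0 α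
    have := Real.rpow_pos_of_pos hz α
    field_simp
  rw [e]
  gcongr
  exact le_max_left _ _

/-- On the imaginary axis |α arg x| ≤ π/4 since α < 1/2, so Re x^{-α} ≥ |x|^{-α}/2. The asymptotics
with error C_W/4 then leave the constant C_W/4. -/
lemma IsAdmissibleKernel.exists_re_lower (hα : 0 < α) (hα2 : α < 1 / 2)
    (hK : IsAdmissibleKernel α W w) :
    ∃ c δ : ℝ, 0 < c ∧ 0 < δ ∧ ∀ x : ℂ, x.re = 0 → x ≠ 0 → ‖x‖ < δ →
      c * ‖x‖ ^ (-α) ≤ (w x).re := by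
  obtain ⟨C, hC, hlim⟩ := hK.asymptotics
  have h1 := hlim (Metric.closedBall_mem_nhds (C : ℂ) (show 0 < C / 4 by positivity))
  rw [mem_map, Metric.mem_nhdsWithin_iff] at h1
  obtain ⟨δ, hδ, hsub⟩ := h1
  refine ⟨C / 4, δ, by positivity, hδ, fun x hx hx0 hxδ => ?_⟩
  have hm := hsub ⟨by simpa using hxδ, mem_slitPlane_of_re_eq_zero hx hx0⟩
  rw [mem_preimage, Metric.mem_closedBall, dist_eq_norm] at hm
  have hn : 0 < ‖x‖ := norm_pos_iff.2 hx0
  set u : ℂ := x ^ (-(α : ℂ)) with hu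
  have hunorm : ‖u‖ = ‖x‖ ^ (-α) := by
    rw [hu, ← Complex.ofReal_neg, Complex.norm_cpow_real]
  have hure : ‖x‖ ^ (-α) / 2 ≤ u.re := by
    have e : u.re = ‖x‖ ^ (-α) * Real.cos (α * x.arg) := by
      rw [hu, Complex.cpow_def_of_ne_zero hx0, Complex.exp_re, Real.rpow_def_of_pos hn]
      simp only [Complex.mul_re, Complex.mul_im, Complex.log_re, Complex.log_im, Complex.neg_re,
        Complex.neg_im, Complex.ofReal_re, Complex.ofReal_im]
      rw [← Real.cos_neg (α * x.arg)]
      congr 2 <;> ring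
    rw [e, div_eq_mul_one_div]
    refine mul_le_mul_of_nonneg_left ?_ (by positivity)
    have harg : |x.arg| ≤ Real.pi / 2 := Complex.abs_arg_le_pi_div_two_iff.2 hx.ge
    have h3 : |α * x.arg| ≤ Real.pi / 3 := by
      rw [abs_mul, abs_of_pos hα]
      calc α * |x.arg| ≤ 1 / 2 * (Real.pi / 2) := by gcongr
        _ ≤ Real.pi / 3 := by linarith [Real.pi_pos]
    rw [← Real.cos_pi_div_three, ← Real.cos_abs (α * x.arg)]
    exact Real.cos_le_cos_of_nonneg_of_le_pi (abs_nonneg _) (by linarith [Real.pi_pos]) h3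
  have hw : w x = u * (C : ℂ) + u * (x ^ (α : ℂ) * w x - C) := by
    have : u * x ^ (α : ℂ) = 1 := by
      rw [hu, ← Complex.cpow_add _ _ hx0]; simp
    linear_combination (-(w x)) * this
  have h4 : |(u * (x ^ (α : ℂ) * w x - C)).re| ≤ ‖x‖ ^ (-α) * (C / 4) := by
    refine (Complex.abs_re_le_norm _).trans ?_
    rw [norm_mul, hunorm]
    gcongr
  rw [hw, Complex.add_re, Complex.re_mul_ofReal]
  have h5 := (abs_le.1 h4).1
  have h6 := mul_le_mul_of_nonneg_right hure hC.le
  linarith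

lemma IsAdmissibleKernel.continuousOn_div (hK : IsAdmissibleKernel α W w) {x : ℂ}
    (hx : x ∈ Complex.slitPlane) : ContinuousOn (fun z : ℝ => w (x / z)) (Ioi 0) := by
  refine hK.analytic.continuousOn.comp ?_ fun z hz => div_ofReal_mem_slitPlane hx hz
  refine continuousOn_const.div Complex.continuous_ofReal.continuousOn fun z hz => ?_
  exact Complex.ofReal_ne_zero.2 (ne_of_gt hz)

lemma _root_.ContinuousOn.aestronglyMeasurable_of_ae_mem {E : Type*} [NormedAddCommGroup E]
    {ν : Measure ℝ} (hν : ∀ᵐ x ∂ν, 0 < x) {g : ℝ → E} (hg : ContinuousOn g (Ioi 0)) :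
    AEStronglyMeasurable g ν := by
  have : ν = ν.restrict (Ioi 0) := (Measure.restrict_eq_self_of_ae_mem hν).symm
  rw [this]
  exact hg.aestronglyMeasurable measurableSet_Ioi

lemma IsAdmissibleKernel.integrable_div (hK : IsAdmissibleKernel α W w) {ν : Measure ℝ}
    (hν : ∀ᵐ x ∂ν, 0 < x) (h1 : Integrable (fun z => z ^ α) ν)
    (h2 : Integrable (fun z => z ^ (-α)) ν) {x : ℂ} (hx : x ∈ Complex.slitPlane) :
    Integrable (fun z : ℝ => w (x / z)) ν := by
  obtain ⟨C, hC1, hC⟩ := hK.exists_growth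
  refine (((h1.const_mul (‖x‖ ^ (-α))).add (h2.const_mul (‖x‖ ^ α))).const_mul C).mono'
    ((hK.continuousOn_div hx).aestronglyMeasurable_of_ae_mem hν) ?_
  filter_upwards [hν] with z hz
  exact hC x hx z hz

/-- Cauchy's estimate on a small disc turns the growth bound for w into an integrable bound for the
derivative of the integrand. -/
lemma IsAdmissibleKernel.differentiableOn_integral (hα : 0 < α) (hK : IsAdmissibleKernel α W w)
    {ν : Measure ℝ} (hν : ∀ᵐ x ∂ν, 0 < x) (h1 : Integrable (fun z => z ^ α) ν)
    (h2 : Integrable (fun z => z ^ (-α)) ν) :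
    DifferentiableOn ℂ (fun x => ∫ z : ℝ, w (x / z) ∂ν) Complex.slitPlane := by
  obtain ⟨C, hC1, hC⟩ := hK.exists_growth
  intro x₀ hx₀
  have hn : 0 < ‖x₀‖ := norm_pos_iff.2 (Complex.slitPlane_ne_zero hx₀)
  obtain ⟨δ₁, hδ₁, hsub₁⟩ := Metric.isOpen_iff.1 Complex.isOpen_slitPlane x₀ hx₀
  set δ := min (δ₁ / 3) (‖x₀‖ / 4) with hδ
  have hδp : 0 < δ := by positivity
  have hball : ∀ x ∈ Metric.ball x₀ δ, ∀ y ∈ Metric.closedBall x δ, y ∈ Complex.slitPlane ∧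
      ‖x₀‖ / 2 ≤ ‖y‖ ∧ ‖y‖ ≤ 2 * ‖x₀‖ := by
    intro x hx y hy
    have hd : dist y x₀ < 2 * δ := by
      have := dist_triangle y x x₀
      rw [Metric.mem_ball] at hx
      rw [Metric.mem_closedBall] at hy
      linarith
    have hd1 : δ ≤ δ₁ / 3 := min_le_left _ _
    have hd2 : δ ≤ ‖x₀‖ / 4 := min_le_right _ _
    rw [dist_eq_norm] at hd
    have a1 := norm_sub_norm_le y x₀
    have a2 := norm_sub_norm_le x₀ y
    rw [norm_sub_rev x₀ y] at a2
    exact ⟨hsub₁ (by rw [Metric.mem_ball, dist_eq_norm]; linarith), by linarith, by linarith⟩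
  have hdw : ∀ z : ℝ, 0 < z → ∀ y ∈ Complex.slitPlane,
      HasDerivAt (fun x => w (x / z)) (deriv w (y / z) * (1 / z)) y := by
    intro z hz y hy
    have h3 : HasDerivAt w (deriv w (y / z)) (y / z) :=
      (hK.analytic.differentiableAt (Complex.isOpen_slitPlane.mem_nhds
        (div_ofReal_mem_slitPlane hy hz))).hasDerivAt
    exact h3.comp y ((hasDerivAt_id' y).div_const (z : ℂ))
  have key := hasDerivAt_integral_of_dominated_loc_of_deriv_le (μ := ν) (𝕜 := ℂ)
    (F := fun x z => w (x / z)) (F' := fun x z => deriv w (x / z) * (1 / z)) (x₀ := x₀)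
    (bound := fun z => C * ((‖x₀‖ / 2) ^ (-α) * z ^ α + (2 * ‖x₀‖) ^ α * z ^ (-α)) / δ)
    (Metric.ball_mem_nhds x₀ hδp) ?_ (hK.integrable_div hν h1 h2 hx₀) ?_ ?_ ?_ ?_
  · exact key.2.differentiableAt.differentiableWithinAt
  · filter_upwards [Complex.isOpen_slitPlane.mem_nhds hx₀] with x hx
    exact (hK.continuousOn_div hx).aestronglyMeasurable_of_ae_mem hν
  · refine ContinuousOn.aestronglyMeasurable_of_ae_mem hν ?_
    have hd := (hK.analytic.deriv Complex.isOpen_slitPlane).continuousOn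
    have hc : ContinuousOn (fun z : ℝ => x₀ / (z : ℂ)) (Ioi 0) :=
      continuousOn_const.div Complex.continuous_ofReal.continuousOn
        fun z hz => Complex.ofReal_ne_zero.2 (ne_of_gt hz)
    refine (hd.comp hc fun z hz => div_ofReal_mem_slitPlane hx₀ hz).mul ?_
    exact continuousOn_const.div Complex.continuous_ofReal.continuousOn
        fun z hz => Complex.ofReal_ne_zero.2 (ne_of_gt hz)
  · filter_upwards [hν] with z hz x hx
    have hxm := (hball x hx x (Metric.mem_closedBall_self hδp.le)).1
    rw [← (hdw z hz x hxm).deriv]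
    refine Complex.norm_deriv_le_of_forall_mem_sphere_norm_le hδp ?_ ?_
    · refine DifferentiableOn.diffContOnCl ?_
      rw [closure_ball _ hδp.ne']
      intro y hy
      exact (hdw z hz y (hball x hx y hy).1).differentiableAt.differentiableWithinAt
    · intro y hy
      obtain ⟨b1, b2, b3⟩ := hball x hx y (Metric.sphere_subset_closedBall hy)
      refine (hC y b1 z hz).trans ?_
      have e1 : ‖y‖ ^ (-α) ≤ (‖x₀‖ / 2) ^ (-α) :=
        Real.rpow_le_rpow_of_nonpos (by positivity) b2 (by linarith)
      have e2 : ‖y‖ ^ α ≤ (2 * ‖x₀‖) ^ α := Real.rpow_le_rpow (norm_nonneg _) b3 hα.le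
      gcongr
  · exact (((h1.const_mul _).add (h2.const_mul _)).const_mul C).div_const δ
  · filter_upwards [hν] with z hz x hx
    exact hdw z hz x (hball x hx x (Metric.mem_closedBall_self hδp.le)).1

/-- Uniform properties of `ε β_W` and `κ` for normalized profiles. -/
lemma IsAdmissibleKernel.exists_isRate (hα : 0 < α) (hα2 : α < 1 / 2)
    (hK : IsAdmissibleKernel α W w) :
    ∃ C c : ℝ, 1 ≤ C ∧ 0 < c ∧ ∀ ε : ℝ, 0 < ε → ε ≤ 1 / 10 ^ 7 →
      ∀ f : ℝ → ℝ, IsNormalizedProfile ε W f →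
        IsRate α C c ε (fun x => ε * betaW w (muOf f) x) ∧
        -1 / 4 ≤ kappa (muOf f) ∧ kappa (muOf f) ≤ 0 := by
  obtain ⟨Cw, hCw1, hCw⟩ := hK.exists_growth
  obtain ⟨c₀, δ, hc₀, hδ, hlow⟩ := hK.exists_re_lower hα hα2
  -- The threshold of `tail_ge`: mass at least 13/16 lies beyond r, and for these z the point x/z is
  -- within δ of 0 as soon as |x| < δr.
  set r : ℝ := 1 / 4800 with hr
  have hrp : 0 < r := by norm_num [hr]
  set c : ℝ := c₀ * r ^ α * (13 / 16) with hc
  have hcp : 0 < c := by positivity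
  set v₀ : ℝ := δ * r with hv₀
  have hv₀p : 0 < v₀ := by positivity
  set Cm : ℝ := 16 * r ^ (-α) + 3 with hCm
  have hCmp : 3 ≤ Cm := by
    have : 0 ≤ 16 * r ^ (-α) := by positivity
    linarith
  refine ⟨Cw * Cm + c * v₀ ^ (-α) / v₀, c, ?_, hcp, fun ε hε hε1 f hf => ?_⟩
  · have h1 : 0 ≤ c * v₀ ^ (-α) / v₀ := by positivity
    have h2 : 1 * 3 ≤ Cw * Cm := mul_le_mul hCw1 hCmp (by norm_num) (by linarith)
    linarith
  have hp := hf.isProfileMeasure hα hα2 hK hε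
  have hfin := hp.finite
  set ν := profileMeasure f with hν
  have hM1 := hp.mass_le_one
  have hM2 := hp.mass_ge hε1
  obtain ⟨hneg, hnegle⟩ := hp.neg_moment hε1 hα hα2
  have hm1 := hp.normMoment_one_le
  rw [hp.normMoment_one] at hm1
  have hpos : Integrable (fun z : ℝ => z ^ α) ν := by
    refine ((integrable_const (1 : ℝ)).add hp.integrable_id).mono' (by fun_prop) ?_
    filter_upwards [hp.pos] with z hz
    rw [Real.norm_of_nonneg (Real.rpow_nonneg hz.le _)]
    exact rpow_le_one_add hz hα.le (by linarith)
  have hposle : ∫ z, z ^ α ∂ν ≤ 3 := by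
    have : ∫ z, z ^ α ∂ν ≤ ∫ z, (1 + z) ∂ν := by
      refine integral_mono_ae hpos ((integrable_const (1 : ℝ)).add hp.integrable_id) ?_
      filter_upwards [hp.pos] with z hz
      exact rpow_le_one_add hz hα.le (by linarith)
    rw [integral_add (integrable_const _) hp.integrable_id] at this
    simp at this
    linarith
  have hpos0 : 0 ≤ ∫ z, z ^ α ∂ν := integral_nonneg_of_ae (by
    filter_upwards [hp.pos] with z hz
    exact Real.rpow_nonneg hz.le _)
  have hneg0 : 0 ≤ ∫ z, z ^ (-α) ∂ν := integral_nonneg_of_ae (by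
    filter_upwards [hp.pos] with z hz
    exact Real.rpow_nonneg hz.le _)
  have hint : ∀ x ∈ Complex.slitPlane, Integrable (fun z : ℝ => w (x / z)) ν := fun x hx =>
    hK.integrable_div hp.pos hpos hneg hx
  have hbeta : (fun x => ε * betaW w (muOf f) x) = fun x => ε * ∫ z : ℝ, w (x / z) ∂ν := by
    ext x; rw [hf.betaW_eq]
  have hre : ∀ x ∈ Complex.slitPlane, (ε * ∫ z : ℝ, w (x / z) ∂ν : ℂ).re =
      ε * ∫ z : ℝ, (w (x / z)).re ∂ν := by
    intro x hx
    rw [Complex.re_ofReal_mul]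
    congr 1
    exact (integral_re (𝕜 := ℂ) (hint x hx)).symm
  refine ⟨⟨?_, ?_, ?_⟩, ?_, ?_⟩
  · rw [hbeta]
    exact (hK.differentiableOn_integral hα hp.pos hpos hneg).const_mul _
  · intro x hx
    rw [congrFun hbeta x, norm_mul, Complex.norm_real, Real.norm_of_nonneg hε.le]
    have h1 : ‖∫ z : ℝ, w (x / z) ∂ν‖ ≤ Cw * (‖x‖ ^ (-α) * ∫ z, z ^ α ∂ν + ‖x‖ ^ α *
        ∫ z, z ^ (-α) ∂ν) := by
      rw [← integral_const_mul, ← integral_const_mul,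
        ← integral_add (hpos.const_mul _) (hneg.const_mul _), ← integral_const_mul]
      refine norm_integral_le_of_norm_le (((hpos.const_mul _).add (hneg.const_mul _)).const_mul _) ?_
      filter_upwards [hp.pos] with z hz
      exact hCw x hx z hz
    have h2 : Cw * (‖x‖ ^ (-α) * ∫ z, z ^ α ∂ν + ‖x‖ ^ α * ∫ z, z ^ (-α) ∂ν) ≤
        Cw * (‖x‖ ^ (-α) * Cm + ‖x‖ ^ α * Cm) := by
      gcongr
      · linarith
      · linarith
    have h3 : 0 ≤ c * v₀ ^ (-α) / v₀ * ε * (‖x‖ ^ (-α) + ‖x‖ ^ α) := by positivity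
    have h4 := mul_le_mul_of_nonneg_left (h1.trans h2) hε.le
    linarith
  · intro x hx hx0 hx1
    have hxs := mem_slitPlane_of_re_eq_zero hx hx0
    have hn : 0 < ‖x‖ := norm_pos_iff.2 hx0
    rw [congrFun hbeta x, hre x hxs]
    have hnn : ∀ᵐ z : ℝ ∂ν, 0 ≤ (w (x / z)).re := by
      filter_upwards [hp.pos] with z hz
      refine hK.re_nonneg _ (div_ofReal_mem_slitPlane hxs hz) ?_
      rw [Complex.div_ofReal_re, hx, zero_div]
    have hrei : Integrable (fun z : ℝ => (w (x / z)).re) ν := (hint x hxs).re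
    have hCle : c * v₀ ^ (-α) / v₀ ≤ Cw * Cm + c * v₀ ^ (-α) / v₀ := by
      have : 0 ≤ Cw * Cm := by positivity
      linarith
    -- Below v₀ only z > r is used, the rest being nonnegative by `re_nonneg`. Above v₀ the asserted
    -- lower bound is not positive, by the second summand of the constant.
    rcases lt_or_ge ‖x‖ v₀ with hlt | hge
    · have h1 : c₀ * r ^ α * ‖x‖ ^ (-α) * ν.real (Ioi r) ≤ ∫ z : ℝ, (w (x / z)).re ∂ν := by
        have e : c₀ * r ^ α * ‖x‖ ^ (-α) * ν.real (Ioi r) =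
            ∫ z, (Ioi r).indicator (fun _ => c₀ * r ^ α * ‖x‖ ^ (-α)) z ∂ν := by
          rw [integral_indicator_const _ measurableSet_Ioi, smul_eq_mul, mul_comm]
        rw [e]
        refine integral_mono_ae ((integrable_const _).indicator measurableSet_Ioi) hrei ?_
        filter_upwards [hp.pos, hnn] with z hz hz0
        by_cases hzr : z ∈ Ioi r
        · rw [indicator_of_mem hzr]
          have hzr' := mem_Ioi.1 hzr
          have h2 := hlow (x / z) (by rw [Complex.div_ofReal_re, hx, zero_div])
            (div_ne_zero hx0 (Complex.ofReal_ne_zero.2 hz.ne')) (by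
              rw [norm_div_ofReal x hz, div_lt_iff₀ hz]
              exact hlt.trans (mul_lt_mul_of_pos_left hzr' hδ))
          refine le_trans ?_ h2
          rw [norm_div_ofReal x hz, Real.div_rpow hn.le hz.le, Real.rpow_neg hz.le, div_inv_eq_mul,
            mul_assoc]
          have h3 : r ^ α ≤ z ^ α := Real.rpow_le_rpow hrp.le hzr'.le hα.le
          calc c₀ * (r ^ α * ‖x‖ ^ (-α)) ≤ c₀ * (z ^ α * ‖x‖ ^ (-α)) := by gcongr
            _ = c₀ * (‖x‖ ^ (-α) * z ^ α) := by ring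
        · rw [indicator_of_notMem hzr]; exact hz0
      have h2 : c * ‖x‖ ^ (-α) ≤ c₀ * r ^ α * ‖x‖ ^ (-α) * ν.real (Ioi r) := by
        have := hp.tail_ge hε1
        calc c * ‖x‖ ^ (-α) = c₀ * r ^ α * ‖x‖ ^ (-α) * (13 / 16) := by rw [hc]; ring
          _ ≤ _ := by gcongr
      have h3 := mul_le_mul_of_nonneg_left (h2.trans h1) hε.le
      have h4 : 0 ≤ (Cw * Cm + c * v₀ ^ (-α) / v₀) * ε * ‖x‖ := by positivity
      linarith
    · have h1 : 0 ≤ ∫ z : ℝ, (w (x / z)).re ∂ν := integral_nonneg_of_ae hnn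
      have h2 : c * ‖x‖ ^ (-α) ≤ (Cw * Cm + c * v₀ ^ (-α) / v₀) * ‖x‖ := by
        have e1 : ‖x‖ ^ (-α) ≤ v₀ ^ (-α) := Real.rpow_le_rpow_of_nonpos hv₀p hge (by linarith)
        calc c * ‖x‖ ^ (-α) ≤ c * v₀ ^ (-α) := by gcongr
          _ = c * v₀ ^ (-α) / v₀ * v₀ := by field_simp
          _ ≤ (Cw * Cm + c * v₀ ^ (-α) / v₀) * ‖x‖ := by gcongr
      have h3 := mul_le_mul_of_nonneg_left h2 hε.le
      have h4 := mul_nonneg hε.le h1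
      linarith
  · rw [hf.kappa_eq]; linarith
  · rw [hf.kappa_eq]; linarith

end

end SelfSim
end

/-! ### Symbols on the imaginary axis, and the phase Φ. -/

noncomputable section

namespace SelfSim

/-- `B'` is `t ↦ t * dB/dt`, and both functions are of order `(ε |t| ^ (-α)) ^ k` at the origin and of
order `|t| ^ γ` at infinity. -/
structure IsSymbol (ε α : ℝ) (k : ℕ) (γ D : ℝ) (B B' : ℝ → ℂ) : Prop where
  hasDeriv : ∀ t : ℝ, t ≠ 0 → HasDerivAt B (B' t / t) t
  small : ∀ t : ℝ, t ≠ 0 → |t| ≤ 1 → ‖B t‖ ≤ D * (ε * |t| ^ (-α)) ^ k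
  small' : ∀ t : ℝ, t ≠ 0 → |t| ≤ 1 → ‖B' t‖ ≤ D * (ε * |t| ^ (-α)) ^ k
  large : ∀ t : ℝ, 1 ≤ |t| → ‖B t‖ ≤ D * |t| ^ γ
  large' : ∀ t : ℝ, 1 ≤ |t| → ‖B' t‖ ≤ D * |t| ^ γ

/-- The properties of `t ↦ Φ(it)` used in the estimates, in terms of `β(t) = b(it)`. -/
structure IsPhase (ε α c D : ℝ) (φ β : ℝ → ℂ) : Prop where
  hasDeriv : ∀ t : ℝ, t ≠ 0 → HasDerivAt φ (-(β t / t * Complex.exp (-(t * Complex.I)))) t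
  decay : ∀ t : ℝ, t ≠ 0 → ∀ s ∈ Ioo (0 : ℝ) 1,
    (φ t - φ (s * t)).re ≤ D - c * ((1 - s) * (ε * (s * |t|) ^ (-α)))

section symbols

variable {ε α γ δ D E : ℝ} {k l : ℕ} {B B' G G' : ℝ → ℂ}

/-- Leibniz' rule for the operator t d/dt; the factor 2 accounts for its two terms. -/
lemma IsSymbol.mul (hB : IsSymbol ε α k γ D B B') (hG : IsSymbol ε α l δ E G G')
    (hε : 0 < ε) (hD : 0 ≤ D) :
    IsSymbol ε α (k + l) (γ + δ) (2 * (D * E)) (fun t => B t * G t)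
      (fun t => B' t * G t + B t * G' t) := by
  have aux : ∀ {x y : ℂ} {u v : ℝ}, ‖x‖ ≤ D * u → ‖y‖ ≤ E * v → 0 ≤ u →
      ‖x * y‖ ≤ D * E * (u * v) := by
    intro x y u v h1 h2 hu
    rw [norm_mul]
    calc ‖x‖ * ‖y‖ ≤ D * u * (E * v) := by gcongr
      _ = _ := by ring
  have up : ∀ {x : ℂ} {u : ℝ}, ‖x‖ ≤ D * E * u → ‖x‖ ≤ 2 * (D * E) * u := by
    intro x u h
    have := norm_nonneg x
    linarith
  have two : ∀ {x y : ℂ} {u : ℝ}, ‖x‖ ≤ D * E * u → ‖y‖ ≤ D * E * u →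
      ‖x + y‖ ≤ 2 * (D * E) * u := by
    intro x y u h1 h2
    have := norm_add_le x y
    linarith
  refine ⟨fun t ht => ?_, fun t ht h1 => ?_, fun t ht h1 => ?_, fun t h1 => ?_, fun t h1 => ?_⟩
  · exact ((hB.hasDeriv t ht).mul (hG.hasDeriv t ht)).congr_deriv (by ring)
  · rw [pow_add]
    exact up (aux (hB.small t ht h1) (hG.small t ht h1) (by positivity))
  · rw [pow_add]
    exact two (aux (hB.small' t ht h1) (hG.small t ht h1) (by positivity))
      (aux (hB.small t ht h1) (hG.small' t ht h1) (by positivity))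
  · rw [Real.rpow_add (by linarith)]
    exact up (aux (hB.large t h1) (hG.large t h1) (by positivity))
  · rw [Real.rpow_add (by linarith)]
    exact two (aux (hB.large' t h1) (hG.large t h1) (by positivity))
      (aux (hB.large t h1) (hG.large' t h1) (by positivity))

lemma IsSymbol.add (hB : IsSymbol ε α k γ D B B') (hG : IsSymbol ε α k γ E G G') :
    IsSymbol ε α k γ (D + E) (fun t => B t + G t) (fun t => B' t + G' t) where
  hasDeriv t ht := ((hB.hasDeriv t ht).add (hG.hasDeriv t ht)).congr_deriv (by ring)
  small t ht h1 := (norm_add_le _ _).trans (by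
    rw [add_mul]; exact add_le_add (hB.small t ht h1) (hG.small t ht h1))
  small' t ht h1 := (norm_add_le _ _).trans (by
    rw [add_mul]; exact add_le_add (hB.small' t ht h1) (hG.small' t ht h1))
  large t h1 := (norm_add_le _ _).trans (by
    rw [add_mul]; exact add_le_add (hB.large t h1) (hG.large t h1))
  large' t h1 := (norm_add_le _ _).trans (by
    rw [add_mul]; exact add_le_add (hB.large' t h1) (hG.large' t h1))

lemma IsSymbol.neg (hB : IsSymbol ε α k γ D B B') :
    IsSymbol ε α k γ D (fun t => -B t) (fun t => -B' t) where
  hasDeriv t ht := ((hB.hasDeriv t ht).fun_neg).congr_deriv (by ring)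
  small t ht h1 := by rw [norm_neg]; exact hB.small t ht h1
  small' t ht h1 := by rw [norm_neg]; exact hB.small' t ht h1
  large t h1 := by rw [norm_neg]; exact hB.large t h1
  large' t h1 := by rw [norm_neg]; exact hB.large' t h1

lemma IsSymbol.mono (hB : IsSymbol ε α k γ D B B') (hγ : γ ≤ δ) (hD : 0 ≤ D) :
    IsSymbol ε α k δ D B B' where
  hasDeriv := hB.hasDeriv
  small := hB.small
  small' := hB.small'
  large t h1 := (hB.large t h1).trans
    (mul_le_mul_of_nonneg_left (Real.rpow_le_rpow_of_exponent_le h1 hγ) hD)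
  large' t h1 := (hB.large' t h1).trans
    (mul_le_mul_of_nonneg_left (Real.rpow_le_rpow_of_exponent_le h1 hγ) hD)

lemma isSymbol_one : IsSymbol ε α 0 0 1 (fun _ => 1) (fun _ => 0) where
  hasDeriv t _ := (hasDerivAt_const t (1 : ℂ)).congr_deriv (by simp)
  small t _ _ := by simp
  small' t _ _ := by simp
  large t _ := by simp
  large' t _ := by simp

lemma hasDerivAt_ofReal_mul_I (t : ℝ) :
    HasDerivAt (fun t : ℝ => (t : ℂ) * Complex.I) Complex.I t := by
  simpa using (hasDerivAt_id t).ofReal_comp.mul_const Complex.I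

lemma isSymbol_mul_I : IsSymbol ε α 0 1 1 (fun t => t * Complex.I) (fun t => t * Complex.I) where
  hasDeriv t ht := (hasDerivAt_ofReal_mul_I t).congr_deriv (by
    have : (t : ℂ) ≠ 0 := Complex.ofReal_ne_zero.2 ht
    field_simp)
  small t _ h := by simpa using h
  small' t _ h := by simpa using h
  large t h := by simp
  large' t h := by simp

lemma one_add_mul_I_ne_zero (t : ℝ) : (1 : ℂ) + t * Complex.I ≠ 0 := by
  intro h
  simpa using congrArg Complex.re h

lemma one_le_norm_one_add_mul_I (t : ℝ) : 1 ≤ ‖(1 : ℂ) + t * Complex.I‖ := by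
  have := Complex.abs_re_le_norm ((1 : ℂ) + t * Complex.I)
  simpa using this

lemma abs_le_norm_one_add_mul_I (t : ℝ) : |t| ≤ ‖(1 : ℂ) + t * Complex.I‖ := by
  have := Complex.abs_im_le_norm ((1 : ℂ) + t * Complex.I)
  simpa using this

lemma isSymbol_inv : IsSymbol ε α 0 (-1) 1 (fun t => (1 + t * Complex.I)⁻¹)
    (fun t => -(t * Complex.I) * ((1 + t * Complex.I)⁻¹ * (1 + t * Complex.I)⁻¹)) := by
  have h1 : ∀ t : ℝ, ‖(1 + t * Complex.I)⁻¹‖ ≤ 1 := fun t => by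
    rw [norm_inv]; exact inv_le_one_of_one_le₀ (one_le_norm_one_add_mul_I t)
  have h2 : ∀ t : ℝ, 1 ≤ |t| → ‖(1 + t * Complex.I)⁻¹‖ ≤ 1 * |t| ^ (-1 : ℝ) := fun t ht => by
    rw [norm_inv, one_mul, Real.rpow_neg_one]
    exact inv_anti₀ (by linarith) (abs_le_norm_one_add_mul_I t)
  have h3 : ∀ t : ℝ, ‖-(t * Complex.I) * ((1 + t * Complex.I)⁻¹ * (1 + t * Complex.I)⁻¹)‖ ≤
      ‖(1 + t * Complex.I)⁻¹‖ := fun t => by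
    rw [norm_mul, norm_mul, ← mul_assoc]
    refine mul_le_of_le_one_left (norm_nonneg _) ?_
    rw [norm_neg, norm_mul, Complex.norm_I, mul_one, Complex.norm_real, Real.norm_eq_abs, norm_inv,
      ← div_eq_mul_inv, div_le_one (by linarith [one_le_norm_one_add_mul_I t])]
    exact abs_le_norm_one_add_mul_I t
  refine ⟨fun t ht => ?_, fun t _ _ => ?_, fun t _ _ => ?_, h2, fun t h => (h3 t).trans (h2 t h)⟩
  · refine (((hasDerivAt_ofReal_mul_I t).const_add 1).fun_inv
      (one_add_mul_I_ne_zero t)).congr_deriv ?_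
    have : (t : ℂ) ≠ 0 := Complex.ofReal_ne_zero.2 ht
    have := one_add_mul_I_ne_zero t
    field_simp
  · simpa using h1 t
  · simpa using (h3 t).trans (h1 t)

end symbols

section rate

variable {α C c ε : ℝ} {b : ℂ → ℂ}

lemma ball_mul_I {t : ℝ} (ht : t ≠ 0) {y : ℂ}
    (hy : y ∈ Metric.closedBall ((t : ℂ) * Complex.I) (|t| / 2)) :
    y ∈ Complex.slitPlane ∧ |t| / 2 ≤ ‖y‖ ∧ ‖y‖ ≤ 2 * |t| := by
  have ht0 : 0 < |t| := abs_pos.2 ht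
  rw [Metric.mem_closedBall, dist_eq_norm] at hy
  have hn : ‖(t : ℂ) * Complex.I‖ = |t| := by simp
  have h1 := norm_sub_norm_le y (t * Complex.I)
  have h2 := norm_sub_norm_le ((t : ℂ) * Complex.I) y
  rw [norm_sub_rev] at h2
  have h3 := (Complex.abs_im_le_norm _).trans hy
  simp only [Complex.sub_im, Complex.mul_im, Complex.ofReal_re, Complex.I_im, mul_one,
    Complex.ofReal_im, Complex.I_re, mul_zero, add_zero] at h3
  refine ⟨?_, by linarith, by linarith⟩
  rw [Complex.mem_slitPlane_iff]
  right
  intro h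
  rw [h, zero_sub, abs_neg] at h3
  linarith

lemma two_rpow_le_two (hα1 : α ≤ 1) : (2 : ℝ) ^ α ≤ 2 := by
  simpa using Real.rpow_le_rpow_of_exponent_le (one_le_two) hα1

lemma IsRate.bound_ball (hb : IsRate α C c ε b) (hα : 0 < α) (hα1 : α ≤ 1) (hC : 0 ≤ C)
    (hε : 0 < ε) {t : ℝ} (ht : t ≠ 0) {y : ℂ}
    (hy : y ∈ Metric.closedBall ((t : ℂ) * Complex.I) (|t| / 2)) :
    ‖b y‖ ≤ 2 * C * ε * (|t| ^ (-α) + |t| ^ α) := by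
  obtain ⟨h1, h2, h3⟩ := ball_mul_I ht hy
  have ht0 : 0 < |t| := abs_pos.2 ht
  refine (hb.bound y h1).trans ?_
  have e1 : ‖y‖ ^ (-α) ≤ 2 * |t| ^ (-α) := by
    refine (Real.rpow_le_rpow_of_nonpos (by positivity) h2 (by linarith)).trans ?_
    rw [Real.div_rpow ht0.le (by norm_num), Real.rpow_neg (by norm_num : (0 : ℝ) ≤ 2),
      div_inv_eq_mul, mul_comm]
    gcongr
    exact two_rpow_le_two hα1
  have e2 : ‖y‖ ^ α ≤ 2 * |t| ^ α := by
    refine (Real.rpow_le_rpow (norm_nonneg _) h3 hα.le).trans ?_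
    rw [Real.mul_rpow (by norm_num) ht0.le]
    gcongr
    exact two_rpow_le_two hα1
  calc C * ε * (‖y‖ ^ (-α) + ‖y‖ ^ α) ≤ C * ε * (2 * |t| ^ (-α) + 2 * |t| ^ α) := by gcongr
    _ = _ := by ring

lemma rpow_add_rpow_le_of_le_one {t : ℝ} (hα : 0 < α) (ht : t ≠ 0) (h1 : |t| ≤ 1) :
    |t| ^ (-α) + |t| ^ α ≤ 2 * |t| ^ (-α) := by
  have := Real.rpow_le_rpow_of_exponent_ge (abs_pos.2 ht) h1 (by linarith : -α ≤ α)
  linarith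

lemma rpow_add_rpow_le_of_one_le {t : ℝ} (hα : 0 < α) (h1 : 1 ≤ |t|) :
    |t| ^ (-α) + |t| ^ α ≤ 2 * |t| ^ α := by
  have := Real.rpow_le_rpow_of_exponent_le h1 (by linarith : -α ≤ α)
  linarith

/-- Cauchy's estimates on the disc of radius |t|/2 around it, which avoids the slit: each derivative
costs a factor 1/|t|. Two derivatives of b are needed, because the expansion of `H0` contains its
first derivative as an amplitude. -/
lemma IsRate.isSymbol (hb : IsRate α C c ε b) (hα : 0 < α) (hα1 : α ≤ 1) (hC : 1 ≤ C)
    (hε : 0 < ε) (hε1 : ε ≤ 1) :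
    IsSymbol ε α 1 α (40 * C) (fun t => b (t * Complex.I))
      (fun t => t * Complex.I * deriv b (t * Complex.I)) ∧
    IsSymbol ε α 1 α (40 * C) (fun t => t * Complex.I * deriv b (t * Complex.I))
      (fun t => t * Complex.I * deriv b (t * Complex.I) +
        (t * Complex.I) ^ 2 * iteratedDeriv 2 b (t * Complex.I)) := by
  have hmem : ∀ t : ℝ, t ≠ 0 → (t : ℂ) * Complex.I ∈ Complex.slitPlane := fun t ht =>
    (ball_mul_I ht (Metric.mem_closedBall_self (by positivity))).1
  have hit : ∀ n : ℕ, ∀ t : ℝ, t ≠ 0 → ‖iteratedDeriv n b (t * Complex.I)‖ ≤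
      n.factorial * (2 * C * ε * (|t| ^ (-α) + |t| ^ α)) / (|t| / 2) ^ n := by
    intro n t ht
    have ht0 : 0 < |t| := abs_pos.2 ht
    refine Complex.norm_iteratedDeriv_le_of_forall_mem_sphere_norm_le n (by positivity) ?_ ?_
    · refine DifferentiableOn.diffContOnCl ?_
      rw [closure_ball _ (by positivity)]
      exact hb.diff.mono fun y hy => (ball_mul_I ht hy).1
    · intro y hy
      exact hb.bound_ball hα hα1 (by linarith) hε ht (Metric.sphere_subset_closedBall hy)
  have hn : ∀ t : ℝ, ‖(t : ℂ) * Complex.I‖ = |t| := fun t => by simp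
  have h0 : ∀ t : ℝ, t ≠ 0 → ‖b (t * Complex.I)‖ ≤ 20 * C * ε * (|t| ^ (-α) + |t| ^ α) := by
    intro t ht
    have := hit 0 t ht
    simp only [iteratedDeriv_zero, Nat.factorial_zero, Nat.cast_one, one_mul, pow_zero,
      div_one] at this
    refine this.trans ?_
    gcongr
    norm_num
  have h1 : ∀ t : ℝ, t ≠ 0 → ‖t * Complex.I * deriv b (t * Complex.I)‖ ≤
      4 * C * ε * (|t| ^ (-α) + |t| ^ α) := by
    intro t ht
    have ht0 : 0 < |t| := abs_pos.2 ht
    have := hit 1 t ht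
    rw [iteratedDeriv_one] at this
    rw [norm_mul, hn]
    refine (mul_le_mul_of_nonneg_left this ht0.le).trans (le_of_eq ?_)
    simp only [Nat.factorial_one, Nat.cast_one, one_mul, pow_one]
    field_simp
    ring
  have h2 : ∀ t : ℝ, t ≠ 0 → ‖(t * Complex.I) ^ 2 * iteratedDeriv 2 b (t * Complex.I)‖ ≤
      16 * C * ε * (|t| ^ (-α) + |t| ^ α) := by
    intro t ht
    have ht0 : 0 < |t| := abs_pos.2 ht
    have := hit 2 t ht
    rw [norm_mul, norm_pow, hn]
    refine (mul_le_mul_of_nonneg_left this (by positivity)).trans (le_of_eq ?_)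
    simp only [Nat.factorial_two, Nat.cast_ofNat]
    field_simp
    ring
  have h1' : ∀ t : ℝ, t ≠ 0 → ‖t * Complex.I * deriv b (t * Complex.I)‖ ≤
      20 * C * ε * (|t| ^ (-α) + |t| ^ α) := by
    intro t ht
    refine (h1 t ht).trans ?_
    gcongr
    norm_num
  have h3 : ∀ t : ℝ, t ≠ 0 → ‖t * Complex.I * deriv b (t * Complex.I) +
        (t * Complex.I) ^ 2 * iteratedDeriv 2 b (t * Complex.I)‖ ≤
      20 * C * ε * (|t| ^ (-α) + |t| ^ α) := by
    intro t ht
    refine (norm_add_le _ _).trans ((add_le_add (h1 t ht) (h2 t ht)).trans (le_of_eq ?_))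
    ring
  have sm : ∀ (g : ℝ → ℂ), (∀ t : ℝ, t ≠ 0 → ‖g t‖ ≤ 20 * C * ε * (|t| ^ (-α) + |t| ^ α)) →
      ∀ t : ℝ, t ≠ 0 → |t| ≤ 1 → ‖g t‖ ≤ 40 * C * (ε * |t| ^ (-α)) ^ 1 := by
    intro g hg t ht ht1
    refine (hg t ht).trans ?_
    have := mul_le_mul_of_nonneg_left (rpow_add_rpow_le_of_le_one hα ht ht1)
      (by positivity : 0 ≤ 20 * C * ε)
    linarith
  have la : ∀ (g : ℝ → ℂ), (∀ t : ℝ, t ≠ 0 → ‖g t‖ ≤ 20 * C * ε * (|t| ^ (-α) + |t| ^ α)) →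
      ∀ t : ℝ, 1 ≤ |t| → ‖g t‖ ≤ 40 * C * |t| ^ α := by
    intro g hg t ht1
    refine (hg t (abs_pos.1 (by linarith))).trans ?_
    have h4 := mul_le_mul_of_nonneg_left (rpow_add_rpow_le_of_one_le hα ht1)
      (by positivity : 0 ≤ 20 * C * ε)
    have h5 : 20 * C * ε * (2 * |t| ^ α) ≤ 20 * C * 1 * (2 * |t| ^ α) := by gcongr
    linarith
  have hd : ∀ t : ℝ, t ≠ 0 → HasDerivAt (fun t : ℝ => b (t * Complex.I))
      (Complex.I * deriv b (t * Complex.I)) t := by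
    intro t ht
    have := (hb.diff.differentiableAt (Complex.isOpen_slitPlane.mem_nhds (hmem t ht))).hasDerivAt
    exact this.scomp t (hasDerivAt_ofReal_mul_I t)
  have hd2 : ∀ t : ℝ, t ≠ 0 → HasDerivAt (fun t : ℝ => deriv b (t * Complex.I))
      (Complex.I * iteratedDeriv 2 b (t * Complex.I)) t := by
    intro t ht
    have := ((hb.diff.deriv Complex.isOpen_slitPlane).differentiableAt
      (Complex.isOpen_slitPlane.mem_nhds (hmem t ht))).hasDerivAt
    rw [iteratedDeriv_succ, iteratedDeriv_one]
    exact this.scomp t (hasDerivAt_ofReal_mul_I t)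
  refine ⟨⟨fun t ht => ?_, sm _ h0, sm _ h1', la _ h0, la _ h1'⟩,
    ⟨fun t ht => ?_, sm _ h1', sm _ h3, la _ h1', la _ h3⟩⟩
  · have : (t : ℂ) ≠ 0 := Complex.ofReal_ne_zero.2 ht
    exact (hd t ht).congr_deriv (by field_simp)
  · have : (t : ℂ) ≠ 0 := Complex.ofReal_ne_zero.2 ht
    exact ((hasDerivAt_ofReal_mul_I t).mul (hd2 t ht)).congr_deriv (by field_simp)

/-- The x-derivative of h(x+s) is also its s-derivative, so its integral over the ray is -h(x).
Domination again comes from Cauchy's estimate, on discs of radius |t|/4. -/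
lemma hasDerivAt_integral_ray {h : ℂ → ℂ} (hd : DifferentiableOn ℂ h Complex.slitPlane) {t K : ℝ}
    (ht : t ≠ 0) (hK : ∀ y : ℂ, |t| / 2 ≤ |y.im| → ‖h y‖ ≤ K * Real.exp (-y.re)) :
    HasDerivAt (fun x : ℂ => ∫ s in Ioi (0 : ℝ), h (x + s)) (-h (t * Complex.I))
      (t * Complex.I) := by
  have ht0 : 0 < |t| := abs_pos.2 ht
  have hK0 : 0 ≤ K := by
    have := hK (t * Complex.I) (by simp)
    simp only [Complex.mul_re, Complex.ofReal_re, Complex.I_re, mul_zero, Complex.ofReal_im,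
      Complex.I_im, mul_one, sub_self, neg_zero, Real.exp_zero] at this
    exact (norm_nonneg _).trans this
  have slit : ∀ y : ℂ, |t| / 2 ≤ |y.im| → y ∈ Complex.slitPlane := by
    intro y hy
    rw [Complex.mem_slitPlane_iff]
    exact Or.inr (abs_pos.1 (by linarith))
  have him : ∀ x ∈ Metric.closedBall ((t : ℂ) * Complex.I) (|t| / 4), 3 * |t| / 4 ≤ |x.im| ∧
      -(|t| / 4) ≤ x.re := by
    intro x hx
    rw [Metric.mem_closedBall, dist_eq_norm] at hx
    have h1 := (Complex.abs_im_le_norm _).trans hx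
    have h2 := (Complex.abs_re_le_norm _).trans hx
    simp only [Complex.sub_im, Complex.mul_im, Complex.ofReal_re, Complex.I_im, mul_one,
      Complex.ofReal_im, Complex.I_re, mul_zero, add_zero, Complex.sub_re, Complex.mul_re,
      sub_zero] at h1 h2
    have h3 := abs_sub_abs_le_abs_sub t x.im
    rw [abs_sub_comm] at h3
    refine ⟨by linarith, (abs_le.1 h2).1⟩
  have hdh : ∀ y : ℂ, |t| / 2 ≤ |y.im| → HasDerivAt h (deriv h y) y := fun y hy =>
    (hd.differentiableAt (Complex.isOpen_slitPlane.mem_nhds (slit y hy))).hasDerivAt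
  have hadd : ∀ x ∈ Metric.closedBall ((t : ℂ) * Complex.I) (|t| / 4), ∀ s : ℝ,
      |t| / 2 ≤ |(x + s).im| := by
    intro x hx s
    have := (him x hx).1
    simp only [Complex.add_im, Complex.ofReal_im, add_zero]
    linarith
  have hself := Metric.mem_closedBall_self (x := (t : ℂ) * Complex.I) (ε := |t| / 4) (by positivity)
  have hcont : ∀ x ∈ Metric.closedBall ((t : ℂ) * Complex.I) (|t| / 4),
      Continuous (fun s : ℝ => h (x + s)) := by
    intro x hx
    exact hd.continuousOn.comp_continuous (by fun_prop) fun s => slit _ (hadd x hx s)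
  have hexp : IntegrableOn (fun s : ℝ => Real.exp (-s)) (Ioi 0) := by
    simpa using exp_neg_integrableOn_Ioi 0 one_pos
  have hbd0 : ∀ s : ℝ, ‖h (t * Complex.I + s)‖ ≤ K * Real.exp (-s) := by
    intro s
    simpa using hK _ (hadd _ hself s)
  have hder : ∀ x ∈ Metric.closedBall ((t : ℂ) * Complex.I) (|t| / 4), ∀ s : ℝ,
      HasDerivAt (fun x : ℂ => h (x + s)) (deriv h (x + s)) x := fun x hx s =>
    (hdh _ (hadd x hx s)).comp_add_const x (s : ℂ)
  have key := hasDerivAt_integral_of_dominated_loc_of_deriv_le (𝕜 := ℂ)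
    (μ := volume.restrict (Ioi (0 : ℝ)))
    (F := fun x s => h (x + (s : ℝ))) (F' := fun x s => deriv h (x + (s : ℝ)))
    (x₀ := (t : ℂ) * Complex.I)
    (bound := fun s => K * Real.exp (|t| / 2) / (|t| / 4) * Real.exp (-s))
    (Metric.ball_mem_nhds _ (show 0 < |t| / 4 by positivity)) ?_ ?_ ?_ ?_ ?_ ?_
  · refine key.2.congr_deriv ?_
    have := integral_Ioi_of_hasDerivAt_of_tendsto (a := 0) (m := 0)
      (f := fun s : ℝ => h (t * Complex.I + s)) (f' := fun s : ℝ => deriv h (t * Complex.I + s))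
      (hcont _ hself).continuousAt.continuousWithinAt (fun s _ => ?_) key.1 ?_
    · rw [this]; simp
    · have h1 := hdh _ (hadd _ hself s)
      have h2 : HasDerivAt (fun s : ℝ => (t : ℂ) * Complex.I + s) 1 s := by
        simpa using (hasDerivAt_id s).ofReal_comp.const_add ((t : ℂ) * Complex.I)
      have h3 := h1.scomp s h2
      rw [one_smul] at h3
      exact h3
    · refine squeeze_zero_norm hbd0 ?_
      simpa using (Real.tendsto_exp_neg_atTop_nhds_zero).const_mul K
  · filter_upwards [Metric.closedBall_mem_nhds _ (show 0 < |t| / 4 by positivity)] with x hx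
    exact (hcont x hx).aestronglyMeasurable
  · exact (hexp.const_mul K).mono' (hcont _ hself).aestronglyMeasurable
      (Eventually.of_forall hbd0)
  · refine Continuous.aestronglyMeasurable ?_
    exact (hd.deriv Complex.isOpen_slitPlane).continuousOn.comp_continuous (by fun_prop)
      fun s => slit _ (hadd _ hself s)
  · refine Eventually.of_forall fun s x hx => ?_
    have hx' := Metric.ball_subset_closedBall hx
    have hy : ∀ y ∈ Metric.closedBall (x + s : ℂ) (|t| / 4), |t| / 2 ≤ |y.im| ∧
        s - |t| / 2 ≤ y.re := by
      intro y hy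
      rw [Metric.mem_closedBall, dist_eq_norm] at hy
      have h1 := (Complex.abs_im_le_norm _).trans hy
      have h2 := (Complex.abs_re_le_norm _).trans hy
      simp only [Complex.sub_im, Complex.add_im, Complex.ofReal_im, add_zero, Complex.sub_re,
        Complex.add_re, Complex.ofReal_re] at h1 h2
      obtain ⟨h3, h4⟩ := him x hx'
      have h5 := abs_sub_abs_le_abs_sub x.im y.im
      rw [abs_sub_comm] at h5
      refine ⟨by linarith, ?_⟩
      have := (abs_le.1 h2).1
      linarith
    have hC := Complex.norm_deriv_le_of_forall_mem_sphere_norm_le (f := h) (c := x + s)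
      (C := K * (Real.exp (|t| / 2) * Real.exp (-s)))
      (show 0 < |t| / 4 by positivity) ?_ ?_
    · refine hC.trans (le_of_eq ?_)
      ring
    · refine DifferentiableOn.diffContOnCl ?_
      rw [closure_ball _ (by positivity)]
      exact hd.mono fun y hy' => slit y (hy y hy').1
    · intro y hy'
      obtain ⟨h1, h2⟩ := hy y (Metric.sphere_subset_closedBall hy')
      refine (hK y h1).trans ?_
      rw [← Real.exp_add]
      gcongr
      linarith
  · exact hexp.const_mul _
  · exact Eventually.of_forall fun s x hx => hder x (Metric.ball_subset_closedBall hx) s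

/-- `Φ` for a general rate function `b`. -/
def phase (b : ℂ → ℂ) (x : ℂ) : ℂ :=
  ∫ s in Ioi (0 : ℝ), b (x + s) / (x + s) * Complex.exp (-(x + s))

lemma IsRate.norm_div_mul_exp_le (hb : IsRate α C c ε b) (hα : 0 < α) (hα1 : α ≤ 1) (hC : 0 ≤ C)
    (hε : 0 < ε) {r : ℝ} (hr : 0 < r) {y : ℂ} (hy : y ∈ Complex.slitPlane) (hry : r ≤ ‖y‖) :
    ‖b y / y * Complex.exp (-y)‖ ≤
      C * ε * (r ^ (-α - 1) + r ^ (α - 1)) * Real.exp (-y.re) := by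
  have hn : 0 < ‖y‖ := hr.trans_le hry
  rw [norm_mul, norm_div, Complex.norm_exp, Complex.neg_re]
  gcongr
  rw [div_le_iff₀ hn]
  refine (hb.bound y hy).trans ?_
  have e1 : ‖y‖ ^ (-α) = ‖y‖ ^ (-α - 1) * ‖y‖ := by
    rw [← Real.rpow_add_one hn.ne']; ring_nf
  have e2 : ‖y‖ ^ α = ‖y‖ ^ (α - 1) * ‖y‖ := by
    rw [← Real.rpow_add_one hn.ne']; ring_nf
  rw [e1, e2, mul_assoc (C * ε), add_mul]
  have h1 := Real.rpow_le_rpow_of_nonpos hr hry (by linarith : -α - 1 ≤ 0)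
  have h2 := Real.rpow_le_rpow_of_nonpos hr hry (by linarith : α - 1 ≤ 0)
  gcongr

lemma IsRate.hasDerivAt_phase (hb : IsRate α C c ε b) (hα : 0 < α) (hα1 : α ≤ 1) (hC : 0 ≤ C)
    (hε : 0 < ε) {t : ℝ} (ht : t ≠ 0) :
    HasDerivAt (phase b)
      (-(b (t * Complex.I) / (t * Complex.I) * Complex.exp (-(t * Complex.I))))
      (t * Complex.I) := by
  have ht0 : 0 < |t| := abs_pos.2 ht
  refine hasDerivAt_integral_ray (h := fun y => b y / y * Complex.exp (-y)) ?_ ht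
    (K := C * ε * ((|t| / 2) ^ (-α - 1) + (|t| / 2) ^ (α - 1))) fun y hy => ?_
  · refine (hb.diff.div differentiableOn_id fun y hy => Complex.slitPlane_ne_zero hy).mul ?_
    fun_prop
  · refine hb.norm_div_mul_exp_le hα hα1 hC hε (by positivity) ?_
      (hy.trans (Complex.abs_im_le_norm y))
    rw [Complex.mem_slitPlane_iff]
    exact Or.inr (abs_pos.1 (by linarith))

lemma IsRate.norm_phase_le (hb : IsRate α C c ε b) (hα : 0 < α) (hα1 : α ≤ 1) (hC : 0 ≤ C)
    (hε : 0 < ε) (hε1 : ε ≤ 1) {t : ℝ} (ht : 1 ≤ |t|) : ‖phase b (t * Complex.I)‖ ≤ 2 * C := by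
  have hexp : IntegrableOn (fun s : ℝ => Real.exp (-s)) (Ioi 0) := by
    simpa using exp_neg_integrableOn_Ioi 0 one_pos
  have h1 : ‖phase b (t * Complex.I)‖ ≤ ∫ s in Ioi (0 : ℝ), C * ε * 2 * Real.exp (-s) := by
    refine norm_integral_le_of_norm_le (hexp.const_mul _) (Eventually.of_forall fun s => ?_)
    have him : ((t : ℂ) * Complex.I + s).im = t := by simp
    have := hb.norm_div_mul_exp_le hα hα1 hC hε one_pos (y := t * Complex.I + s) ?_ ?_
    · norm_num at this
      simpa using this
    · rw [Complex.mem_slitPlane_iff, him]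
      exact Or.inr (abs_pos.1 (by linarith))
    · exact ht.trans (by simpa [him] using Complex.abs_im_le_norm ((t : ℂ) * Complex.I + s))
  rw [integral_const_mul, integral_exp_neg_Ioi_zero] at h1
  refine h1.trans ?_
  have : C * ε ≤ C * 1 := by gcongr
  linarith

end rate

end SelfSim
end

/-! ### Damping by the real part of the phase. -/

noncomputable section

namespace SelfSim

section

variable {α C c ε : ℝ} {b : ℂ → ℂ}

lemma IsRate.hasDerivAt_phase_ray (hb : IsRate α C c ε b) (hα : 0 < α) (hα1 : α ≤ 1) (hC : 0 ≤ C)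
    (hε : 0 < ε) {σ v : ℝ} (hσ : σ ≠ 0) (hv : v ≠ 0) :
    HasDerivAt (fun v : ℝ => phase b ((σ * v : ℝ) * Complex.I))
      (-(b ((σ * v : ℝ) * Complex.I) / v * Complex.exp (-((σ * v : ℝ) * Complex.I)))) v := by
  have h1 := hb.hasDerivAt_phase hα hα1 hC hε (mul_ne_zero hσ hv)
  have h2 : HasDerivAt (fun v : ℝ => ((σ * v : ℝ) : ℂ) * Complex.I) (σ * Complex.I) v := by
    have h3 : HasDerivAt (fun v : ℝ => σ * v) σ v := by
      simpa using (hasDerivAt_id v).const_mul σ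
    exact h3.ofReal_comp.mul_const Complex.I
  refine (h1.scomp v h2).congr_deriv ?_
  have h4 : (σ : ℂ) ≠ 0 := Complex.ofReal_ne_zero.2 hσ
  have h5 : (v : ℂ) ≠ 0 := Complex.ofReal_ne_zero.2 hv
  rw [smul_eq_mul, Complex.ofReal_mul]
  have := Complex.I_ne_zero
  field_simp

lemma norm_exp_neg_mul_I_sub_one_le (t : ℝ) : ‖Complex.exp (-(t * Complex.I)) - 1‖ ≤ |t| := by
  have := Real.norm_exp_I_mul_ofReal_sub_one_le (x := -t)
  rw [Real.norm_eq_abs, abs_neg] at this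
  convert this using 4
  push_cast
  ring

/-- Along the axis the phase has derivative -b e^{-iσv}/v. The lower bound for Re b supplies the
power; replacing e^{-iσv} by 1 costs 2Cεv^{-α} and the error in the lower bound at most Cεv^{-α},
which are integrable at 0. -/
lemma IsRate.re_phase_sub_le (hb : IsRate α C c ε b) (hα : 0 < α) (hα2 : α < 1 / 2) (hC : 0 ≤ C)
    (hε : 0 < ε) (hε1 : ε ≤ 1) {σ : ℝ} (hσ : |σ| = 1) {r v : ℝ} (hr : 0 < r) (hrv : r ≤ v)
    (hv1 : v ≤ 1) :
    (phase b ((σ * v : ℝ) * Complex.I) - phase b ((σ * r : ℝ) * Complex.I)).re ≤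
      c * ε / α * (v ^ (-α) - r ^ (-α)) + 6 * C := by
  have hσ0 : σ ≠ 0 := abs_pos.1 (by rw [hσ]; exact one_pos)
  -- The real phase minus primitives of its main term and of the error 3Cεv^{-α}; the estimate is
  -- the monotonicity of G.
  set G : ℝ → ℝ := fun v => (phase b ((σ * v : ℝ) * Complex.I)).re - c * ε / α * v ^ (-α) -
    3 * C * ε / (1 - α) * v ^ (1 - α) with hG
  have hα1 : 0 < 1 - α := by linarith
  have hGd : ∀ v : ℝ, 0 < v → HasDerivAt G
      ((-(b ((σ * v : ℝ) * Complex.I) / v * Complex.exp (-((σ * v : ℝ) * Complex.I)))).re +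
        c * ε * v ^ (-α - 1) - 3 * C * ε * v ^ (-α)) v := by
    intro v hv
    have h1 := (hb.hasDerivAt_phase_ray hα (by linarith) hC hε hσ0 hv.ne')
    have h2 := (Complex.reCLM.hasFDerivAt.comp_hasDerivAt v h1)
    have h3 := (h2.sub ((Real.hasDerivAt_rpow_const (p := -α) (Or.inl hv.ne')).const_mul
      (c * ε / α))).sub ((Real.hasDerivAt_rpow_const (p := 1 - α) (Or.inl hv.ne')).const_mul
      (3 * C * ε / (1 - α)))
    refine h3.congr_deriv ?_
    have e : 1 - α - 1 = -α := by ring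
    simp only [Complex.reCLM_apply, e]
    field_simp
    ring
  have hneg : ∀ v : ℝ, 0 < v → v ≤ 1 →
      (-(b ((σ * v : ℝ) * Complex.I) / v * Complex.exp (-((σ * v : ℝ) * Complex.I)))).re +
        c * ε * v ^ (-α - 1) - 3 * C * ε * v ^ (-α) ≤ 0 := by
    intro v hv hv1
    set t := σ * v with ht
    have ht1 : |t| = v := by rw [ht, abs_mul, hσ, one_mul, abs_of_pos hv]
    have ht0 : t ≠ 0 := mul_ne_zero hσ0 hv.ne'
    have hn : ‖(t : ℂ) * Complex.I‖ = v := by simp [ht1]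
    have hre : ((t : ℂ) * Complex.I).re = 0 := by simp
    have hne : (t : ℂ) * Complex.I ≠ 0 := by
      rw [← norm_pos_iff, hn]; exact hv
    have h1 := hb.lower _ hre hne (by rw [hn]; exact hv1)
    have h2 := hb.bound _ (mem_slitPlane_of_re_eq_zero hre hne)
    rw [hn] at h1 h2
    have h3 : ‖b (t * Complex.I)‖ ≤ C * ε * (2 * v ^ (-α)) := by
      refine h2.trans ?_
      have := Real.rpow_le_rpow_of_exponent_ge hv hv1 (by linarith : -α ≤ α)
      gcongr
      linarith
    have h4 := norm_exp_neg_mul_I_sub_one_le t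
    rw [ht1] at h4
    have h5 : |(b (t * Complex.I) * (Complex.exp (-(t * Complex.I)) - 1)).re| ≤
        C * ε * (2 * v ^ (-α)) * v := by
      refine (Complex.abs_re_le_norm _).trans ?_
      rw [norm_mul]
      gcongr
    have h6 := (abs_le.1 h5).1
    have h7 : (b (t * Complex.I) * Complex.exp (-(t * Complex.I))).re =
        (b (t * Complex.I)).re + (b (t * Complex.I) * (Complex.exp (-(t * Complex.I)) - 1)).re := by
      rw [← Complex.add_re]; congr 1; ring
    have e1 : v ^ (-α - 1) = v ^ (-α) / v := by
      rw [Real.rpow_sub_one hv.ne']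
    have e2 : (-(b (t * Complex.I) / v * Complex.exp (-(t * Complex.I)))).re =
        -((b (t * Complex.I) * Complex.exp (-(t * Complex.I))).re / v) := by
      rw [← Complex.div_ofReal_re, ← Complex.neg_re]
      congr 1
      ring
    rw [e2, e1, h7]
    have h8 : v ≤ v ^ (-α) * v :=
      le_mul_of_one_le_left hv.le (Real.one_le_rpow_of_pos_of_le_one_of_nonpos hv hv1 (by linarith))
    have h9 := mul_le_mul_of_nonneg_left h8 (by positivity : 0 ≤ C * ε)
    have h10 : -((b (t * Complex.I)).re + (b (t * Complex.I) *
        (Complex.exp (-(t * Complex.I)) - 1)).re) + c * ε * v ^ (-α) -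
        3 * C * ε * v ^ (-α) * v ≤ 0 := by linarith
    have h11 := div_nonpos_of_nonpos_of_nonneg h10 hv.le
    refine le_trans (le_of_eq ?_) h11
    field_simp
  have hanti : AntitoneOn G (Icc r v) := by
    refine antitoneOn_of_deriv_nonpos (convex_Icc r v) ?_ ?_ ?_
    · exact fun x hx => (hGd x (hr.trans_le hx.1)).continuousAt.continuousWithinAt
    · intro x hx
      rw [interior_Icc] at hx
      exact (hGd x (hr.trans hx.1)).differentiableAt.differentiableWithinAt
    · intro x hx
      rw [interior_Icc] at hx
      rw [(hGd x (hr.trans hx.1)).deriv]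
      exact hneg x (hr.trans hx.1) (hx.2.le.trans hv1)
  have h1 := hanti (left_mem_Icc.2 hrv) (right_mem_Icc.2 hrv) hrv
  simp only [hG] at h1
  have h2 : v ^ (1 - α) ≤ 1 := Real.rpow_le_one (hr.le.trans hrv) hv1 hα1.le
  have h3 : 0 ≤ r ^ (1 - α) := Real.rpow_nonneg hr.le _
  have h4 : 3 * C * ε / (1 - α) ≤ 6 * C := by
    rw [div_le_iff₀ hα1]
    have : C * ε ≤ C * 1 := by gcongr
    have : C * (1 / 2) ≤ C * (1 - α) := by gcongr; linarith
    linarith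
  have h5 : 3 * C * ε / (1 - α) * (v ^ (1 - α) - r ^ (1 - α)) ≤ 6 * C * 1 := by
    refine mul_le_mul_of_nonneg h4 (by linarith) (by positivity) (by norm_num)
  rw [Complex.sub_re]
  linarith

lemma one_sub_rpow_ge {s : ℝ} (hs : 0 < s) (hα : 0 ≤ α) (hα1 : α ≤ 1) :
    α * (1 - s) ≤ 1 - s ^ α := by
  have := rpow_one_add_le_one_add_mul_self (s := s - 1) (p := α) (by linarith) hα hα1
  rw [add_sub_cancel] at this
  linarith

/-- With v = |t|, v^{-α} - (sv)^{-α} = -(1 - s^α)(sv)^{-α} and 1 - s^α ≥ α(1-s) by Bernoulli. Beyond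
|t| = 1 the phase is bounded, so intervals that cross 1 are split there. -/
lemma IsRate.isPhase (hb : IsRate α C c ε b) (hα : 0 < α) (hα2 : α < 1 / 2) (hC : 0 ≤ C)
    (hc : 0 < c) (hε : 0 < ε) (hε1 : ε ≤ 1) :
    IsPhase ε α c (10 * C + c / α + c) (fun t => phase b (t * Complex.I))
      (fun t => b (t * Complex.I)) := by
  refine ⟨fun t ht => ?_, fun t ht s hs => ?_⟩
  · have h := hb.hasDerivAt_phase hα (by linarith) hC hε ht
    refine (h.scomp t (hasDerivAt_ofReal_mul_I t)).congr_deriv ?_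
    have h5 : (t : ℂ) ≠ 0 := Complex.ofReal_ne_zero.2 ht
    have := Complex.I_ne_zero
    rw [smul_eq_mul]
    field_simp
  · obtain ⟨hs0, hs1⟩ := hs
    set v := |t| with hv
    have hv0 : 0 < v := abs_pos.2 ht
    obtain ⟨σ, hσ, htσ⟩ : ∃ σ : ℝ, |σ| = 1 ∧ ∀ r : ℝ, r * t = σ * (r * v) := by
      rcases lt_or_gt_of_ne ht with h | h
      · exact ⟨-1, by simp, fun r => by rw [hv, abs_of_neg h]; ring⟩
      · exact ⟨1, by simp, fun r => by rw [hv, abs_of_pos h]; ring⟩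
    have ht1 : t = σ * v := by simpa using htσ 1
    have hst := htσ s
    have hbd : ∀ x : ℝ, 1 ≤ |x| → |(phase b (x * Complex.I)).re| ≤ 2 * C := fun x hx =>
      (Complex.abs_re_le_norm _).trans (hb.norm_phase_le hα (by linarith) hC hε hε1 hx)
    have hcα : 0 < c / α := by positivity
    have hsv : 0 < s * v := by positivity
    rcases le_or_gt v 1 with h1 | h1
    · have h2 := hb.re_phase_sub_le hα hα2 hC hε hε1 hσ hsv
        (mul_le_of_le_one_left hv0.le hs1.le) h1
      rw [← ht1, ← hst] at h2
      refine h2.trans ?_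
      have e : v ^ (-α) = s ^ α * (s * v) ^ (-α) := by
        rw [Real.mul_rpow hs0.le hv0.le, ← mul_assoc, ← Real.rpow_add hs0]; simp
      rw [e]
      have h3 := mul_le_mul_of_nonneg_right (one_sub_rpow_ge hs0 hα.le (by linarith : α ≤ 1))
        (by positivity : 0 ≤ c * ε / α * (s * v) ^ (-α))
      have h4 : α * (1 - s) * (c * ε / α * (s * v) ^ (-α)) =
          c * ((1 - s) * (ε * (s * v) ^ (-α))) := by field_simp
      rw [h4] at h3
      nlinarith
    · rcases le_or_gt 1 (s * v) with h2 | h2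
      · have a1 := (abs_le.1 (hbd t (by rw [← hv]; exact h1.le))).2
        have a2 := (abs_le.1 (hbd (s * t) (by rw [abs_mul, abs_of_pos hs0]; exact h2))).1
        have a3 : (s * v) ^ (-α) ≤ 1 := Real.rpow_le_one_of_one_le_of_nonpos h2 (by linarith)
        have a4 : c * ((1 - s) * (ε * (s * v) ^ (-α))) ≤ c * (1 * (1 * 1)) := by
          gcongr
          linarith
        rw [Complex.sub_re]
        linarith
      · have a1 := (abs_le.1 (hbd t (by rw [← hv]; exact h1.le))).2
        have a2 := (abs_le.1 (hbd (σ * (1 : ℝ)) (by rw [mul_one]; exact hσ.ge))).1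
        have a3 := hb.re_phase_sub_le hα hα2 hC hε hε1 hσ hsv h2.le le_rfl
        rw [← hst, Real.one_rpow, Complex.sub_re] at a3
        rw [Complex.sub_re]
        have a4 : c * ((1 - s) * (ε * (s * v) ^ (-α))) ≤ c * ε / α * (s * v) ^ (-α) := by
          have : c * ((1 - s) * (ε * (s * v) ^ (-α))) =
            c * ε * (1 - s) * (s * v) ^ (-α) := by ring
          rw [this]
          gcongr
          rw [le_div_iff₀ hα]
          have : (1 - s) * α ≤ 1 * 1 := by gcongr <;> linarith
          calc c * ε * (1 - s) * α = c * ε * ((1 - s) * α) := by ring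
            _ ≤ c * ε * (1 * 1) := by gcongr
            _ = c * ε := by ring
        have a5 : c * ε / α ≤ c * 1 / α := by gcongr
        push_cast at a2 a3 ⊢
        rw [mul_one] at a5
        linarith

end

end SelfSim
end

/-! ### The damped kernel and its derivative. -/

noncomputable section

namespace SelfSim

/-- The integrand `B(st) e^{φ(t) - φ(st)} / (1 + it)`. -/
def kernelFun (φ B : ℝ → ℂ) (s t : ℝ) : ℂ :=
  B (s * t) * Complex.exp (φ t - φ (s * t)) * (1 + t * Complex.I)⁻¹

lemma pow_mul_exp_neg_le (k : ℕ) {c : ℝ} (hc : 0 < c) :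
    ∃ M : ℝ, 0 ≤ M ∧ ∀ x : ℝ, 0 ≤ x → x ^ k * Real.exp (-(c * x)) ≤ M := by
  refine ⟨k.factorial / c ^ k, by positivity, fun x hx => ?_⟩
  have h := Real.pow_div_factorial_le_exp (c * x) (by positivity) k
  rw [Real.exp_neg, ← div_eq_mul_inv, div_le_div_iff₀ (Real.exp_pos _) (by positivity), ← mul_pow,
    mul_comm x]
  rw [div_le_iff₀ (by positivity)] at h
  linarith

lemma half_rpow_neg_le_two {α : ℝ} (hα1 : α ≤ 1) : (1 / 2 : ℝ) ^ (-α) ≤ 2 := by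
  rw [one_div, Real.inv_rpow (by norm_num), Real.rpow_neg (by norm_num), inv_inv]
  exact two_rpow_le_two hα1

/-- For s ≤ 1/2 the exponential controls every power; for s > 1/2 one has st ≥ 1/2, so the base is
at most 2. -/
lemma weight_pow_le_of_one_le (k : ℕ) {c α : ℝ} (hc : 0 < c) (hα : 0 < α) (hα1 : α ≤ 1) :
    ∃ M : ℝ, 0 ≤ M ∧ ∀ ε s t : ℝ, 0 < ε → ε ≤ 1 → s ∈ Ioo (0 : ℝ) 1 → 1 ≤ t →
      (ε * (s * t) ^ (-α)) ^ k * Real.exp (-(c * ((1 - s) * (ε * (s * t) ^ (-α))))) ≤ M := by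
  obtain ⟨M, hM0, hM⟩ := pow_mul_exp_neg_le k (half_pos hc)
  refine ⟨max M (2 ^ k), le_max_of_le_left hM0, fun ε s t hε hε1 hs ht => ?_⟩
  obtain ⟨hs0, hs1⟩ := hs
  have ht0 : 0 < t := by linarith
  set A := ε * (s * t) ^ (-α) with hA
  have hA0 : 0 ≤ A := by positivity
  rcases le_or_gt s (1 / 2) with h | h
  · refine le_trans ?_ ((hM A hA0).trans (le_max_left _ _))
    refine mul_le_mul_of_nonneg_left (Real.exp_le_exp.2 ?_) (by positivity)
    have : 1 / 2 * A ≤ (1 - s) * A := by gcongr; linarith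
    have := mul_le_mul_of_nonneg_left this hc.le
    linarith
  · refine le_trans ?_ (le_max_right _ _)
    have h1 : A ≤ 2 := by
      have : (s * t) ^ (-α) ≤ (1 / 2) ^ (-α) :=
        Real.rpow_le_rpow_of_nonpos (by norm_num) (by nlinarith) (by linarith)
      have h2 := half_rpow_neg_le_two hα1
      calc A ≤ 1 * 2 := by rw [hA]; gcongr; linarith
        _ = 2 := by norm_num
    calc A ^ k * Real.exp (-(c * ((1 - s) * A))) ≤ 2 ^ k * 1 := by
          gcongr
          rw [Real.exp_le_one_iff, neg_nonpos]
          have : 0 ≤ 1 - s := by linarith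
          positivity
      _ = 2 ^ k := by ring

/-- The gain from damping: order k costs only |t|^{-α(k-1+η)}, almost one power less than the
trivial bound, if the integrable singularity (1-s)^{-(1-η)} at s = 1 is accepted. The constant does
not depend on ε. -/
lemma weight_pow_le_of_le_one (k : ℕ) {c α η a : ℝ} (hc : 0 < c) (hα : 0 < α) (hα1 : α ≤ 1)
    (hη : 0 < η) (hη1 : η ≤ 1) (ha : 0 ≤ a) (hak : α * (k - 1 + η) ≤ a) :
    ∃ M : ℝ, 0 ≤ M ∧ ∀ ε s t : ℝ, 0 < ε → ε ≤ 1 → s ∈ Ioo (0 : ℝ) 1 → 0 < t → t ≤ 1 →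
      (ε * (s * t) ^ (-α)) ^ k * Real.exp (-(c * ((1 - s) * (ε * (s * t) ^ (-α))))) ≤
        M * ((1 - s) ^ (-(1 - η)) * t ^ (-a)) := by
  obtain ⟨M, hM0, hM⟩ := pow_mul_exp_neg_le k (half_pos hc)
  obtain ⟨M1, hM10, hM1⟩ := pow_mul_exp_neg_le 1 hc
  refine ⟨max (max M 1) (2 ^ k * (1 + M1)), by positivity, fun ε s t hε hε1 hs ht ht1 => ?_⟩
  obtain ⟨hs0, hs1⟩ := hs
  set A := ε * (s * t) ^ (-α) with hA
  have hA0 : 0 < A := by positivity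
  have hs' : 0 < 1 - s := by linarith
  have g1 : 1 ≤ (1 - s) ^ (-(1 - η)) :=
    Real.one_le_rpow_of_pos_of_le_one_of_nonpos hs' (by linarith) (by linarith)
  have g2 : 1 ≤ t ^ (-a) :=
    Real.one_le_rpow_of_pos_of_le_one_of_nonpos ht ht1 (by linarith)
  have g3 : 1 ≤ (1 - s) ^ (-(1 - η)) * t ^ (-a) := one_le_mul_of_one_le_of_one_le g1 g2
  have bdd : ∀ {x : ℝ}, x ≤ max M 1 → x ≤ max (max M 1) (2 ^ k * (1 + M1)) *
      ((1 - s) ^ (-(1 - η)) * t ^ (-a)) := fun {x} hx => by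
    refine (hx.trans (le_max_left _ _)).trans (le_mul_of_one_le_right ?_ g3)
    positivity
  rcases le_or_gt s (1 / 2) with h | h
  · refine bdd (le_trans ?_ ((hM A hA0.le).trans (le_max_left _ _)))
    refine mul_le_mul_of_nonneg_left (Real.exp_le_exp.2 ?_) (by positivity)
    have : 1 / 2 * A ≤ (1 - s) * A := by gcongr; linarith
    have := mul_le_mul_of_nonneg_left this hc.le
    linarith
  · rcases Nat.eq_zero_or_pos k with rfl | hk
    · refine bdd (le_trans ?_ (le_max_right _ _))
      rw [pow_zero, one_mul, Real.exp_le_one_iff, neg_nonpos]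
      positivity
    · set x := (1 - s) * A with hx
      have hx0 : 0 < x := by positivity
      have hk1 : (1 : ℝ) ≤ k := by exact_mod_cast hk
      -- The power 1-η of A is traded for the same power of x = (1-s)A, which the exponential
      -- e^{-cx} absorbs.
      have e1 : A ^ k = A ^ (k - 1 + η) * (x ^ (1 - η) * (1 - s) ^ (-(1 - η))) := by
        rw [hx, Real.mul_rpow hs'.le hA0.le, mul_comm ((1 - s) ^ (1 - η)), mul_assoc,
          ← Real.rpow_add hs', add_neg_cancel, Real.rpow_zero, mul_one, ← Real.rpow_add hA0,
          ← Real.rpow_natCast]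
        congr 1
        ring
      have e2 : x ^ (1 - η) * Real.exp (-(c * x)) ≤ 1 + M1 := by
        have : x ^ (1 - η) ≤ 1 + x := rpow_le_one_add hx0 (by linarith) (by linarith)
        have h3 := hM1 x hx0.le
        rw [pow_one] at h3
        have h4 : Real.exp (-(c * x)) ≤ 1 := by
          rw [Real.exp_le_one_iff, neg_nonpos]; positivity
        have h5 := mul_le_mul_of_nonneg_right this (Real.exp_pos (-(c * x))).le
        linarith
      have e3 : A ^ (k - 1 + η) ≤ 2 ^ k * t ^ (-a) := by
        have hA2 : A ≤ 2 * t ^ (-α) := by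
          have : (s * t) ^ (-α) ≤ 2 * t ^ (-α) := by
            rw [Real.mul_rpow hs0.le ht.le]
            gcongr
            have : s ^ (-α) ≤ (1 / 2) ^ (-α) :=
              Real.rpow_le_rpow_of_nonpos (by norm_num) h.le (by linarith)
            exact this.trans (half_rpow_neg_le_two hα1)
          calc A ≤ 1 * (2 * t ^ (-α)) := by rw [hA]; gcongr
            _ = _ := one_mul _
        have hk2 : (0 : ℝ) ≤ k - 1 + η := by linarith
        calc A ^ (k - 1 + η) ≤ (2 * t ^ (-α)) ^ (k - 1 + η) := by gcongr
          _ = 2 ^ (k - 1 + η) * t ^ (-(α * (k - 1 + η))) := by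
            rw [Real.mul_rpow (by norm_num) (by positivity), ← Real.rpow_mul ht.le]
            ring_nf
          _ ≤ 2 ^ (k : ℝ) * t ^ (-a) := by
            refine mul_le_mul ?_ ?_ (by positivity) (by positivity)
            · exact Real.rpow_le_rpow_of_exponent_le one_le_two (by linarith)
            · exact Real.rpow_le_rpow_of_exponent_ge ht ht1 (by linarith)
          _ = _ := by rw [Real.rpow_natCast]
      calc A ^ k * Real.exp (-(c * x))
          = A ^ (k - 1 + η) * (x ^ (1 - η) * Real.exp (-(c * x))) * (1 - s) ^ (-(1 - η)) := by
            rw [e1]; ring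
        _ ≤ 2 ^ k * t ^ (-a) * (1 + M1) * (1 - s) ^ (-(1 - η)) := by gcongr
        _ = 2 ^ k * (1 + M1) * ((1 - s) ^ (-(1 - η)) * t ^ (-a)) := by ring
        _ ≤ _ := by
          gcongr
          exact le_max_right _ _

section

variable {ε α γ c D DB Dβ : ℝ} {k : ℕ} {φ β β' B B' : ℝ → ℂ}

lemma norm_exp_mul_I_neg (t : ℝ) : ‖Complex.exp (-(t * Complex.I))‖ = 1 := by
  rw [Complex.norm_exp]; simp

/-- The increment of `t ∂φ/∂t` between `st` and `t`. -/
def phaseIncrement (β : ℝ → ℂ) (s t : ℝ) : ℂ :=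
  β t * Complex.exp (-(t * Complex.I)) -
    β (s * t) * Complex.exp (-((s * t : ℝ) * Complex.I))

/-- For s > 1/2 this is the mean value inequality for r ↦ β(rt)e^{-irt} on [s, 1]; for s ≤ 1/2 the
triangle inequality suffices. The factor 1-s makes the bound a multiple of the exponent in the
damping factor, which can therefore absorb it. -/
lemma IsSymbol.norm_phaseIncrement_le (hβ : IsSymbol ε α 1 α Dβ β β') (hε : 0 < ε) (hα : 0 < α)
    (hD : 0 ≤ Dβ) {s t : ℝ} (hs : s ∈ Ioo (0 : ℝ) 1) (ht : t ≠ 0) (ht1 : |t| ≤ 1) :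
    ‖phaseIncrement β s t‖ ≤ 4 * Dβ * ((1 - s) * (ε * (s * |t|) ^ (-α))) := by
  obtain ⟨hs0, hs1⟩ := hs
  have ht0 : 0 < |t| := abs_pos.2 ht
  have hst : ∀ r : ℝ, 0 < r → |r * t| = r * |t| := fun r hr => by rw [abs_mul, abs_of_pos hr]
  set A := ε * (s * |t|) ^ (-α) with hA
  have hA0 : 0 < A := by positivity
  have hmono : ∀ r : ℝ, s ≤ r → ε * (r * |t|) ^ (-α) ≤ A := fun r hr => by
    rw [hA]
    exact mul_le_mul_of_nonneg_left (Real.rpow_le_rpow_of_nonpos (by positivity)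
      (by gcongr) (by linarith)) hε.le
  have hbd : ∀ r : ℝ, s ≤ r → r ≤ 1 → ‖β (r * t)‖ ≤ Dβ * A ∧ ‖β' (r * t)‖ ≤ Dβ * A := by
    intro r hr hr1
    have hr0 : 0 < r := hs0.trans_le hr
    have hne : r * t ≠ 0 := mul_ne_zero hr0.ne' ht
    have hle : |r * t| ≤ 1 := by
      rw [hst r hr0]; exact mul_le_one₀ hr1 ht0.le ht1
    have h1 := hβ.small _ hne hle
    have h2 := hβ.small' _ hne hle
    rw [hst r hr0, pow_one] at h1 h2
    exact ⟨h1.trans (mul_le_mul_of_nonneg_left (hmono r hr) hD),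
      h2.trans (mul_le_mul_of_nonneg_left (hmono r hr) hD)⟩
  rcases le_or_gt s (1 / 2) with h | h
  · have h1 := (hbd 1 hs1.le le_rfl).1
    have h2 := (hbd s le_rfl hs1.le).1
    rw [one_mul] at h1
    have h3 : ‖phaseIncrement β s t‖ ≤ Dβ * A + Dβ * A := by
      refine (norm_sub_le _ _).trans ?_
      rw [norm_mul, norm_mul, norm_exp_mul_I_neg, norm_exp_mul_I_neg, mul_one, mul_one]
      exact add_le_add h1 h2
    refine h3.trans ?_
    have : 1 / 2 * A ≤ (1 - s) * A := by gcongr; linarith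
    have := mul_le_mul_of_nonneg_left this hD
    linarith
  · set g : ℝ → ℂ := fun r => β (r * t) * Complex.exp (-((r * t : ℝ) * Complex.I)) with hg
    have hgd : ∀ r : ℝ, s ≤ r → HasDerivAt g
        ((β' (r * t) - (r * t : ℝ) * Complex.I * β (r * t)) / r *
          Complex.exp (-((r * t : ℝ) * Complex.I))) r := by
      intro r hr
      have hr0 : 0 < r := hs0.trans_le hr
      have h1 : HasDerivAt (fun r : ℝ => r * t) t r := by
        simpa using (hasDerivAt_id r).mul_const t
      have h2 := (hβ.hasDeriv (r * t) (mul_ne_zero hr0.ne' ht)).scomp r h1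
      have h3 : HasDerivAt (fun r : ℝ => Complex.exp (-((r * t : ℝ) * Complex.I)))
          (Complex.exp (-((r * t : ℝ) * Complex.I)) * -(t * Complex.I)) r :=
        ((h1.ofReal_comp.mul_const Complex.I).fun_neg).cexp
      refine (h2.mul h3).congr_deriv ?_
      have h4 : (r : ℂ) ≠ 0 := Complex.ofReal_ne_zero.2 hr0.ne'
      have h5 : (t : ℂ) ≠ 0 := Complex.ofReal_ne_zero.2 ht
      rw [Complex.real_smul, Complex.ofReal_mul, Function.comp_apply]
      field_simp
      ring
    have hgb : ∀ r ∈ Icc s 1, ‖(β' (r * t) - (r * t : ℝ) * Complex.I * β (r * t)) / r *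
          Complex.exp (-((r * t : ℝ) * Complex.I))‖ ≤ 4 * Dβ * A := by
      intro r hr
      have hr0 : 0 < r := hs0.trans_le hr.1
      obtain ⟨h1, h2⟩ := hbd r hr.1 hr.2
      rw [norm_mul, norm_exp_mul_I_neg, mul_one, norm_div, Complex.norm_real,
        Real.norm_of_nonneg hr0.le, div_le_iff₀ hr0]
      refine (norm_sub_le _ _).trans ?_
      rw [norm_mul, norm_mul, Complex.norm_I, mul_one, Complex.norm_real, Real.norm_eq_abs,
        hst r hr0]
      have h3 : r * |t| ≤ 1 := mul_le_one₀ hr.2 ht0.le ht1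
      have h4 : r * |t| * ‖β (r * t)‖ ≤ 1 * (Dβ * A) := by gcongr
      have h5 : 4 * Dβ * A * (1 / 2) ≤ 4 * Dβ * A * r := by
        gcongr
        linarith [hr.1]
      linarith
    have := Convex.norm_image_sub_le_of_norm_hasDerivWithin_le (s := Icc s 1) (f := g)
      (fun r hr => (hgd r hr.1).hasDerivWithinAt) hgb (convex_Icc s 1)
      (left_mem_Icc.2 hs1.le) (right_mem_Icc.2 hs1.le)
    simp only [hg, one_mul] at this
    rw [Real.norm_of_nonneg (by linarith)] at this
    calc ‖phaseIncrement β s t‖ ≤ 4 * Dβ * A * (1 - s) := this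
      _ = _ := by ring

lemma IsSymbol.norm_phaseIncrement_le' (hβ : IsSymbol ε α 1 α Dβ β β') (hα : 0 < α)
    (hε : 0 < ε) (hD : 0 ≤ Dβ) {s t : ℝ} (hs : s ∈ Ioo (0 : ℝ) 1) (ht1 : 1 ≤ |t|) :
    ‖phaseIncrement β s t‖ ≤ Dβ * (2 * |t| ^ α + ε * (s * |t|) ^ (-α)) := by
  obtain ⟨hs0, hs1⟩ := hs
  have ht0 : 0 < |t| := by linarith
  have hst : |s * t| = s * |t| := by rw [abs_mul, abs_of_pos hs0]
  have h2 : ‖β (s * t)‖ ≤ Dβ * (|t| ^ α + ε * (s * |t|) ^ (-α)) := by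
    rcases le_total |s * t| 1 with h | h
    · have := hβ.small _ (mul_ne_zero hs0.ne' (abs_pos.1 ht0)) h
      rw [hst, pow_one] at this
      refine this.trans (mul_le_mul_of_nonneg_left ?_ hD)
      have : 0 ≤ |t| ^ α := by positivity
      linarith
    · have := hβ.large _ h
      rw [hst] at this
      refine this.trans (mul_le_mul_of_nonneg_left ?_ hD)
      have h3 : (s * |t|) ^ α ≤ |t| ^ α :=
        Real.rpow_le_rpow (by positivity) (mul_le_of_le_one_left ht0.le hs1.le) hα.le
      have : 0 ≤ ε * (s * |t|) ^ (-α) := by positivity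
      linarith
  refine (norm_sub_le _ _).trans ?_
  rw [norm_mul, norm_mul, norm_exp_mul_I_neg, norm_exp_mul_I_neg, mul_one, mul_one]
  have := hβ.large t ht1
  linarith

lemma IsPhase.norm_exp_le (hφ : IsPhase ε α c D φ β) {s t : ℝ} (hs : s ∈ Ioo (0 : ℝ) 1)
    (ht : t ≠ 0) : ‖Complex.exp (φ t - φ (s * t))‖ ≤
      Real.exp D * Real.exp (-(c * ((1 - s) * (ε * (s * |t|) ^ (-α))))) := by
  rw [Complex.norm_exp, ← Real.exp_add]
  exact Real.exp_le_exp.2 (by linarith [hφ.decay t ht s hs])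

lemma hasDerivAt_exp_phase (hφ : IsPhase ε α c D φ β) {s t : ℝ} (hs : s ≠ 0) (ht : t ≠ 0) :
    HasDerivAt (fun t => Complex.exp (φ t - φ (s * t)))
      (Complex.exp (φ t - φ (s * t)) * (-phaseIncrement β s t / t)) t := by
  have h1 : HasDerivAt (fun t : ℝ => s * t) s t := by
    simpa using (hasDerivAt_id t).const_mul s
  have h2 := (hφ.hasDeriv (s * t) (mul_ne_zero hs ht)).scomp t h1
  refine ((hφ.hasDeriv t ht).sub h2).cexp.congr_deriv ?_
  congr 1
  have h4 : (s : ℂ) ≠ 0 := Complex.ofReal_ne_zero.2 hs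
  have h5 : (t : ℂ) ≠ 0 := Complex.ofReal_ne_zero.2 ht
  rw [phaseIncrement, Complex.real_smul, Complex.ofReal_mul]
  field_simp
  ring

/-- `t` times the derivative of `kernelFun φ B s`. -/
def kernelDeriv (φ β B B' : ℝ → ℂ) (s t : ℝ) : ℂ :=
  (B' (s * t) - B (s * t) * phaseIncrement β s t - B (s * t) * (t * Complex.I *
    (1 + t * Complex.I)⁻¹)) * Complex.exp (φ t - φ (s * t)) * (1 + t * Complex.I)⁻¹

lemma hasDerivAt_kernelFun (hφ : IsPhase ε α c D φ β) (hB : IsSymbol ε α k γ DB B B') {s t : ℝ}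
    (hs : s ≠ 0) (ht : t ≠ 0) :
    HasDerivAt (kernelFun φ B s) (kernelDeriv φ β B B' s t / t) t := by
  have h1 : HasDerivAt (fun t : ℝ => s * t) s t := by
    simpa using (hasDerivAt_id t).const_mul s
  have h2 := (hB.hasDeriv (s * t) (mul_ne_zero hs ht)).scomp t h1
  have h3 := (isSymbol_inv (ε := ε) (α := α)).hasDeriv t ht
  refine ((h2.mul (hasDerivAt_exp_phase hφ hs ht)).mul h3).congr_deriv ?_
  have h4 : (s : ℂ) ≠ 0 := Complex.ofReal_ne_zero.2 hs
  have h5 : (t : ℂ) ≠ 0 := Complex.ofReal_ne_zero.2 ht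
  have h6 := one_add_mul_I_ne_zero t
  rw [kernelDeriv, Complex.real_smul, Complex.ofReal_mul]
  simp only [Function.comp_apply, Pi.mul_apply]
  field_simp
  ring

lemma norm_mul_I_mul_inv_le (t : ℝ) : ‖t * Complex.I * (1 + t * Complex.I)⁻¹‖ ≤ 1 := by
  rw [norm_mul, norm_inv, ← div_eq_mul_inv, div_le_one (by linarith [one_le_norm_one_add_mul_I t])]
  simpa using abs_le_norm_one_add_mul_I t

lemma norm_kernelDeriv_le {s t P : ℝ} (hB : ‖B (s * t)‖ ≤ P) (hB' : ‖B' (s * t)‖ ≤ P) :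
    ‖kernelDeriv φ β B B' s t‖ ≤ P * (2 + ‖phaseIncrement β s t‖) *
      ‖Complex.exp (φ t - φ (s * t))‖ * ‖(1 + t * Complex.I)⁻¹‖ := by
  rw [kernelDeriv, norm_mul, norm_mul]
  gcongr
  refine (norm_sub_le _ _).trans ((add_le_add_left (norm_sub_le _ _) _).trans ?_)
  rw [norm_mul, norm_mul]
  have h1 := norm_mul_I_mul_inv_le t
  have h2 : ‖B (s * t)‖ * ‖t * Complex.I * (1 + t * Complex.I)⁻¹‖ ≤ P * 1 := by
    gcongr
    exact (norm_nonneg _).trans hB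
  have h3 : ‖B (s * t)‖ * ‖phaseIncrement β s t‖ ≤ P * ‖phaseIncrement β s t‖ := by gcongr
  linarith

end

end SelfSim
end

/-! ### Kernel bounds uniform in ε, s and the profile. -/

noncomputable section

namespace SelfSim

section

variable {α c D DB Dβ η a b : ℝ}

/-- One half of the exponent absorbs the phase increment, so t d/dt costs nothing near the origin;
the other half goes into `weight_pow_le_of_le_one`. -/
lemma exists_kernel_bounds_of_le_one (k : ℕ) (hc : 0 < c) (hα : 0 < α) (hα1 : α ≤ 1)
    (hη : 0 < η) (hη1 : η ≤ 1) (ha : 0 ≤ a) (hak : α * (k - 1 + η) ≤ a) (hDB : 0 ≤ DB)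
    (hDβ : 0 ≤ Dβ) :
    ∃ M : ℝ, 0 ≤ M ∧ ∀ (ε : ℝ) (φ β β' B B' : ℝ → ℂ), 0 < ε → ε ≤ 1 → IsPhase ε α c D φ β →
      IsSymbol ε α 1 α Dβ β β' → IsSymbol ε α k α DB B B' →
      ∀ s ∈ Ioo (0 : ℝ) 1, ∀ t : ℝ, t ≠ 0 → |t| ≤ 1 →
        ‖kernelFun φ B s t‖ ≤ M * ((1 - s) ^ (-(1 - η)) * |t| ^ (-a)) ∧
        ‖kernelDeriv φ β B B' s t‖ ≤ M * ((1 - s) ^ (-(1 - η)) * |t| ^ (-a)) := by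
  obtain ⟨M1, hM10, hM1⟩ := pow_mul_exp_neg_le 1 (half_pos hc)
  obtain ⟨M2, hM20, hM2⟩ := weight_pow_le_of_le_one k (half_pos hc) hα hα1 hη hη1 ha hak
  refine ⟨DB * Real.exp D * (2 + 4 * Dβ * M1) * M2, by positivity,
    fun ε φ β β' B B' hε hε1 hφ hβ hB s hs t ht ht1 => ?_⟩
  have hs0 := hs.1
  have hs1 := hs.2
  have ht0 : 0 < |t| := abs_pos.2 ht
  have hst : |s * t| = s * |t| := by rw [abs_mul, abs_of_pos hs0]
  have hst1 : |s * t| ≤ 1 := by rw [hst]; exact mul_le_one₀ hs1.le ht0.le ht1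
  have hst0 : s * t ≠ 0 := mul_ne_zero hs0.ne' ht
  have b1 := hB.small _ hst0 hst1
  have b2 := hB.small' _ hst0 hst1
  have b3 := hφ.norm_exp_le hs ht
  have b4 := hβ.norm_phaseIncrement_le hε hα hDβ hs ht ht1
  have b5 := hM2 ε s |t| hε hε1 hs ht0 ht1
  rw [hst] at b1 b2
  set A := ε * (s * |t|) ^ (-α) with hA
  have hA0 : 0 ≤ A := by positivity
  set x := (1 - s) * A with hx
  have hx0 : 0 ≤ x := mul_nonneg (by linarith) hA0
  have b6 := hM1 x hx0
  rw [pow_one] at b6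
  have hinv : ‖(1 + t * Complex.I)⁻¹‖ ≤ 1 := by
    rw [norm_inv]; exact inv_le_one_of_one_le₀ (one_le_norm_one_add_mul_I t)
  have esplit : Real.exp (-(c * x)) = Real.exp (-(c / 2 * x)) * Real.exp (-(c / 2 * x)) := by
    rw [← Real.exp_add]; ring_nf
  have hexp1 : Real.exp (-(c / 2 * x)) ≤ 1 := by
    rw [Real.exp_le_one_iff, neg_nonpos]; positivity
  have main : DB * A ^ k * (2 + 4 * Dβ * x) * (Real.exp D * Real.exp (-(c * x))) * 1 ≤
      DB * Real.exp D * (2 + 4 * Dβ * M1) * M2 * ((1 - s) ^ (-(1 - η)) * |t| ^ (-a)) := by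
    have h1 : (2 + 4 * Dβ * x) * Real.exp (-(c / 2 * x)) ≤ 2 + 4 * Dβ * M1 := by
      have := mul_le_mul_of_nonneg_left b6 (by positivity : 0 ≤ 4 * Dβ)
      nlinarith
    calc DB * A ^ k * (2 + 4 * Dβ * x) * (Real.exp D * Real.exp (-(c * x))) * 1
        = DB * Real.exp D * ((2 + 4 * Dβ * x) * Real.exp (-(c / 2 * x))) *
          (A ^ k * Real.exp (-(c / 2 * x))) := by rw [esplit]; ring
      _ ≤ DB * Real.exp D * (2 + 4 * Dβ * M1) *
          (M2 * ((1 - s) ^ (-(1 - η)) * |t| ^ (-a))) := by gcongr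
      _ = _ := by ring
  constructor
  · refine le_trans ?_ main
    rw [kernelFun, norm_mul, norm_mul]
    have h2 : 1 ≤ 2 + 4 * Dβ * x := by
      have : 0 ≤ 4 * Dβ * x := by positivity
      linarith
    gcongr
    exact b1.trans (le_mul_of_one_le_right (by positivity) h2)
  · refine (norm_kernelDeriv_le b1 b2).trans (le_trans ?_ main)
    gcongr

/-- At infinity the phase increment is of order |t|^α, so the derivative loses |t|^α. The exponent
2α - 1 remains negative because α < 1/2 in the application. -/
lemma exists_kernel_bounds_of_one_le (k : ℕ) (hc : 0 < c) (hα : 0 < α) (hα1 : α ≤ 1)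
    (hDB : 0 ≤ DB) (hDβ : 0 ≤ Dβ) :
    ∃ M : ℝ, 0 ≤ M ∧ ∀ (ε : ℝ) (φ β β' B B' : ℝ → ℂ), 0 < ε → ε ≤ 1 → IsPhase ε α c D φ β →
      IsSymbol ε α 1 α Dβ β β' → IsSymbol ε α k α DB B B' →
      ∀ s ∈ Ioo (0 : ℝ) 1, ∀ t : ℝ, 1 ≤ |t| →
        ‖kernelFun φ B s t‖ ≤ M * |t| ^ (α - 1) ∧
        ‖kernelDeriv φ β B B' s t‖ ≤ M * |t| ^ (2 * α - 1) := by
  obtain ⟨M3, hM30, hM3⟩ := weight_pow_le_of_one_le k hc hα hα1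
  obtain ⟨M4, hM40, hM4⟩ := weight_pow_le_of_one_le (k + 1) hc hα hα1
  refine ⟨DB * Real.exp D * ((2 + 3 * Dβ) * (M3 + M4 + 1)), by positivity,
    fun ε φ β β' B B' hε hε1 hφ hβ hB s hs t ht1 => ?_⟩
  have hs0 := hs.1
  have hs1 := hs.2
  have ht0 : 0 < |t| := by linarith
  have ht : t ≠ 0 := abs_pos.1 ht0
  have hst : |s * t| = s * |t| := by rw [abs_mul, abs_of_pos hs0]
  have hst0 : s * t ≠ 0 := mul_ne_zero hs0.ne' ht
  have b3 := hφ.norm_exp_le hs ht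
  have b4 := hβ.norm_phaseIncrement_le' hα hε hDβ hs ht1
  have b5 := hM3 ε s |t| hε hε1 hs ht1
  have b6 := hM4 ε s |t| hε hε1 hs ht1
  set A := ε * (s * |t|) ^ (-α) with hA
  have hA0 : 0 ≤ A := by positivity
  set x := (1 - s) * A with hx
  have hx0 : 0 ≤ x := mul_nonneg (by linarith) hA0
  set T := |t| ^ α with hT
  have hT1 : 1 ≤ T := Real.one_le_rpow ht1 hα.le
  have hinv : ‖(1 + t * Complex.I)⁻¹‖ ≤ |t|⁻¹ := by
    rw [norm_inv]
    exact inv_anti₀ ht0 (abs_le_norm_one_add_mul_I t)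
  have e1 : |t| ^ (α - 1) = T * |t|⁻¹ := by
    rw [Real.rpow_sub_one ht0.ne', div_eq_mul_inv]
  have e2 : |t| ^ (2 * α - 1) = T * T * |t|⁻¹ := by
    rw [Real.rpow_sub_one ht0.ne', div_eq_mul_inv, two_mul, Real.rpow_add ht0]
  rw [e1, e2]
  -- P bounds the amplitude at st in both regimes, |st| ≤ 1 and |st| ≥ 1, where the symbol bounds
  -- differ.
  obtain ⟨P, hP0, hP1, hP2, hPT, hPA⟩ : ∃ P : ℝ, 0 ≤ P ∧ ‖B (s * t)‖ ≤ DB * P ∧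
      ‖B' (s * t)‖ ≤ DB * P ∧ P * Real.exp (-(c * x)) ≤ (M3 + M4 + 1) * T ∧
      P * Real.exp (-(c * x)) * A ≤ (M3 + M4 + 1) * T := by
    rcases le_total |s * t| 1 with h | h
    · have b1 := hB.small _ hst0 h
      have b2 := hB.small' _ hst0 h
      rw [hst] at b1 b2
      refine ⟨A ^ k, by positivity, b1, b2, ?_, ?_⟩
      · refine b5.trans ((?_ : M3 ≤ M3 + M4 + 1).trans (le_mul_of_one_le_right (by positivity) hT1))
        linarith
      · have : A ^ k * Real.exp (-(c * x)) * A = A ^ (k + 1) * Real.exp (-(c * x)) := by ring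
        rw [this]
        refine b6.trans ((?_ : M4 ≤ M3 + M4 + 1).trans (le_mul_of_one_le_right (by positivity) hT1))
        linarith
    · have b1 := hB.large _ h
      have b2 := hB.large' _ h
      rw [hst] at b1 b2 h
      have hle : (s * |t|) ^ α ≤ T :=
        Real.rpow_le_rpow (by positivity) (mul_le_of_le_one_left ht0.le hs1.le) hα.le
      have hexp : Real.exp (-(c * x)) ≤ 1 := by
        rw [Real.exp_le_one_iff, neg_nonpos]; positivity
      have hA1 : A ≤ 1 := by
        rw [hA]
        exact mul_le_one₀ hε1 (by positivity)
          (Real.rpow_le_one_of_one_le_of_nonpos h (by linarith))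
      have h1 : T * Real.exp (-(c * x)) ≤ T * 1 := by gcongr
      have h2 : T * Real.exp (-(c * x)) * A ≤ T * 1 * 1 := by gcongr
      have h3 : 0 ≤ (M3 + M4) * T := by positivity
      exact ⟨T, by positivity, b1.trans (mul_le_mul_of_nonneg_left hle hDB),
        b2.trans (mul_le_mul_of_nonneg_left hle hDB), by linarith, by linarith⟩
  constructor
  · rw [kernelFun, norm_mul, norm_mul]
    calc ‖B (s * t)‖ * ‖Complex.exp (φ t - φ (s * t))‖ * ‖(1 + t * Complex.I)⁻¹‖
        ≤ DB * P * (Real.exp D * Real.exp (-(c * x))) * |t|⁻¹ := by gcongr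
      _ = DB * Real.exp D * (P * Real.exp (-(c * x))) * |t|⁻¹ := by ring
      _ ≤ DB * Real.exp D * (1 * ((M3 + M4 + 1) * T)) * |t|⁻¹ := by
        rw [one_mul]; gcongr
      _ ≤ DB * Real.exp D * ((2 + 3 * Dβ) * ((M3 + M4 + 1) * T)) * |t|⁻¹ := by
        gcongr
        linarith
      _ = _ := by ring
  · refine (norm_kernelDeriv_le hP1 hP2).trans ?_
    have h1 : P * Real.exp (-(c * x)) * (2 + Dβ * (2 * T + A)) ≤
        (2 + 3 * Dβ) * (M3 + M4 + 1) * (T * T) := by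
      have g0 : (M3 + M4 + 1) * T ≤ (M3 + M4 + 1) * T * T :=
        le_mul_of_one_le_right (by positivity) hT1
      have g1 := mul_le_mul_of_nonneg_right hPT (by positivity : 0 ≤ T)
      have g2 := mul_le_mul_of_nonneg_left (hPA.trans g0) hDβ
      have g3 := mul_le_mul_of_nonneg_left g1 hDβ
      have g4 := hPT.trans g0
      linarith
    calc DB * P * (2 + ‖phaseIncrement β s t‖) * ‖Complex.exp (φ t - φ (s * t))‖ *
          ‖(1 + t * Complex.I)⁻¹‖
        ≤ DB * P * (2 + Dβ * (2 * T + A)) * (Real.exp D * Real.exp (-(c * x))) * |t|⁻¹ := by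
          gcongr
      _ = DB * Real.exp D * (P * Real.exp (-(c * x)) * (2 + Dβ * (2 * T + A))) * |t|⁻¹ := by ring
      _ ≤ DB * Real.exp D * ((2 + 3 * Dβ) * (M3 + M4 + 1) * (T * T)) * |t|⁻¹ := by gcongr
      _ = _ := by ring

/-- The bounds on `kernelFun φ B s` and its derivative, uniformly in the parameters. -/
lemma exists_kernel_bounds (k : ℕ) (hc : 0 < c) (hα : 0 < α) (hα2 : α < 1 / 2)
    (hη : 0 < η) (hη1 : η ≤ 1) (ha : 0 ≤ a) (hak : α * (k - 1 + η) ≤ a) (hb : b ≤ 1 - 2 * α)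
    (hDB : 0 ≤ DB) (hDβ : 0 ≤ Dβ) :
    ∃ M : ℝ, 0 ≤ M ∧ ∀ (ε : ℝ) (φ β β' B B' : ℝ → ℂ), 0 < ε → ε ≤ 1 → IsPhase ε α c D φ β →
      IsSymbol ε α 1 α Dβ β β' → IsSymbol ε α k α DB B B' → ∀ s ∈ Ioo (0 : ℝ) 1,
        (∀ t : ℝ, t ≠ 0 → ‖kernelFun φ B s t‖ ≤
          M * (1 - s) ^ (-(1 - η)) * (|t| ^ (-a) + |t| ^ (-b))) ∧
        (∀ t : ℝ, t ≠ 0 → ‖kernelDeriv φ β B B' s t‖ ≤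
          M * (1 - s) ^ (-(1 - η)) * (|t| ^ (-a) + |t| ^ (-b))) ∧
        (∀ t : ℝ, 1 ≤ |t| → ‖kernelFun φ B s t‖ ≤ M * |t| ^ (α - 1)) := by
  obtain ⟨M1, hM10, hM1⟩ := exists_kernel_bounds_of_le_one (D := D) k hc hα (by linarith) hη hη1 ha
    hak hDB hDβ
  obtain ⟨M2, hM20, hM2⟩ := exists_kernel_bounds_of_one_le (D := D) k hc hα (by linarith) hDB hDβ
  refine ⟨M1 + M2, by positivity, fun ε φ β β' B B' hε hε1 hφ hβ hB s hs => ?_⟩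
  have hs' : 0 < 1 - s := by linarith [hs.2]
  have g1 : 1 ≤ (1 - s) ^ (-(1 - η)) :=
    Real.one_le_rpow_of_pos_of_le_one_of_nonpos hs' (by linarith [hs.1]) (by linarith)
  have key : ∀ {x t : ℝ}, t ≠ 0 → (|t| ≤ 1 → x ≤ M1 * ((1 - s) ^ (-(1 - η)) * |t| ^ (-a))) →
      (1 ≤ |t| → x ≤ M2 * |t| ^ (2 * α - 1)) →
      x ≤ (M1 + M2) * (1 - s) ^ (-(1 - η)) * (|t| ^ (-a) + |t| ^ (-b)) := by
    intro x t ht h1 h2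
    have ht0 : 0 < |t| := abs_pos.2 ht
    have p1 : 0 ≤ |t| ^ (-a) := by positivity
    have p2 : 0 ≤ |t| ^ (-b) := by positivity
    rcases le_total |t| 1 with h | h
    · refine (h1 h).trans ?_
      rw [← mul_assoc]
      gcongr <;> linarith
    · refine (h2 h).trans ?_
      have p3 : |t| ^ (2 * α - 1) ≤ |t| ^ (-b) :=
        Real.rpow_le_rpow_of_exponent_le h (by linarith)
      calc M2 * |t| ^ (2 * α - 1) ≤ (M1 + M2) * 1 * (|t| ^ (-a) + |t| ^ (-b)) := by
            gcongr <;> linarith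
        _ ≤ _ := by gcongr
  refine ⟨fun t ht => key ht (fun h => ?_) (fun h => ?_),
    fun t ht => key ht (fun h => ?_) (fun h => ?_), fun t h => ?_⟩
  · exact (hM1 ε φ β β' B B' hε hε1 hφ hβ hB s hs t ht h).1
  · refine (hM2 ε φ β β' B B' hε hε1 hφ hβ hB s hs t h).1.trans ?_
    gcongr
    linarith
  · exact (hM1 ε φ β β' B B' hε hε1 hφ hβ hB s hs t ht h).2
  · exact (hM2 ε φ β β' B B' hε hε1 hφ hβ hB s hs t h).2
  · refine (hM2 ε φ β β' B B' hε hε1 hφ hβ hB s hs t h).1.trans ?_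
    gcongr
    linarith

end

end SelfSim
end

/-! ### Oscillatory integrals with singular amplitudes. -/

noncomputable section

namespace SelfSim

section oscillatory

variable {a b M : ℝ}

lemma norm_exp_mul_I_real (t u : ℝ) : ‖Complex.exp (t * Complex.I * u)‖ = 1 := by
  rw [Complex.norm_exp]; simp

lemma integral_zero_rpow_neg {ρ : ℝ} (ha1 : a < 1) :
    ∫ t in (0 : ℝ)..ρ, t ^ (-a) = ρ ^ (1 - a) / (1 - a) := by
  rw [integral_rpow (Or.inl (by linarith)), Real.zero_rpow (by linarith)]
  rw [sub_zero]
  congr 1 <;> ring_nf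

lemma integral_rpow_neg_sub_one_le {ρ R : ℝ} (ha : 0 < a) (hρ : 0 < ρ) (hR : ρ ≤ R) :
    ∫ t in ρ..R, t ^ (-a - 1) ≤ ρ ^ (-a) / a := by
  rw [integral_rpow (Or.inr ⟨by linarith, by
    rw [uIcc_of_le hR]
    intro h
    linarith [h.1]⟩)]
  have e : -a - 1 + 1 = -a := by ring
  rw [e, div_neg, ← neg_div, neg_sub]
  have : 0 ≤ R ^ (-a) := Real.rpow_nonneg (hρ.le.trans hR) _
  gcongr
  linarith

/-- Split at ρ = 1/|u|. Below ρ the absolute value is integrated; beyond ρ one integration by parts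
gains 1/|u|, and both parts scale as |u|^{a-1} + |u|^{b-1}. The bound is independent of R. -/
lemma norm_integral_mul_exp_le {g g' : ℝ → ℂ} (ha : 0 < a) (ha1 : a < 1) (hb : 0 < b) (hb1 : b < 1)
    (hg : ∀ t : ℝ, 0 < t → HasDerivAt g (g' t / t) t)
    (hbd : ∀ t : ℝ, 0 < t → ‖g t‖ ≤ M * (t ^ (-a) + t ^ (-b)))
    (hbd' : ∀ t : ℝ, 0 < t → ‖g' t‖ ≤ M * (t ^ (-a) + t ^ (-b))) {R u : ℝ} (hR : 0 < R)
    (hu : u ≠ 0) (hgi : ∀ R : ℝ, IntervalIntegrable g volume 0 R) :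
    ‖∫ t in (0 : ℝ)..R, g t * Complex.exp (t * Complex.I * u)‖ ≤
      (1 / (1 - a) + 1 / (1 - b) + 2 + 1 / a + 1 / b) * M * (|u| ^ (a - 1) + |u| ^ (b - 1)) := by
  have hu0 : 0 < |u| := abs_pos.2 hu
  have hM : 0 ≤ M := by
    have h1 := (norm_nonneg _).trans (hbd 1 one_pos)
    simp only [Real.one_rpow] at h1
    linarith
  have e1 : 0 < 1 - a := by linarith
  have e2 : 0 < 1 - b := by linarith
  set ρ := |u|⁻¹ with hρ
  have hρ0 : 0 < ρ := by positivity
  have pw : ∀ p : ℝ, ρ ^ (1 - p) = |u| ^ (p - 1) := fun p => by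
    rw [hρ, Real.inv_rpow hu0.le, ← Real.rpow_neg hu0.le, neg_sub]
  have pw' : ∀ p : ℝ, ρ ^ (-p) * |u|⁻¹ = |u| ^ (p - 1) := fun p => by
    rw [hρ, Real.inv_rpow hu0.le, ← Real.rpow_neg hu0.le, neg_neg, Real.rpow_sub_one hu0.ne',
      div_eq_mul_inv]
  have hmint : ∀ x y : ℝ, IntervalIntegrable (fun t : ℝ => M * (t ^ (-a) + t ^ (-b))) volume x y :=
    fun x y => ((intervalIntegral.intervalIntegrable_rpow' (by linarith)).add
      (intervalIntegral.intervalIntegrable_rpow' (by linarith))).const_mul M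
  have hnear : ∀ r : ℝ, 0 < r → r ≤ ρ →
      ‖∫ t in (0 : ℝ)..r, g t * Complex.exp (t * Complex.I * u)‖ ≤
      (1 / (1 - a) + 1 / (1 - b)) * M * (|u| ^ (a - 1) + |u| ^ (b - 1)) := by
    intro r hr hrρ
    have h1 : ‖∫ t in (0 : ℝ)..r, g t * Complex.exp (t * Complex.I * u)‖ ≤
        ∫ t in (0 : ℝ)..r, M * (t ^ (-a) + t ^ (-b)) := by
      refine intervalIntegral.norm_integral_le_of_norm_le hr.le
        (Eventually.of_forall fun t ht => ?_) (hmint 0 r)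
      rw [norm_mul, norm_exp_mul_I_real, mul_one]
      exact hbd t ht.1
    refine h1.trans ?_
    rw [intervalIntegral.integral_const_mul, intervalIntegral.integral_add
      (intervalIntegral.intervalIntegrable_rpow' (by linarith))
      (intervalIntegral.intervalIntegrable_rpow' (by linarith)),
      integral_zero_rpow_neg ha1, integral_zero_rpow_neg hb1]
    have h2 : r ^ (1 - a) ≤ |u| ^ (a - 1) := by
      rw [← pw]; exact Real.rpow_le_rpow hr.le hrρ e1.le
    have h3 : r ^ (1 - b) ≤ |u| ^ (b - 1) := by
      rw [← pw]; exact Real.rpow_le_rpow hr.le hrρ e2.le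
    have p1 : 0 ≤ |u| ^ (a - 1) := by positivity
    have p2 : 0 ≤ |u| ^ (b - 1) := by positivity
    have q1 : 0 ≤ 1 / (1 - a) := by positivity
    have q2 : 0 ≤ 1 / (1 - b) := by positivity
    calc M * (r ^ (1 - a) / (1 - a) + r ^ (1 - b) / (1 - b))
        ≤ M * (|u| ^ (a - 1) / (1 - a) + |u| ^ (b - 1) / (1 - b)) := by gcongr
      _ = M * (1 / (1 - a) * |u| ^ (a - 1) + 1 / (1 - b) * |u| ^ (b - 1)) := by ring
      _ ≤ M * ((1 / (1 - a) + 1 / (1 - b)) * |u| ^ (a - 1) +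
          (1 / (1 - a) + 1 / (1 - b)) * |u| ^ (b - 1)) := by
        gcongr <;> linarith
      _ = _ := by ring
  have hpos : 0 ≤ (2 + 1 / a + 1 / b) * M * (|u| ^ (a - 1) + |u| ^ (b - 1)) := by positivity
  rcases le_or_gt R ρ with h | h
  · refine (hnear R hR h).trans ?_
    linarith
  · have hexp : Continuous fun t : ℝ => Complex.exp (t * Complex.I * u) := by fun_prop
    have hgi' : ∀ x y : ℝ, IntervalIntegrable (fun t : ℝ => g t * Complex.exp (t * Complex.I * u))
        volume x y := fun x y =>
      (((hgi x).symm).trans (hgi y)).mul_continuousOn hexp.continuousOn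
    rw [← intervalIntegral.integral_add_adjacent_intervals (hgi' 0 ρ) (hgi' ρ R)]
    have hfar : ‖∫ t in ρ..R, g t * Complex.exp (t * Complex.I * u)‖ ≤
        (2 + 1 / a + 1 / b) * M * (|u| ^ (a - 1) + |u| ^ (b - 1)) := by
      have hmem : ∀ t ∈ uIcc ρ R, 0 < t := fun t ht => by
        rw [uIcc_of_le h.le] at ht
        exact hρ0.trans_le ht.1
      have huI : (Complex.I * u : ℂ) ≠ 0 := mul_ne_zero Complex.I_ne_zero (Complex.ofReal_ne_zero.2 hu)
      have hvd : ∀ t ∈ uIcc ρ R, HasDerivAt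
          (fun t : ℝ => Complex.exp (t * Complex.I * u) / (Complex.I * u))
          (Complex.exp (t * Complex.I * u)) t := by
        intro t _
        have h1 : HasDerivAt (fun t : ℝ => (t : ℂ) * Complex.I * u) (Complex.I * u) t :=
          (hasDerivAt_ofReal_mul_I t).mul_const _
        exact (h1.cexp.div_const _).congr_deriv (by rw [mul_div_assoc, div_self huI, mul_one])
      have hdi : IntervalIntegrable (fun t : ℝ => deriv g t) volume ρ R := by
        have hcont : IntervalIntegrable (fun t : ℝ => M * (t ^ (-a) + t ^ (-b)) / t) volume ρ R := by
          refine ContinuousOn.intervalIntegrable fun t ht => ?_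
          have ht0 := hmem t ht
          refine ContinuousAt.continuousWithinAt ?_
          have c1 := Real.continuousAt_rpow_const t (-a) (Or.inl ht0.ne')
          have c2 := Real.continuousAt_rpow_const t (-b) (Or.inl ht0.ne')
          exact ((c1.add c2).const_mul M).div continuousAt_id ht0.ne'
        refine hcont.mono_fun' (measurable_deriv g).aestronglyMeasurable ?_
        rw [uIoc_of_le h.le]
        filter_upwards [ae_restrict_mem measurableSet_Ioc] with t ht
        have ht0 : 0 < t := hρ0.trans ht.1
        rw [(hg t ht0).deriv, norm_div, Complex.norm_real, Real.norm_of_nonneg ht0.le]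
        gcongr
        exact hbd' t ht0
      rw [intervalIntegral.integral_mul_deriv_eq_deriv_mul
        (fun t ht => (hg t (hmem t ht)).differentiableAt.hasDerivAt) hvd hdi
        hexp.continuousOn.intervalIntegrable]
      have hv : ∀ t : ℝ, ‖Complex.exp (t * Complex.I * u) / (Complex.I * u)‖ = |u|⁻¹ := fun t => by
        rw [norm_div, norm_exp_mul_I_real, norm_mul, Complex.norm_I, one_mul, Complex.norm_real,
          Real.norm_eq_abs, one_div]
      set m := |u| ^ (a - 1) + |u| ^ (b - 1) with hm
      have hmρ : (ρ ^ (-a) + ρ ^ (-b)) * |u|⁻¹ = m := by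
        rw [add_mul, pw', pw']
      have hb1 : ‖g R * (Complex.exp (R * Complex.I * u) / (Complex.I * u))‖ ≤ M * m := by
        rw [norm_mul, hv, ← hmρ, ← mul_assoc]
        gcongr
        refine (hbd R hR).trans ?_
        have h1 := Real.rpow_le_rpow_of_nonpos hρ0 h.le (by linarith : -a ≤ 0)
        have h2 := Real.rpow_le_rpow_of_nonpos hρ0 h.le (by linarith : -b ≤ 0)
        gcongr
      have hb2 : ‖g ρ * (Complex.exp (ρ * Complex.I * u) / (Complex.I * u))‖ ≤ M * m := by
        rw [norm_mul, hv, ← hmρ, ← mul_assoc]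
        gcongr
        exact hbd ρ hρ0
      have hii : ∀ p : ℝ, IntervalIntegrable (fun t : ℝ => t ^ (-p - 1)) volume ρ R := by
        intro p
        refine ContinuousOn.intervalIntegrable fun t ht => ?_
        exact (Real.continuousAt_rpow_const t _ (Or.inl (hmem t ht).ne')).continuousWithinAt
      have hb3 : ‖∫ t in ρ..R, deriv g t * (Complex.exp (t * Complex.I * u) / (Complex.I * u))‖ ≤
          (1 / a + 1 / b) * M * m := by
        have h1 : ‖∫ t in ρ..R, deriv g t * (Complex.exp (t * Complex.I * u) / (Complex.I * u))‖ ≤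
            ∫ t in ρ..R, M * |u|⁻¹ * (t ^ (-a - 1) + t ^ (-b - 1)) := by
          refine intervalIntegral.norm_integral_le_of_norm_le h.le
            (Eventually.of_forall fun t ht => ?_) (((hii a).add (hii b)).const_mul _)
          have ht0 : 0 < t := hρ0.trans ht.1
          rw [norm_mul, hv, (hg t ht0).deriv, norm_div, Complex.norm_real,
            Real.norm_of_nonneg ht0.le, Real.rpow_sub_one ht0.ne', Real.rpow_sub_one ht0.ne',
            ← add_div]
          have := hbd' t ht0
          calc ‖g' t‖ / t * |u|⁻¹ ≤ M * (t ^ (-a) + t ^ (-b)) / t * |u|⁻¹ := by gcongr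
            _ = _ := by ring
        refine h1.trans ?_
        rw [intervalIntegral.integral_const_mul, intervalIntegral.integral_add (hii a) (hii b)]
        have h2 := integral_rpow_neg_sub_one_le ha hρ0 h.le
        have h3 := integral_rpow_neg_sub_one_le hb hρ0 h.le
        have p1 : 0 ≤ ρ ^ (-a) := by positivity
        have p2 : 0 ≤ ρ ^ (-b) := by positivity
        have q1 : 0 ≤ 1 / a := by positivity
        have q2 : 0 ≤ 1 / b := by positivity
        calc M * |u|⁻¹ * ((∫ t in ρ..R, t ^ (-a - 1)) + ∫ t in ρ..R, t ^ (-b - 1))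
            ≤ M * |u|⁻¹ * (ρ ^ (-a) / a + ρ ^ (-b) / b) := by gcongr
          _ = M * |u|⁻¹ * (1 / a * ρ ^ (-a) + 1 / b * ρ ^ (-b)) := by ring
          _ ≤ M * |u|⁻¹ * ((1 / a + 1 / b) * ρ ^ (-a) + (1 / a + 1 / b) * ρ ^ (-b)) := by
            gcongr <;> linarith
          _ = (1 / a + 1 / b) * M * ((ρ ^ (-a) + ρ ^ (-b)) * |u|⁻¹) := by ring
          _ = _ := by rw [hmρ]
      refine (norm_sub_le _ _).trans ?_
      have := norm_sub_le (g R * (Complex.exp (R * Complex.I * u) / (Complex.I * u)))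
        (g ρ * (Complex.exp (ρ * Complex.I * u) / (Complex.I * u)))
      linarith
    refine (norm_add_le _ _).trans ?_
    have := hnear ρ hρ0 le_rfl
    linarith

/-- `J` and `t J'(t)` are bounded by `M (|t| ^ (-a) + |t| ^ (-b))`. -/
structure IsOscillatoryAmplitude (a b M : ℝ) (J J' : ℝ → ℂ) : Prop where
  hasDeriv : ∀ t : ℝ, t ≠ 0 → HasDerivAt J (J' t / t) t
  bound : ∀ t : ℝ, t ≠ 0 → ‖J t‖ ≤ M * (|t| ^ (-a) + |t| ^ (-b))
  bound' : ∀ t : ℝ, t ≠ 0 → ‖J' t‖ ≤ M * (|t| ^ (-a) + |t| ^ (-b))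

lemma measurable_of_hasDerivAt {J J' : ℝ → ℂ}
    (h : ∀ t : ℝ, t ≠ 0 → HasDerivAt J (J' t / t) t) : Measurable J :=
  measurable_of_continuousOn_compl_singleton 0 fun t ht =>
    (h t ht).continuousAt.continuousWithinAt

lemma intervalIntegrable_abs_rpow (ha1 : a < 1) (x y : ℝ) :
    IntervalIntegrable (fun t : ℝ => |t| ^ (-a)) volume x y := by
  have h0 : ∀ y : ℝ, 0 ≤ y → IntervalIntegrable (fun t : ℝ => |t| ^ (-a)) volume 0 y := by
    intro y hy
    refine (intervalIntegral.intervalIntegrable_rpow' (r := -a) (by linarith)).congr ?_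
    intro t ht
    rw [uIoc_of_le hy] at ht
    simp only
    rw [abs_of_pos ht.1]
  have h1 : ∀ y : ℝ, IntervalIntegrable (fun t : ℝ => |t| ^ (-a)) volume 0 y := by
    intro y
    rcases le_total 0 y with h | h
    · exact h0 y h
    · have := (h0 (-y) (by linarith)).comp_sub_left 0
      simpa using this
  exact (h1 x).symm.trans (h1 y)

lemma IsOscillatoryAmplitude.intervalIntegrable {J J' : ℝ → ℂ}
    (h : IsOscillatoryAmplitude a b M J J') (ha1 : a < 1) (hb1 : b < 1) (x y : ℝ) :
    IntervalIntegrable J volume x y := by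
  refine (((intervalIntegrable_abs_rpow ha1 x y).add
    (intervalIntegrable_abs_rpow hb1 x y)).const_mul M).mono_fun'
    (measurable_of_hasDerivAt h.hasDeriv).aestronglyMeasurable ?_
  refine ae_restrict_of_ae ?_
  filter_upwards [Measure.ae_ne volume (0 : ℝ)] with t ht
  exact h.bound t ht

lemma IsOscillatoryAmplitude.norm_integral_le {J J' : ℝ → ℂ}
    (h : IsOscillatoryAmplitude a b M J J') (ha : 0 < a) (ha1 : a < 1) (hb : 0 < b) (hb1 : b < 1)
    {R u : ℝ} (hR : 0 < R) (hu : u ≠ 0) :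
    ‖∫ t in (-R)..R, J t * Complex.exp (t * Complex.I * u)‖ ≤
      2 * (1 / (1 - a) + 1 / (1 - b) + 2 + 1 / a + 1 / b) * M *
        (|u| ^ (a - 1) + |u| ^ (b - 1)) := by
  have hexp : Continuous fun t : ℝ => Complex.exp (t * Complex.I * u) := by fun_prop
  have hi : ∀ x y, IntervalIntegrable (fun t : ℝ => J t * Complex.exp (t * Complex.I * u))
      volume x y := fun x y =>
    (h.intervalIntegrable ha1 hb1 x y).mul_continuousOn hexp.continuousOn
  rw [← intervalIntegral.integral_add_adjacent_intervals (hi (-R) 0) (hi 0 R)]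
  have h1 := norm_integral_mul_exp_le ha ha1 hb hb1 (fun t ht => h.hasDeriv t ht.ne')
    (fun t ht => by simpa [abs_of_pos ht] using h.bound t ht.ne')
    (fun t ht => by simpa [abs_of_pos ht] using h.bound' t ht.ne') hR hu
    (fun R => h.intervalIntegrable ha1 hb1 0 R)
  have h2 := norm_integral_mul_exp_le (g := fun t => J (-t)) (g' := fun t => J' (-t))
    ha ha1 hb hb1 (fun t ht => ?_)
    (fun t ht => by simpa [abs_of_pos ht] using h.bound (-t) (neg_ne_zero.2 ht.ne'))
    (fun t ht => by simpa [abs_of_pos ht] using h.bound' (-t) (neg_ne_zero.2 ht.ne')) hR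
    (neg_ne_zero.2 hu) (fun R => ?_)
  · have e : ∫ t in (0 : ℝ)..R, J (-t) * Complex.exp (t * Complex.I * (-u : ℝ)) =
        ∫ t in (-R)..0, J t * Complex.exp (t * Complex.I * u) := by
      have := intervalIntegral.integral_comp_neg (a := 0) (b := R)
        (fun t : ℝ => J t * Complex.exp (t * Complex.I * u))
      rw [neg_zero] at this
      rw [← this]
      congr 1
      ext t
      push_cast
      ring_nf
    rw [e, abs_neg] at h2
    refine (norm_add_le _ _).trans ?_
    linarith
  · have := (h.hasDeriv (-t) (neg_ne_zero.2 ht.ne')).scomp t (hasDerivAt_neg t)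
    refine this.congr_deriv ?_
    simp [div_neg]
  · have := (h.intervalIntegrable ha1 hb1 0 (-R)).comp_sub_left 0
    simpa using this

end oscillatory

/-! ### Weighted integrals of translated powers. -/

section weight

lemma lintegral_comp_abs_eq (F : ℝ → ENNReal) (hF : Measurable F) :
    ∫⁻ x : ℝ, F |x| = 2 * ∫⁻ x in Ioi (0 : ℝ), F x := by
  rw [← lintegral_add_compl _ (measurableSet_Ioi (a := (0 : ℝ))), compl_Ioi, two_mul]
  congr 1
  · exact setLIntegral_congr_fun measurableSet_Ioi fun x hx => by rw [abs_of_pos hx]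
  · rw [setLIntegral_congr (Iio_ae_eq_Iic (a := (0 : ℝ))).symm]
    have hmp := Measure.measurePreserving_neg (volume : Measure ℝ)
    have := hmp.setLIntegral_comp_preimage (measurableSet_Ioi (a := (0 : ℝ)))
      (f := fun x => F |x|) (hF.comp measurable_norm)
    simp only [abs_neg] at this
    have e : (fun x : ℝ => -x) ⁻¹' Ioi 0 = Iio 0 := by ext x; simp
    rw [show (Neg.neg ⁻¹' Ioi (0 : ℝ)) = Iio 0 from e] at this
    rw [this]
    exact setLIntegral_congr_fun measurableSet_Ioi fun x hx => by rw [abs_of_pos hx]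

lemma lintegral_Ioc_rpow {p h : ℝ} (hp : -1 < p) (hh : 0 ≤ h) :
    ∫⁻ x in Ioc 0 h, ENNReal.ofReal (x ^ p) = ENNReal.ofReal (h ^ (p + 1) / (p + 1)) := by
  rw [← ofReal_integral_eq_lintegral_ofReal]
  · rw [← intervalIntegral.integral_of_le hh, integral_rpow (Or.inl hp),
      Real.zero_rpow (by linarith), sub_zero]
  · exact (intervalIntegrable_iff_integrableOn_Ioc_of_le hh).1
      (intervalIntegral.intervalIntegrable_rpow' hp)
  · filter_upwards [ae_restrict_mem measurableSet_Ioc] with x hx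
    exact Real.rpow_nonneg hx.1.le _

/-- The weighted integral of a translated power. -/
lemma exists_lintegral_weight_le {a s : ℝ} (ha : 0 < a) (has : a < s) (hs1 : s < 1) :
    ∃ K : ℝ, 0 ≤ K ∧ ∀ P : ℝ, 0 ≤ P →
      ∫⁻ ξ in Ioi (0 : ℝ), ENNReal.ofReal (|ξ - P| ^ (a - 1) * (1 + ξ) ^ (-s)) ≤
        ENNReal.ofReal (K * (1 + P) ^ (a - s)) := by
  refine ⟨2 * (1 / 2) ^ (-s) * ((1 / 2) ^ a / a) + (1 / 2) ^ (a - 1) * (2 ^ (1 - s) / (1 - s)) +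
    (1 / 2) ^ (a - 1) * (2 ^ (a - s) / (s - a)), ?_, fun P hP => ?_⟩
  · have : 0 < 1 - s := by linarith
    have : 0 < s - a := by linarith
    positivity
  set N := 1 + P with hN
  have hN0 : 0 < N := by linarith
  set F : ℝ → ENNReal := fun r => (Ioc 0 (1 / 2 * N)).indicator
    (fun r => ENNReal.ofReal (r ^ (a - 1))) r with hF
  have hFm : Measurable F := Measurable.indicator (by fun_prop) measurableSet_Ioc
  -- With N = 1 + P the three majorants treat |ξ - P| ≤ N/2, where 1 + ξ ≥ N/2; the remaining ξ ≤
  -- 2N, where |ξ - P| > N/2; and ξ > 2N, where |ξ - P| ≥ ξ/2. Each contributes a multiple of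
  -- N^{a-s}.
  set f₁ : ℝ → ENNReal := fun ξ => ENNReal.ofReal ((1 / 2 * N) ^ (-s)) * F |ξ - P| with hf₁
  set f₂ : ℝ → ENNReal := fun ξ => (Ioc 0 (2 * N)).indicator
    (fun ξ => ENNReal.ofReal ((1 / 2 * N) ^ (a - 1)) * ENNReal.ofReal (ξ ^ (-s))) ξ with hf₂
  set f₃ : ℝ → ENNReal := fun ξ => (Ioi (2 * N)).indicator
    (fun ξ => ENNReal.ofReal ((1 / 2) ^ (a - 1)) * ENNReal.ofReal (ξ ^ (a - 1 - s))) ξ with hf₃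
  have hf₁m : Measurable f₁ := by
    have : Measurable fun ξ : ℝ => |ξ - P| := by fun_prop
    exact (hFm.comp this).const_mul _
  have hf₂m : Measurable f₂ := Measurable.indicator (by fun_prop) measurableSet_Ioc
  have hpt : ∀ᵐ ξ ∂volume.restrict (Ioi (0 : ℝ)),
      ENNReal.ofReal (|ξ - P| ^ (a - 1) * (1 + ξ) ^ (-s)) ≤ f₁ ξ + f₂ ξ + f₃ ξ := by
    filter_upwards [ae_restrict_mem measurableSet_Ioi, ae_restrict_of_ae (Measure.ae_ne volume P)]
      with ξ hξ hξP
    have hξ0 : 0 < ξ := hξ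
    have hd : 0 < |ξ - P| := abs_pos.2 (sub_ne_zero.2 hξP)
    rcases le_or_gt |ξ - P| (1 / 2 * N) with h1 | h1
    · refine le_trans ?_ (le_add_right (le_add_right le_rfl))
      simp only [hf₁, hF]
      rw [indicator_of_mem (show |ξ - P| ∈ Ioc 0 (1 / 2 * N) from ⟨hd, h1⟩),
        ← ENNReal.ofReal_mul (by positivity)]
      refine ENNReal.ofReal_le_ofReal ?_
      have g1 : (1 + ξ) ^ (-s) ≤ (1 / 2 * N) ^ (-s) := by
        refine Real.rpow_le_rpow_of_nonpos (by positivity) ?_ (by linarith)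
        have := (abs_le.1 h1).1
        linarith
      rw [mul_comm]
      exact mul_le_mul_of_nonneg_right g1 (by positivity)
    · rcases le_or_gt ξ (2 * N) with h2 | h2
      · refine le_trans ?_ (le_add_right (le_add_left le_rfl))
        simp only [hf₂]
        rw [indicator_of_mem (show ξ ∈ Ioc 0 (2 * N) from ⟨hξ0, h2⟩),
          ← ENNReal.ofReal_mul (by positivity)]
        refine ENNReal.ofReal_le_ofReal ?_
        have g1 : |ξ - P| ^ (a - 1) ≤ (1 / 2 * N) ^ (a - 1) :=
          Real.rpow_le_rpow_of_nonpos (by positivity) h1.le (by linarith)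
        have g2 : (1 + ξ) ^ (-s) ≤ ξ ^ (-s) :=
          Real.rpow_le_rpow_of_nonpos hξ0 (by linarith) (by linarith)
        gcongr
      · refine le_trans ?_ (le_add_left le_rfl)
        simp only [hf₃]
        rw [indicator_of_mem (show ξ ∈ Ioi (2 * N) from h2), ← ENNReal.ofReal_mul (by positivity)]
        refine ENNReal.ofReal_le_ofReal ?_
        have g0 : 1 / 2 * ξ ≤ |ξ - P| := le_trans (by linarith) (le_abs_self _)
        have g1 : |ξ - P| ^ (a - 1) ≤ (1 / 2 * ξ) ^ (a - 1) :=
          Real.rpow_le_rpow_of_nonpos (by positivity) g0 (by linarith)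
        have g2 : (1 + ξ) ^ (-s) ≤ ξ ^ (-s) :=
          Real.rpow_le_rpow_of_nonpos hξ0 (by linarith) (by linarith)
        calc |ξ - P| ^ (a - 1) * (1 + ξ) ^ (-s) ≤ (1 / 2 * ξ) ^ (a - 1) * ξ ^ (-s) := by gcongr
          _ = (1 / 2) ^ (a - 1) * ξ ^ (a - 1 - s) := by
            rw [Real.mul_rpow (by norm_num) hξ0.le, mul_assoc, ← Real.rpow_add hξ0]
            ring_nf
  refine (lintegral_mono_ae hpt).trans ?_
  have hadd : ∫⁻ ξ in Ioi (0 : ℝ), (f₁ ξ + f₂ ξ + f₃ ξ) =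
      (∫⁻ ξ in Ioi (0 : ℝ), f₁ ξ) + (∫⁻ ξ in Ioi (0 : ℝ), f₂ ξ) + ∫⁻ ξ in Ioi (0 : ℝ), f₃ ξ := by
    rw [← lintegral_add_left hf₁m]
    exact lintegral_add_left (hf₁m.add hf₂m) f₃
  rw [hadd]
  have i₁ : ∫⁻ ξ in Ioi (0 : ℝ), f₁ ξ ≤
      ENNReal.ofReal (2 * (1 / 2) ^ (-s) * ((1 / 2) ^ a / a) * N ^ (a - s)) := by
    refine (setLIntegral_le_lintegral _ _).trans ?_
    simp only [hf₁]
    rw [lintegral_const_mul' _ _ ENNReal.ofReal_ne_top]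
    have := lintegral_sub_right_eq_self (μ := (volume : Measure ℝ)) (fun x => F |x|) P
    rw [this, lintegral_comp_abs_eq F hFm]
    simp only [hF]
    rw [setLIntegral_indicator measurableSet_Ioc, inter_eq_left.2 (fun x hx => hx.1),
      lintegral_Ioc_rpow (by linarith) (by positivity), ← ENNReal.ofReal_ofNat 2,
      ← ENNReal.ofReal_mul (by norm_num), ← ENNReal.ofReal_mul (by positivity)]
    refine ENNReal.ofReal_le_ofReal (le_of_eq ?_)
    rw [sub_add_cancel, Real.mul_rpow (by norm_num) hN0.le, Real.mul_rpow (by norm_num) hN0.le,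
      sub_eq_add_neg, Real.rpow_add hN0]
    ring
  have i₂ : ∫⁻ ξ in Ioi (0 : ℝ), f₂ ξ ≤
      ENNReal.ofReal ((1 / 2) ^ (a - 1) * (2 ^ (1 - s) / (1 - s)) * N ^ (a - s)) := by
    simp only [hf₂]
    rw [setLIntegral_indicator measurableSet_Ioc, inter_eq_left.2 (fun x hx => hx.1),
      lintegral_const_mul' _ _ ENNReal.ofReal_ne_top,
      lintegral_Ioc_rpow (by linarith) (by positivity), ← ENNReal.ofReal_mul (by positivity)]
    refine ENNReal.ofReal_le_ofReal (le_of_eq ?_)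
    have e : N ^ (a - s) = N ^ (a - 1) * N ^ (1 - s) := by
      rw [← Real.rpow_add hN0]; ring_nf
    have e' : -s + 1 = 1 - s := by ring
    rw [e', e, Real.mul_rpow (by norm_num) hN0.le, Real.mul_rpow (by norm_num) hN0.le]
    ring
  have i₃ : ∫⁻ ξ in Ioi (0 : ℝ), f₃ ξ ≤
      ENNReal.ofReal ((1 / 2) ^ (a - 1) * (2 ^ (a - s) / (s - a)) * N ^ (a - s)) := by
    refine (setLIntegral_le_lintegral _ _).trans ?_
    simp only [hf₃]
    rw [lintegral_indicator measurableSet_Ioi, lintegral_const_mul' _ _ ENNReal.ofReal_ne_top,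
      ← ofReal_integral_eq_lintegral_ofReal
        (integrableOn_Ioi_rpow_of_lt (by linarith) (by positivity)),
      integral_Ioi_rpow_of_lt (by linarith) (by positivity), ← ENNReal.ofReal_mul (by positivity)]
    · refine ENNReal.ofReal_le_ofReal (le_of_eq ?_)
      have e : a - 1 - s + 1 = -(s - a) := by ring
      have e' : -(s - a) = a - s := by ring
      rw [e, neg_div_neg_eq, e', Real.mul_rpow (by norm_num) hN0.le]
      ring
    · filter_upwards [ae_restrict_mem measurableSet_Ioi] with x hx
      have : 0 < x := lt_trans (by positivity) (mem_Ioi.1 hx)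
      exact Real.rpow_nonneg this.le _
  refine (add_le_add (add_le_add i₁ i₂) i₃).trans ?_
  have h1s : 0 < 1 - s := by linarith
  have hsa : 0 < s - a := by linarith
  rw [← ENNReal.ofReal_add (by positivity) (by positivity),
    ← ENNReal.ofReal_add (by positivity) (by positivity)]
  exact ENNReal.ofReal_le_ofReal (le_of_eq (by ring))

end weight

end SelfSim
end

/-! ### Weighted transforms of translated amplitudes and of their superpositions. -/

noncomputable section

namespace SelfSim

/-- The truncated Fourier integrals of `F` are bounded, uniformly in the truncation, by a function
whose integral against `(1 + ξ) ^ (-σ)` is at most `N`. -/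
structure HasWeightedTransform (α σ N : ℝ) (F : ℝ → ℂ) : Prop where
  intervalIntegrable : ∀ R : ℝ, 0 < R → IntervalIntegrable F volume (-R) R
  tail : ∃ M : ℝ, ∀ t : ℝ, 1 ≤ |t| → ‖F t‖ ≤ M * |t| ^ (α - 1)
  transform : ∃ q : ℝ → ENNReal, Measurable q ∧
    (∀ᵐ ξ : ℝ, ∀ R : ℝ, 0 < R → ‖∫ t in (-R)..R, F t * Complex.exp (t * Complex.I * ξ)‖ₑ ≤ q ξ) ∧
    ∫⁻ ξ in Ioi (0 : ℝ), q ξ * ENNReal.ofReal ((1 + ξ) ^ (-σ)) ≤ ENNReal.ofReal N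

section

variable {α σ N N₁ N₂ : ℝ} {F G : ℝ → ℂ}

lemma HasWeightedTransform.mono (hF : HasWeightedTransform α σ N₁ F) (h : N₁ ≤ N₂) :
    HasWeightedTransform α σ N₂ F := by
  obtain ⟨q, h1, h2, h3⟩ := hF.transform
  exact ⟨hF.intervalIntegrable, hF.tail, q, h1, h2, h3.trans (ENNReal.ofReal_le_ofReal h)⟩

lemma intervalIntegrable_mul_exp {x y : ℝ} (hF : IntervalIntegrable F volume x y) (ξ : ℝ) :
    IntervalIntegrable (fun t : ℝ => F t * Complex.exp (t * Complex.I * ξ)) volume x y :=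
  hF.mul_continuousOn (by fun_prop)

lemma HasWeightedTransform.add (hF : HasWeightedTransform α σ N₁ F)
    (hG : HasWeightedTransform α σ N₂ G) (h₁ : 0 ≤ N₁) (h₂ : 0 ≤ N₂) :
    HasWeightedTransform α σ (N₁ + N₂) (fun t => F t + G t) := by
  obtain ⟨q₁, a1, a2, a3⟩ := hF.transform
  obtain ⟨q₂, b1, b2, b3⟩ := hG.transform
  obtain ⟨M₁, hM₁⟩ := hF.tail
  obtain ⟨M₂, hM₂⟩ := hG.tail
  refine ⟨fun R hR => (hF.intervalIntegrable R hR).add (hG.intervalIntegrable R hR),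
    ⟨M₁ + M₂, fun t ht => ?_⟩, fun ξ => q₁ ξ + q₂ ξ, a1.add b1, ?_, ?_⟩
  · rw [add_mul]
    exact (norm_add_le _ _).trans (add_le_add (hM₁ t ht) (hM₂ t ht))
  · filter_upwards [a2, b2] with ξ h3 h4 R hR
    have e : ∫ t in (-R)..R, (F t + G t) * Complex.exp (t * Complex.I * ξ) =
        (∫ t in (-R)..R, F t * Complex.exp (t * Complex.I * ξ)) +
        ∫ t in (-R)..R, G t * Complex.exp (t * Complex.I * ξ) := by
      rw [← intervalIntegral.integral_add
        (intervalIntegrable_mul_exp (hF.intervalIntegrable R hR) ξ)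
        (intervalIntegrable_mul_exp (hG.intervalIntegrable R hR) ξ)]
      simp only [add_mul]
    rw [e]
    exact (enorm_add_le _ _).trans (add_le_add (h3 R hR) (h4 R hR))
  · rw [ENNReal.ofReal_add h₁ h₂]
    simp only [add_mul]
    rw [lintegral_add_left (by fun_prop)]
    exact add_le_add a3 b3

lemma HasWeightedTransform.const_mul (hF : HasWeightedTransform α σ N F) (c : ℂ) :
    HasWeightedTransform α σ (‖c‖ * N) (fun t => c * F t) := by
  obtain ⟨q, a1, a2, a3⟩ := hF.transform
  obtain ⟨M, hM⟩ := hF.tail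
  refine ⟨fun R hR => (hF.intervalIntegrable R hR).const_mul c,
    ⟨‖c‖ * M, fun t ht => ?_⟩, fun ξ => ‖c‖ₑ * q ξ, a1.const_mul _, ?_, ?_⟩
  · rw [norm_mul, mul_assoc]
    exact mul_le_mul_of_nonneg_left (hM t ht) (norm_nonneg _)
  · filter_upwards [a2] with ξ h3 R hR
    simp only [mul_assoc c]
    rw [intervalIntegral.integral_const_mul, enorm_mul]
    gcongr
    exact h3 R hR
  · simp only [mul_assoc]
    rw [lintegral_const_mul _ (by fun_prop), ENNReal.ofReal_mul (norm_nonneg _), ofReal_norm]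
    gcongr

lemma HasWeightedTransform.congr (hF : HasWeightedTransform α σ N F)
    (h : ∀ t : ℝ, t ≠ 0 → F t = G t) : HasWeightedTransform α σ N G := by
  have hae : F =ᵐ[volume] G := by
    filter_upwards [Measure.ae_ne volume (0 : ℝ)] with t ht using h t ht
  obtain ⟨q, a1, a2, a3⟩ := hF.transform
  obtain ⟨M, hM⟩ := hF.tail
  refine ⟨fun R hR => (hF.intervalIntegrable R hR).congr_ae (ae_restrict_of_ae hae),
    ⟨M, fun t ht => ?_⟩, q, a1, ?_, a3⟩
  · rw [← h t (abs_pos.1 (by linarith))]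
    exact hM t ht
  · filter_upwards [a2] with ξ h3 R hR
    rw [← intervalIntegral.integral_congr_ae (μ := volume)
      (f := fun t : ℝ => F t * Complex.exp (t * Complex.I * ξ))]
    · exact h3 R hR
    · filter_upwards [hae] with t ht _
      rw [ht]

end

section

variable {α σ τ a b : ℝ}

lemma exists_lintegral_two_weights_le (ha : 0 < a) (hb : 0 < b)
    (haσ : a < σ) (hbσ : b < σ) (hσ1 : σ < 1) (hτa : τ ≤ σ - a) (hτb : τ ≤ σ - b) :
    ∃ K : ℝ, 0 ≤ K ∧ ∀ P : ℝ, 0 ≤ P →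
      ∫⁻ ξ in Ioi (0 : ℝ), ENNReal.ofReal ((|ξ - P| ^ (a - 1) + |ξ - P| ^ (b - 1))) *
        ENNReal.ofReal ((1 + ξ) ^ (-σ)) ≤ ENNReal.ofReal (K * (1 + P) ^ (-τ)) := by
  obtain ⟨K₁, hK₁, h₁⟩ := exists_lintegral_weight_le ha haσ hσ1
  obtain ⟨K₂, hK₂, h₂⟩ := exists_lintegral_weight_le hb hbσ hσ1
  refine ⟨K₁ + K₂, by positivity, fun P hP => ?_⟩
  have e : ∀ ξ ∈ Ioi (0 : ℝ), ENNReal.ofReal ((|ξ - P| ^ (a - 1) + |ξ - P| ^ (b - 1))) *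
        ENNReal.ofReal ((1 + ξ) ^ (-σ)) = ENNReal.ofReal (|ξ - P| ^ (a - 1) * (1 + ξ) ^ (-σ)) +
        ENNReal.ofReal (|ξ - P| ^ (b - 1) * (1 + ξ) ^ (-σ)) := by
    intro ξ hξ
    have : (0 : ℝ) < 1 + ξ := by linarith [mem_Ioi.1 hξ]
    rw [← ENNReal.ofReal_mul (by positivity), ← ENNReal.ofReal_add (by positivity) (by positivity),
      add_mul]
  rw [setLIntegral_congr_fun measurableSet_Ioi e, lintegral_add_left (by fun_prop)]
  refine (add_le_add (h₁ P hP) (h₂ P hP)).trans ?_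
  rw [← ENNReal.ofReal_add (by positivity) (by positivity)]
  refine ENNReal.ofReal_le_ofReal ?_
  rw [add_mul]
  have : 1 ≤ 1 + P := by linarith
  gcongr <;> linarith

/-- The constant of `IsOscillatoryAmplitude.norm_integral_le`. -/
def oscillationConst (a b : ℝ) : ℝ := 2 * (1 / (1 - a) + 1 / (1 - b) + 2 + 1 / a + 1 / b)

lemma oscillationConst_nonneg (ha : 0 < a) (ha1 : a < 1) (hb : 0 < b) (hb1 : b < 1) :
    0 ≤ oscillationConst a b := by
  have : 0 < 1 - a := by linarith
  have : 0 < 1 - b := by linarith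
  unfold oscillationConst
  positivity

/-- Multiplication by e^{-iqt} translates the transform by q, and the weight converts the
translation into decay in q. -/
lemma exists_hasWeightedTransform_exp_mul (α : ℝ) (ha : 0 < a) (ha1 : a < 1) (hb : 0 < b)
    (hb1 : b < 1) (haσ : a < σ) (hbσ : b < σ) (hσ1 : σ < 1) (hτa : τ ≤ σ - a) (hτb : τ ≤ σ - b) :
    ∃ K : ℝ, 0 ≤ K ∧ ∀ (J J' : ℝ → ℂ) (M M' q : ℝ), IsOscillatoryAmplitude a b M J J' → 0 ≤ M →
      (∀ t : ℝ, 1 ≤ |t| → ‖J t‖ ≤ M' * |t| ^ (α - 1)) → 0 ≤ q →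
      HasWeightedTransform α σ (K * M * (1 + q) ^ (-τ))
        (fun t => Complex.exp (-(q * t * Complex.I)) * J t) := by
  obtain ⟨K, hK, hw⟩ := exists_lintegral_two_weights_le ha hb haσ hbσ hσ1 hτa hτb
  have hC := oscillationConst_nonneg ha ha1 hb hb1
  refine ⟨oscillationConst a b * K, by positivity, fun J J' M M' q hJ hM hM' hq => ?_⟩
  have hn : ∀ t : ℝ, ‖Complex.exp (-(q * t * Complex.I))‖ = 1 := fun t => by
    rw [Complex.norm_exp]; simp
  refine ⟨fun R _ => ?_, ⟨M', fun t ht => ?_⟩, fun ξ => ENNReal.ofReal (oscillationConst a b * M *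
    (|ξ - q| ^ (a - 1) + |ξ - q| ^ (b - 1))), by fun_prop, ?_, ?_⟩
  · exact (hJ.intervalIntegrable ha1 hb1 _ _).continuousOn_mul (by fun_prop)
  · rw [norm_mul, hn, one_mul]
    exact hM' t ht
  · filter_upwards [Measure.ae_ne volume q] with ξ hξ R hR
    have h := hJ.norm_integral_le ha ha1 hb hb1 hR (sub_ne_zero.2 hξ)
    rw [← ofReal_norm]
    refine ENNReal.ofReal_le_ofReal (le_trans (le_of_eq ?_) h)
    congr 1
    refine intervalIntegral.integral_congr fun t _ => ?_
    rw [mul_comm (Complex.exp _), mul_assoc, ← Complex.exp_add]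
    congr 2
    push_cast
    ring
  · have e : ∀ ξ : ℝ, ENNReal.ofReal (oscillationConst a b * M *
        (|ξ - q| ^ (a - 1) + |ξ - q| ^ (b - 1))) * ENNReal.ofReal ((1 + ξ) ^ (-σ)) =
        ENNReal.ofReal (oscillationConst a b * M) * (ENNReal.ofReal
        (|ξ - q| ^ (a - 1) + |ξ - q| ^ (b - 1)) * ENNReal.ofReal ((1 + ξ) ^ (-σ))) := fun ξ => by
      rw [ENNReal.ofReal_mul (by positivity), mul_assoc]
    simp only [e]
    rw [lintegral_const_mul' _ _ ENNReal.ofReal_ne_top]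
    refine (mul_le_mul_right (hw q hq) _).trans ?_
    rw [← ENNReal.ofReal_mul (by positivity)]
    exact ENNReal.ofReal_le_ofReal (le_of_eq (by ring))

lemma intervalIntegrable_beta {η : ℝ} (hη : 0 < η) :
    IntervalIntegrable (fun s : ℝ => s ^ (-3 / 4 : ℝ) * (1 - s) ^ (-(1 - η))) volume 0 1 := by
  have h1 : IntervalIntegrable (fun s : ℝ => s ^ (-3 / 4 : ℝ)) volume 0 1 :=
    intervalIntegral.intervalIntegrable_rpow' (by norm_num)
  have h2 : IntervalIntegrable (fun s : ℝ => (1 - s) ^ (-(1 - η))) volume 0 1 := by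
    have := (intervalIntegral.intervalIntegrable_rpow' (a := 1) (b := 0)
      (r := -(1 - η)) (by linarith)).comp_sub_left 1
    simpa using this
  refine ((h1.const_mul (2 + 2 ^ (1 - η))).add (h2.const_mul (2 + 2 ^ (1 - η)))).mono_fun' ?_ ?_
  · exact Measurable.aestronglyMeasurable (by fun_prop)
  · rw [uIoc_of_le zero_le_one]
    have hae : ∀ᵐ s : ℝ ∂volume.restrict (Ioc (0 : ℝ) 1), s ≠ 1 :=
      ae_restrict_of_ae (Measure.ae_ne volume 1)
    filter_upwards [ae_restrict_mem measurableSet_Ioc, hae] with s hs hs1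
    have hs0 : 0 < s := hs.1
    have hs' : 0 < 1 - s := sub_pos.2 (lt_of_le_of_ne hs.2 hs1)
    have p1 : 0 ≤ s ^ (-3 / 4 : ℝ) := by positivity
    have p2 : 0 ≤ (1 - s) ^ (-(1 - η)) := by positivity
    rw [Real.norm_of_nonneg (by positivity)]
    have hp : (0 : ℝ) ≤ 2 ^ (1 - η) := by positivity
    have half : ∀ x p : ℝ, 1 / 2 ≤ x → x ≤ 1 → x ^ (-p) ≤ 2 + 2 ^ p := by
      intro x p hx hx1
      have h2p : (0 : ℝ) ≤ 2 ^ p := by positivity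
      rcases le_total 0 p with h | h
      · have := Real.rpow_le_rpow_of_nonpos (by norm_num) hx (by linarith : -p ≤ 0)
        rw [one_div, Real.inv_rpow (zero_le_two (α := ℝ)), Real.rpow_neg (zero_le_two (α := ℝ)), inv_inv] at this
        linarith
      · have := Real.rpow_le_one (by linarith) hx1 (by linarith : 0 ≤ -p)
        linarith
    rcases le_total s (1 / 2) with h | h
    · have := half (1 - s) (1 - η) (by linarith) (by linarith)
      have g := mul_le_mul_of_nonneg_left this p1
      have : 0 ≤ (2 + 2 ^ (1 - η)) * (1 - s) ^ (-(1 - η)) := by positivity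
      linarith
    · have h3 : s ^ (-3 / 4 : ℝ) ≤ 2 := by
        have := Real.rpow_le_rpow_of_nonpos (by norm_num) h (by norm_num : (-3 / 4 : ℝ) ≤ 0)
        refine this.trans ?_
        have h4 := half_rpow_neg_le_two (α := 3 / 4) (by norm_num)
        rwa [← neg_div] at h4
      have g := mul_le_mul_of_nonneg_right (h3.trans (by linarith : (2 : ℝ) ≤ 2 + 2 ^ (1 - η))) p2
      have : 0 ≤ (2 + 2 ^ (1 - η)) * s ^ (-3 / 4 : ℝ) := by positivity
      linarith

/-- Superpositions of oscillating amplitudes. -/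
lemma exists_hasWeightedTransform_integral (α : ℝ) {η : ℝ} (ha : 0 < a) (ha1 : a < 1) (hb : 0 < b)
    (hb1 : b < 1) (haσ : a < σ) (hbσ : b < σ) (hσ1 : σ < 1) (hτa : τ ≤ σ - a) (hτb : τ ≤ σ - b)
    (hη : 0 < η) (hτ0 : 0 ≤ τ) (hτ : τ ≤ 1 / 2) :
    ∃ K : ℝ, 0 ≤ K ∧ ∀ (J J' : ℝ → ℝ → ℂ) (M M' q κ : ℝ), Measurable (Function.uncurry J) →
      (∀ s ∈ Ioo (0 : ℝ) 1, IsOscillatoryAmplitude a b (M * (1 - s) ^ (-(1 - η))) (J s) (J' s)) →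
      0 ≤ M → (∀ s ∈ Ioo (0 : ℝ) 1, ∀ t : ℝ, 1 ≤ |t| → ‖J s t‖ ≤ M' * |t| ^ (α - 1)) → 0 < q →
      -1 / 4 ≤ κ → κ ≤ 0 →
      HasWeightedTransform α σ (K * M * (1 + q) ^ (-τ)) (fun t => ∫ s in (0 : ℝ)..1,
        Complex.exp (-(q * s * t * Complex.I)) * (s ^ κ : ℝ) * J s t) := by
  obtain ⟨K, hK, hw⟩ := exists_lintegral_two_weights_le ha hb haσ hbσ hσ1 hτa hτb
  have hC := oscillationConst_nonneg ha ha1 hb hb1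
  set I₀ := ∫ s in (0 : ℝ)..1, s ^ (-3 / 4 : ℝ) * (1 - s) ^ (-(1 - η)) with hI₀
  have hI₀0 : 0 ≤ I₀ := by
    refine intervalIntegral.integral_nonneg zero_le_one fun s hs => ?_
    have := hs.1
    have : 0 ≤ 1 - s := by linarith [hs.2]
    positivity
  refine ⟨oscillationConst a b * K * I₀, by positivity,
    fun J J' M M' q κ hJm hJ hM hM' hq hκ hκ0 => ?_⟩
  have hn : ∀ s t : ℝ, ‖Complex.exp (-(q * s * t * Complex.I))‖ = 1 := fun s t => by
    rw [Complex.norm_exp]; simp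
  have hκs : ∀ s ∈ Ioo (0 : ℝ) 1, s ^ κ ≤ s ^ (-3 / 4 : ℝ) := fun s hs =>
    Real.rpow_le_rpow_of_exponent_ge hs.1 hs.2.le (by linarith)
  have hIoo : ∀ᵐ s : ℝ ∂volume.restrict (Ioc (0 : ℝ) 1), s ∈ Ioo (0 : ℝ) 1 := by
    filter_upwards [ae_restrict_mem measurableSet_Ioc,
      ae_restrict_of_ae (Measure.ae_ne volume 1)] with s hs hs1
    exact ⟨hs.1, lt_of_le_of_ne hs.2 hs1⟩
  have hβ : Integrable (fun s : ℝ => s ^ (-3 / 4 : ℝ) * (1 - s) ^ (-(1 - η)))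
      (volume.restrict (Ioc (0 : ℝ) 1)) :=
    (intervalIntegrable_iff_integrableOn_Ioc_of_le zero_le_one).1 (intervalIntegrable_beta hη)
  set g : ℝ → ℝ → ℂ := fun t s => Complex.exp (-(q * s * t * Complex.I)) * (s ^ κ : ℝ) * J s t
    with hg
  have hgm : Measurable (Function.uncurry g) := by
    refine Measurable.mul (Measurable.mul (by fun_prop) ?_) (hJm.comp measurable_swap)
    exact Complex.measurable_ofReal.comp (by fun_prop)
  have hgn : ∀ s ∈ Ioo (0 : ℝ) 1, ∀ t, ‖g t s‖ = s ^ κ * ‖J s t‖ := by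
    intro s hs t
    have : 0 ≤ s ^ κ := Real.rpow_nonneg hs.1.le _
    rw [hg]
    simp only
    rw [norm_mul, norm_mul, hn, one_mul, Complex.norm_real, Real.norm_of_nonneg this]
  have hgint : ∀ R : ℝ, 0 < R → Integrable (Function.uncurry g)
      ((volume.restrict (Ioc (-R) R)).prod (volume.restrict (Ioc (0 : ℝ) 1))) := by
    intro R hR
    have h1 : Integrable (fun t : ℝ => M * (|t| ^ (-a) + |t| ^ (-b)))
        (volume.restrict (Ioc (-R) R)) :=
      (intervalIntegrable_iff_integrableOn_Ioc_of_le (by linarith)).1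
        (((intervalIntegrable_abs_rpow ha1 _ _).add
          (intervalIntegrable_abs_rpow hb1 _ _)).const_mul M)
    refine (h1.mul_prod hβ).mono' hgm.aestronglyMeasurable ?_
    have h2 : ∀ᵐ t : ℝ ∂volume.restrict (Ioc (-R) R), t ≠ 0 :=
      ae_restrict_of_ae (Measure.ae_ne volume 0)
    filter_upwards [Measure.quasiMeasurePreserving_fst.ae h2,
      Measure.quasiMeasurePreserving_snd.ae hIoo] with z hz1 hz2
    change ‖g z.1 z.2‖ ≤ _
    rw [hgn z.2 hz2 z.1]
    have h3 := (hJ z.2 hz2).bound z.1 hz1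
    have h4 : 0 ≤ z.2 := hz2.1.le
    have h5 : 0 ≤ 1 - z.2 := by linarith [hz2.2]
    calc z.2 ^ κ * ‖J z.2 z.1‖ ≤ z.2 ^ (-3 / 4 : ℝ) *
          (M * (1 - z.2) ^ (-(1 - η)) * (|z.1| ^ (-a) + |z.1| ^ (-b))) := by
          exact mul_le_mul (hκs _ hz2) h3 (norm_nonneg _) (by positivity)
      _ = _ := by ring
  refine ⟨fun R hR => ?_, ⟨(∫ s in (0 : ℝ)..1, s ^ κ) * M', fun t ht => ?_⟩,
    fun ξ => ∫⁻ s in Ioc (0 : ℝ) 1, ENNReal.ofReal (s ^ κ * (oscillationConst a b *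
      (M * (1 - s) ^ (-(1 - η))) * (|ξ - q * s| ^ (a - 1) + |ξ - q * s| ^ (b - 1)))), ?_, ?_, ?_⟩
  · rw [intervalIntegrable_iff_integrableOn_Ioc_of_le (by linarith)]
    simp only [intervalIntegral.integral_of_le zero_le_one]
    exact (hgint R hR).integral_prod_left
  · rw [← intervalIntegral.integral_mul_const, mul_comm]
    have hi : IntervalIntegrable (fun s : ℝ => s ^ κ) volume 0 1 :=
      intervalIntegral.intervalIntegrable_rpow' (by linarith)
    have : ‖∫ s in (0 : ℝ)..1, g t s‖ ≤ ∫ s in (0 : ℝ)..1, s ^ κ * (M' * |t| ^ (α - 1)) := by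
      refine intervalIntegral.norm_integral_le_of_norm_le zero_le_one ?_ (hi.mul_const _)
      filter_upwards [Measure.ae_ne volume (1 : ℝ)] with s hs1 hs
      have hs' : s ∈ Ioo (0 : ℝ) 1 := ⟨hs.1, lt_of_le_of_ne hs.2 hs1⟩
      rw [hgn s hs' t]
      exact mul_le_mul_of_nonneg_left (hM' s hs' t ht) (Real.rpow_nonneg hs.1.le _)
    refine this.trans (le_of_eq ?_)
    rw [intervalIntegral.integral_mul_const, intervalIntegral.integral_mul_const]
    ring
  · refine Measurable.lintegral_prod_right' (f := fun z : ℝ × ℝ => ENNReal.ofReal (z.2 ^ κ *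
      (oscillationConst a b * (M * (1 - z.2) ^ (-(1 - η))) *
      (|z.1 - q * z.2| ^ (a - 1) + |z.1 - q * z.2| ^ (b - 1))))) ?_
    fun_prop
  · refine Eventually.of_forall fun ξ R hR => ?_
    have hexpi : ∀ t : ℝ, (∫ s in (0 : ℝ)..1, g t s) * Complex.exp (t * Complex.I * ξ) =
        ∫ s in Ioc (0 : ℝ) 1, g t s * Complex.exp (t * Complex.I * ξ) := fun t => by
      rw [intervalIntegral.integral_of_le zero_le_one, integral_mul_const]
    have hint2 : Integrable (Function.uncurry fun t s => g t s * Complex.exp (t * Complex.I * ξ))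
        ((volume.restrict (Ioc (-R) R)).prod (volume.restrict (Ioc (0 : ℝ) 1))) := by
      refine (hgint R hR).mono ?_ (Eventually.of_forall fun z => ?_)
      · refine (hgm.mul ?_).aestronglyMeasurable
        fun_prop
      · simp only [Function.uncurry]
        rw [norm_mul, norm_exp_mul_I_real, mul_one]
    -- After Fubini the oscillatory bound applies for each s to the frequency ξ - qs, uniformly in
    -- R; the exceptional s = ξ/q is a null set.
    have hswap : ∫ t in (-R)..R, (∫ s in (0 : ℝ)..1, g t s) * Complex.exp (t * Complex.I * ξ) =
        ∫ s in Ioc (0 : ℝ) 1, ∫ t in (-R)..R, g t s * Complex.exp (t * Complex.I * ξ) := by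
      simp only [hexpi]
      rw [intervalIntegral.integral_of_le (by linarith), integral_integral_swap hint2]
      simp only [intervalIntegral.integral_of_le (by linarith : -R ≤ R)]
    rw [hswap]
    refine (enorm_integral_le_lintegral_enorm _).trans (lintegral_mono_ae ?_)
    have hne : ∀ᵐ s : ℝ ∂volume.restrict (Ioc (0 : ℝ) 1), s ≠ ξ / q :=
      ae_restrict_of_ae (Measure.ae_ne volume _)
    filter_upwards [hIoo, hne] with s hs hsne
    have hu : ξ - q * s ≠ 0 := by
      intro h
      apply hsne
      field_simp
      linarith
    have h := (hJ s hs).norm_integral_le ha ha1 hb hb1 hR hu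
    have e : ∫ t in (-R)..R, g t s * Complex.exp (t * Complex.I * ξ) =
        (s ^ κ : ℝ) * ∫ t in (-R)..R, J s t * Complex.exp (t * Complex.I * (ξ - q * s : ℝ)) := by
      rw [← intervalIntegral.integral_const_mul]
      refine intervalIntegral.integral_congr fun t _ => ?_
      simp only [hg]
      have : Complex.exp (t * Complex.I * (ξ - q * s : ℝ)) =
          Complex.exp (-(q * s * t * Complex.I)) * Complex.exp (t * Complex.I * ξ) := by
        rw [← Complex.exp_add]
        congr 1
        push_cast
        ring
      rw [this]
      ring
    rw [e, ← ofReal_norm, norm_mul, Complex.norm_real,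
      Real.norm_of_nonneg (Real.rpow_nonneg hs.1.le _)]
    refine ENNReal.ofReal_le_ofReal ?_
    have := Real.rpow_nonneg hs.1.le κ
    gcongr
    exact h
  · have hm : Measurable (Function.uncurry fun (ξ s : ℝ) => ENNReal.ofReal (s ^ κ *
        (oscillationConst a b * (M * (1 - s) ^ (-(1 - η))) * (|ξ - q * s| ^ (a - 1) +
        |ξ - q * s| ^ (b - 1)))) * ENNReal.ofReal ((1 + ξ) ^ (-σ))) := by
      unfold Function.uncurry
      fun_prop
    have h1 : ∀ ξ : ℝ, (∫⁻ s in Ioc (0 : ℝ) 1, ENNReal.ofReal (s ^ κ * (oscillationConst a b *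
        (M * (1 - s) ^ (-(1 - η))) * (|ξ - q * s| ^ (a - 1) + |ξ - q * s| ^ (b - 1))))) *
        ENNReal.ofReal ((1 + ξ) ^ (-σ)) = ∫⁻ s in Ioc (0 : ℝ) 1, ENNReal.ofReal (s ^ κ *
        (oscillationConst a b * (M * (1 - s) ^ (-(1 - η))) * (|ξ - q * s| ^ (a - 1) +
        |ξ - q * s| ^ (b - 1)))) * ENNReal.ofReal ((1 + ξ) ^ (-σ)) := fun ξ => by
      rw [lintegral_mul_const' _ _ ENNReal.ofReal_ne_top]
    simp only [h1]
    rw [lintegral_lintegral_swap hm.aemeasurable]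
    have h2 : ∀ᵐ s : ℝ ∂volume.restrict (Ioc (0 : ℝ) 1), ∫⁻ ξ in Ioi (0 : ℝ), ENNReal.ofReal
        (s ^ κ * (oscillationConst a b * (M * (1 - s) ^ (-(1 - η))) * (|ξ - q * s| ^ (a - 1) +
        |ξ - q * s| ^ (b - 1)))) * ENNReal.ofReal ((1 + ξ) ^ (-σ)) ≤
        ENNReal.ofReal (oscillationConst a b * K * M * (1 + q) ^ (-τ) *
          (s ^ (-3 / 4 : ℝ) * (1 - s) ^ (-(1 - η)))) := by
      filter_upwards [hIoo] with s hs
      have hs0 := hs.1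
      have hs' : 0 < 1 - s := by linarith [hs.2]
      have e : ∀ ξ : ℝ, ENNReal.ofReal
        (s ^ κ * (oscillationConst a b * (M * (1 - s) ^ (-(1 - η))) * (|ξ - q * s| ^ (a - 1) +
        |ξ - q * s| ^ (b - 1)))) * ENNReal.ofReal ((1 + ξ) ^ (-σ)) =
        ENNReal.ofReal (s ^ κ * (oscillationConst a b * (M * (1 - s) ^ (-(1 - η))))) *
        (ENNReal.ofReal (|ξ - q * s| ^ (a - 1) + |ξ - q * s| ^ (b - 1)) *
          ENNReal.ofReal ((1 + ξ) ^ (-σ))) := fun ξ => by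
        rw [← mul_assoc (s ^ κ), ENNReal.ofReal_mul (by positivity), mul_assoc]
      simp only [e]
      rw [lintegral_const_mul' _ _ ENNReal.ofReal_ne_top]
      refine (mul_le_mul_right (hw (q * s) (by positivity)) _).trans ?_
      rw [← ENNReal.ofReal_mul (by positivity)]
      refine ENNReal.ofReal_le_ofReal ?_
      -- Since s ≤ 1, 1 + qs ≥ s(1 + q). The loss s^{-τ} joins s^κ, and κ ≥ -1/4, τ ≤ 1/2 give the
      -- integrable power s^{-3/4}.
      have h3 : (1 + q * s) ^ (-τ) ≤ s ^ (-τ) * (1 + q) ^ (-τ) := by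
        rw [← Real.mul_rpow hs0.le (by positivity)]
        refine Real.rpow_le_rpow_of_nonpos (by positivity) ?_ (by linarith)
        linarith [hs.2]
      have h4 : s ^ κ * s ^ (-τ) ≤ s ^ (-3 / 4 : ℝ) := by
        rw [← Real.rpow_add hs0]
        exact Real.rpow_le_rpow_of_exponent_ge hs0 hs.2.le (by linarith)
      calc s ^ κ * (oscillationConst a b * (M * (1 - s) ^ (-(1 - η)))) *
            (K * (1 + q * s) ^ (-τ))
          ≤ s ^ κ * (oscillationConst a b * (M * (1 - s) ^ (-(1 - η)))) *
            (K * (s ^ (-τ) * (1 + q) ^ (-τ))) := by gcongr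
        _ = oscillationConst a b * K * M * (1 + q) ^ (-τ) *
            ((s ^ κ * s ^ (-τ)) * (1 - s) ^ (-(1 - η))) := by ring
        _ ≤ _ := by gcongr
    refine (lintegral_mono_ae h2).trans ?_
    rw [← ofReal_integral_eq_lintegral_ofReal (hβ.const_mul _), integral_const_mul,
      ← intervalIntegral.integral_of_le zero_le_one]
    · exact ENNReal.ofReal_le_ofReal (le_of_eq (by rw [← hI₀]; ring))
    · filter_upwards [hIoo] with s hs
      have hs0 := hs.1
      have hs' : 0 < 1 - s := by linarith [hs.2]
      simp only [Pi.zero_apply]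
      positivity

end

end SelfSim
end

/-! ### Kernel transforms and integration by parts in s. -/

noncomputable section

namespace SelfSim

/-- `(1 + it)⁻¹ ∫_0^1 e^{-qsit} s^κ B(st) e^{φ(t) - φ(st)} ds`. -/
def kernelTransform (κ : ℝ) (φ B : ℝ → ℂ) (q t : ℝ) : ℂ :=
  ∫ s in (0 : ℝ)..1, Complex.exp (-(q * s * t * Complex.I)) * (s ^ κ : ℝ) * kernelFun φ B s t

section

variable {ε α γ δ c D DB DG Dβ κ q : ℝ} {k l : ℕ} {φ β β' B B' B'' G G' : ℝ → ℂ}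

lemma IsPhase.measurable (hφ : IsPhase ε α c D φ β) : Measurable φ :=
  measurable_of_continuousOn_compl_singleton 0 fun t ht =>
    (hφ.hasDeriv t ht).continuousAt.continuousWithinAt

lemma IsSymbol.measurable (hB : IsSymbol ε α k γ DB B B') : Measurable B :=
  measurable_of_hasDerivAt hB.hasDeriv

lemma measurable_kernelFun (hφ : Measurable φ) (hB : Measurable B) :
    Measurable (Function.uncurry (kernelFun φ B)) := by
  unfold kernelFun
  have h1 : Measurable fun z : ℝ × ℝ => B (z.1 * z.2) := hB.comp (by fun_prop)
  have h2 : Measurable fun z : ℝ × ℝ => φ z.2 := hφ.comp (by fun_prop)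
  have h3 : Measurable fun z : ℝ × ℝ => φ (z.1 * z.2) := hφ.comp (by fun_prop)
  exact (h1.mul (h2.sub h3).cexp).mul (by fun_prop)

/-- A bound for fixed t only: it makes the s-integrals converge and lets the boundary term at s = 0
vanish. -/
lemma exists_norm_kernelFun_le (hε : 0 < ε) (hα : 0 < α) (hc : 0 < c)
    (hφ : IsPhase ε α c D φ β) (hDB : 0 ≤ DB) (hB : IsSymbol ε α k γ DB B B') {t : ℝ} (ht : t ≠ 0) :
    ∃ N : ℝ, ∀ s ∈ Ioo (0 : ℝ) 1, ‖kernelFun φ B s t‖ ≤ N := by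
  obtain ⟨M, hM0, hM⟩ := pow_mul_exp_neg_le k (half_pos hc)
  have ht0 : 0 < |t| := abs_pos.2 ht
  set A₁ := ε * (1 / 2 * |t|) ^ (-α) with hA₁
  have hA₁0 : 0 ≤ A₁ := by positivity
  set N := DB * (M + A₁ ^ k + (1 + |t| ^ γ)) * Real.exp D with hN
  refine ⟨N, fun s hs => ?_⟩
  have hs0 := hs.1
  have hs1 := hs.2
  have hst : |s * t| = s * |t| := by rw [abs_mul, abs_of_pos hs0]
  have hst0 : s * t ≠ 0 := mul_ne_zero hs0.ne' ht
  have b3 := hφ.norm_exp_le hs ht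
  have hinv : ‖(1 + t * Complex.I)⁻¹‖ ≤ 1 := by
    rw [norm_inv]; exact inv_le_one_of_one_le₀ (one_le_norm_one_add_mul_I t)
  set A := ε * (s * |t|) ^ (-α) with hA
  have hA0 : 0 ≤ A := by positivity
  have hs' : 0 < 1 - s := by linarith
  have hT : 0 ≤ |t| ^ γ := by positivity
  have key : ‖B (s * t)‖ * Real.exp (-(c * ((1 - s) * A))) ≤ DB * (M + A₁ ^ k + (1 + |t| ^ γ)) := by
    have hA₁k : 0 ≤ A₁ ^ k := by positivity
    have hexp : Real.exp (-(c * ((1 - s) * A))) ≤ 1 := by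
      rw [Real.exp_le_one_iff, neg_nonpos]; positivity
    rcases le_total |s * t| 1 with h | h
    · have b1 := hB.small _ hst0 h
      rw [hst] at b1
      have : A ^ k * Real.exp (-(c * ((1 - s) * A))) ≤ M + A₁ ^ k := by
        rcases le_total s (1 / 2) with h2 | h2
        · refine le_trans ?_ ((hM A hA0).trans (by linarith))
          refine mul_le_mul_of_nonneg_left (Real.exp_le_exp.2 ?_) (by positivity)
          have : 1 / 2 * A ≤ (1 - s) * A := by gcongr; linarith
          have := mul_le_mul_of_nonneg_left this hc.le
          linarith
        · have h3 : A ≤ A₁ := by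
            rw [hA, hA₁]
            exact mul_le_mul_of_nonneg_left (Real.rpow_le_rpow_of_nonpos (by positivity)
              (by gcongr) (by linarith)) hε.le
          calc A ^ k * Real.exp (-(c * ((1 - s) * A))) ≤ A₁ ^ k * 1 := by gcongr
            _ ≤ M + A₁ ^ k := by linarith
      calc ‖B (s * t)‖ * Real.exp (-(c * ((1 - s) * A)))
          ≤ DB * A ^ k * Real.exp (-(c * ((1 - s) * A))) := by gcongr
        _ = DB * (A ^ k * Real.exp (-(c * ((1 - s) * A)))) := by ring
        _ ≤ DB * (M + A₁ ^ k + (1 + |t| ^ γ)) := by gcongr; linarith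
    · have b1 := hB.large _ h
      have h4 : |s * t| ^ γ ≤ 1 + |t| ^ γ := by
        rcases le_total 0 γ with h5 | h5
        · have : |s * t| ^ γ ≤ |t| ^ γ := by
            rw [hst]
            exact Real.rpow_le_rpow (by positivity) (mul_le_of_le_one_left ht0.le hs1.le) h5
          linarith
        · have := Real.rpow_le_one_of_one_le_of_nonpos h h5
          linarith
      calc ‖B (s * t)‖ * Real.exp (-(c * ((1 - s) * A))) ≤ DB * |s * t| ^ γ * 1 := by gcongr
        _ ≤ DB * (M + A₁ ^ k + (1 + |t| ^ γ)) := by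
          rw [mul_one]; gcongr; linarith
  rw [kernelFun, norm_mul, norm_mul]
  calc ‖B (s * t)‖ * ‖Complex.exp (φ t - φ (s * t))‖ * ‖(1 + t * Complex.I)⁻¹‖
      ≤ ‖B (s * t)‖ * (Real.exp D * Real.exp (-(c * ((1 - s) * A)))) * 1 := by gcongr
    _ = ‖B (s * t)‖ * Real.exp (-(c * ((1 - s) * A))) * Real.exp D := by ring
    _ ≤ N := by rw [hN]; gcongr

lemma norm_exp_neg_mul_I (q s t : ℝ) : ‖Complex.exp (-(q * s * t * Complex.I))‖ = 1 := by
  rw [Complex.norm_exp]; simp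

lemma intervalIntegrable_kernel (hκ : -1 < κ) (hφ : Measurable φ) (hB : Measurable B) {t N : ℝ}
    (hN : ∀ s ∈ Ioo (0 : ℝ) 1, ‖kernelFun φ B s t‖ ≤ N) :
    IntervalIntegrable (fun s : ℝ => Complex.exp (-(q * s * t * Complex.I)) * (s ^ κ : ℝ) *
      kernelFun φ B s t) volume 0 1 := by
  have hi : IntervalIntegrable (fun s : ℝ => s ^ κ * N) volume 0 1 :=
    (intervalIntegral.intervalIntegrable_rpow' hκ).mul_const N
  refine hi.mono_fun' ?_ ?_
  · refine Measurable.aestronglyMeasurable ?_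
    refine Measurable.mul (Measurable.mul (by fun_prop) ?_)
      ((measurable_kernelFun hφ hB).comp measurable_prodMk_right)
    exact Complex.measurable_ofReal.comp (by fun_prop)
  · rw [uIoc_of_le zero_le_one]
    filter_upwards [ae_restrict_mem measurableSet_Ioc,
      ae_restrict_of_ae (Measure.ae_ne volume 1)] with s hs hs1
    have hp : 0 ≤ s ^ κ := Real.rpow_nonneg hs.1.le _
    rw [norm_mul, norm_mul, norm_exp_neg_mul_I, one_mul, Complex.norm_real,
      Real.norm_of_nonneg hp]
    exact mul_le_mul_of_nonneg_left (hN s ⟨hs.1, lt_of_le_of_ne hs.2 hs1⟩) hp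

lemma kernelFun_add (s t : ℝ) : kernelFun φ (fun t => B t + G t) s t =
    kernelFun φ B s t + kernelFun φ G s t := by
  simp only [kernelFun]; ring

lemma kernelTransform_congr (h : ∀ t, t ≠ 0 → B t = G t) {t : ℝ} (ht : t ≠ 0) :
    kernelTransform κ φ B q t = kernelTransform κ φ G q t := by
  refine intervalIntegral.integral_congr_ae (Eventually.of_forall fun s hs => ?_)
  rw [uIoc_of_le zero_le_one] at hs
  rw [kernelFun, kernelFun, h _ (mul_ne_zero hs.1.ne' ht)]

lemma kernelTransform_zero (t : ℝ) : kernelTransform κ φ (fun _ => 0) q t = 0 := by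
  simp [kernelTransform, kernelFun]

lemma kernelTransform_add {t : ℝ}
    (h1 : IntervalIntegrable (fun s : ℝ => Complex.exp (-(q * s * t * Complex.I)) * (s ^ κ : ℝ) *
      kernelFun φ B s t) volume 0 1)
    (h2 : IntervalIntegrable (fun s : ℝ => Complex.exp (-(q * s * t * Complex.I)) * (s ^ κ : ℝ) *
      kernelFun φ G s t) volume 0 1) :
    kernelTransform κ φ (fun t => B t + G t) q t =
      kernelTransform κ φ B q t + kernelTransform κ φ G q t := by
  rw [kernelTransform, kernelTransform, kernelTransform, ← intervalIntegral.integral_add h1 h2]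
  refine intervalIntegral.integral_congr fun s _ => ?_
  simp only [kernelFun_add]
  ring

/-- Integration by parts. -/
lemma kernelTransform_mul_I (hε : 0 < ε) (hα : 0 < α) (hc : 0 < c)
    (hφ : IsPhase ε α c D φ β) (hβ : IsSymbol ε α 1 α Dβ β β') (hDβ : 0 ≤ Dβ) (hDB : 0 ≤ DB)
    (hB : IsSymbol ε α k γ DB B B') (hB' : IsSymbol ε α l δ DG B' B'') (hDG : 0 ≤ DG)
    (hκ : -1 < κ) {t : ℝ} (ht : t ≠ 0) :
    q * kernelTransform κ φ (fun t => t * Complex.I * B t) q t =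
      -(Complex.exp (-(q * t * Complex.I)) * (B t * (1 + t * Complex.I)⁻¹)) +
      (1 + κ) * kernelTransform κ φ B q t + kernelTransform κ φ B' q t +
      kernelTransform κ φ (fun t => β t * B t) (q + 1) t := by
  have hφm := hφ.measurable
  obtain ⟨N₁, hN₁⟩ := exists_norm_kernelFun_le hε hα hc hφ hDB hB ht
  obtain ⟨N₂, hN₂⟩ := exists_norm_kernelFun_le hε hα hc hφ hDG hB' ht
  have hxB := (isSymbol_mul_I (ε := ε) (α := α)).mul hB hε zero_le_one
  have hβB := hβ.mul hB hε hDβ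
  obtain ⟨N₃, hN₃⟩ := exists_norm_kernelFun_le hε hα hc hφ (by positivity) hxB ht
  obtain ⟨N₄, hN₄⟩ := exists_norm_kernelFun_le hε hα hc hφ (by positivity) hβB ht
  have i₁ := intervalIntegrable_kernel (q := q) hκ hφm hB.measurable hN₁
  have i₂ := intervalIntegrable_kernel (q := q) hκ hφm hB'.measurable hN₂
  have i₃ := intervalIntegrable_kernel (q := q) hκ hφm hxB.measurable hN₃
  have i₄ := intervalIntegrable_kernel (q := q + 1) hκ hφm hβB.measurable hN₄
  -- The factor s from x = ist raises the power to s^{1+κ}; its derivative produces the coefficient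
  -- 1 + κ, and 1 + κ > 0 makes f vanish at s = 0.
  set f : ℝ → ℂ := fun s => Complex.exp (-(q * s * t * Complex.I)) * (s ^ (1 + κ) : ℝ) *
    kernelFun φ B s t with hf
  have htc : (t : ℂ) ≠ 0 := Complex.ofReal_ne_zero.2 ht
  have hderiv : ∀ s : ℝ, 0 < s → HasDerivAt f
      (-q * (Complex.exp (-(q * s * t * Complex.I)) * (s ^ κ : ℝ) *
        kernelFun φ (fun t => t * Complex.I * B t) s t) +
      (1 + κ) * (Complex.exp (-(q * s * t * Complex.I)) * (s ^ κ : ℝ) * kernelFun φ B s t) +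
      Complex.exp (-(q * s * t * Complex.I)) * (s ^ κ : ℝ) * kernelFun φ B' s t +
      Complex.exp (-((q + 1 : ℝ) * s * t * Complex.I)) * (s ^ κ : ℝ) *
        kernelFun φ (fun t => β t * B t) s t) s := by
    intro s hs
    have hsc : (s : ℂ) ≠ 0 := Complex.ofReal_ne_zero.2 hs.ne'
    have hst : s * t ≠ 0 := mul_ne_zero hs.ne' ht
    have d0 : HasDerivAt (fun s : ℝ => s * t) t s := by
      simpa using (hasDerivAt_id s).mul_const t
    have d1 : HasDerivAt (fun s : ℝ => Complex.exp (-(q * s * t * Complex.I)))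
        (Complex.exp (-(q * s * t * Complex.I)) * -(q * t * Complex.I)) s := by
      have : HasDerivAt (fun s : ℝ => -((q : ℂ) * s * t * Complex.I)) (-(q * t * Complex.I)) s := by
        have h := ((((hasDerivAt_id s).ofReal_comp.const_mul (q : ℂ)).mul_const (t : ℂ)).mul_const
          Complex.I).fun_neg
        simpa using h
      exact this.cexp
    have d2 : HasDerivAt (fun s : ℝ => ((s ^ (1 + κ) : ℝ) : ℂ)) (((1 + κ) * s ^ κ : ℝ) : ℂ) s := by
      have h := (Real.hasDerivAt_rpow_const (x := s) (p := 1 + κ) (Or.inl hs.ne')).ofReal_comp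
      rwa [add_sub_cancel_left] at h
    have d3 := (hB.hasDeriv (s * t) hst).scomp s d0
    have d4 := ((((hφ.hasDeriv (s * t) hst).scomp s d0).const_sub (φ t)).cexp)
    have d5 := (d1.mul d2).mul ((d3.mul d4).mul_const (1 + t * Complex.I)⁻¹)
    refine d5.congr_deriv ?_
    have e1 : ((s ^ (1 + κ) : ℝ) : ℂ) = s * (s ^ κ : ℝ) := by
      rw [Real.rpow_add hs, Real.rpow_one, Complex.ofReal_mul]
    -- The derivative of the phase carries e^{-ist}, which raises the frequency from q to q + 1.
    have e2 : Complex.exp (-((q + 1 : ℝ) * s * t * Complex.I)) =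
        Complex.exp (-(q * s * t * Complex.I)) * Complex.exp (-((s * t : ℝ) * Complex.I)) := by
      rw [← Complex.exp_add]
      congr 1
      push_cast
      ring
    simp only [kernelFun, Pi.mul_apply, Function.comp_apply, Complex.real_smul]
    rw [e1, e2]
    push_cast
    field_simp
    ring
  have hlim0 : Tendsto f (𝓝[>] 0) (𝓝 0) := by
    have h1 : Tendsto (fun s : ℝ => s ^ (1 + κ) * N₁) (𝓝[>] 0) (𝓝 0) := by
      have h2 : ContinuousAt (fun s : ℝ => s ^ (1 + κ) * N₁) 0 :=
        (Real.continuousAt_rpow_const 0 _ (Or.inr (by linarith))).mul continuousAt_const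
      have h3 := h2.tendsto.mono_left (nhdsWithin_le_nhds (s := Ioi (0 : ℝ)))
      simpa [Real.zero_rpow (by linarith : 1 + κ ≠ 0)] using h3
    refine squeeze_zero_norm' ?_ h1
    filter_upwards [Ioo_mem_nhdsGT (zero_lt_one' ℝ)] with s hs
    have hp : 0 ≤ s ^ (1 + κ) := Real.rpow_nonneg hs.1.le _
    rw [hf]
    simp only
    rw [norm_mul, norm_mul, norm_exp_neg_mul_I, one_mul, Complex.norm_real,
      Real.norm_of_nonneg hp]
    exact mul_le_mul_of_nonneg_left (hN₁ s hs) hp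
  have hlim1 : Tendsto f (𝓝[<] 1) (𝓝 (f 1)) :=
    (hderiv 1 one_pos).continuousAt.tendsto.mono_left nhdsWithin_le_nhds
  have hmain := intervalIntegral.integral_eq_sub_of_hasDerivAt_of_tendsto zero_lt_one
    (fun s hs => hderiv s hs.1)
    ((((i₃.const_mul (-(q : ℂ))).add (i₁.const_mul (1 + κ : ℂ))).add i₂).add i₄) hlim0 hlim1
  rw [intervalIntegral.integral_add (((i₃.const_mul _).add (i₁.const_mul _)).add i₂) i₄,
    intervalIntegral.integral_add ((i₃.const_mul _).add (i₁.const_mul _)) i₂,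
    intervalIntegral.integral_add (i₃.const_mul _) (i₁.const_mul _),
    intervalIntegral.integral_const_mul, intervalIntegral.integral_const_mul] at hmain
  have hf1 : f 1 = Complex.exp (-(q * t * Complex.I)) * (B t * (1 + t * Complex.I)⁻¹) := by
    simp [hf, kernelFun]
  rw [hf1, sub_zero] at hmain
  simp only [kernelTransform]
  linear_combination -hmain

end

end SelfSim
end

/-! ### Expansion of `H0` on the imaginary axis. -/

noncomputable section

namespace SelfSim

section decomposition

variable {ε α C c κ p : ℝ} {b : ℂ → ℂ}

lemma Phi_eq_phase (ε : ℝ) (w : ℂ → ℂ) (μ : ℝ → ℝ) :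
    Phi ε w μ = phase (fun x => ε * betaW w μ x) := by
  ext x
  rw [Phi, phase, ← integral_const_mul]
  congr 1
  ext s
  ring

/-- The boundary function of `H₀` in terms of kernel transforms. -/
lemma H0_mul_I_eq {w : ℂ → ℂ} {μ : ℝ → ℝ} (hb : IsRate α C c ε (fun x => ε * betaW w μ x))
    (hα : 0 < α) (hα1 : α ≤ 1) (hC : 0 ≤ C) (hε : 0 < ε) (hp : 0 < p) {t : ℝ} (ht : t ≠ 0) :
    H0 ε w μ p (t * Complex.I) =
      (2 + kappa μ) / p * kernelTransform (kappa μ)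
        (fun t => phase (fun x => ε * betaW w μ x) (t * Complex.I))
        (fun t => t * Complex.I * 1) p t +
      1 / p * kernelTransform (kappa μ)
        (fun t => phase (fun x => ε * betaW w μ x) (t * Complex.I))
        (fun t => t * Complex.I * (ε * betaW w μ (t * Complex.I))) (p + 1) t := by
  rw [H0, H01, H02, segmentIntegral, segmentIntegral, Phi_eq_phase, kernelTransform,
    kernelTransform]
  set κ := kappa μ with hκ
  set b : ℂ → ℂ := fun x => ε * betaW w μ x with hbdef
  have htc : (t : ℂ) ≠ 0 := Complex.ofReal_ne_zero.2 ht
  have hpc : (p : ℂ) ≠ 0 := Complex.ofReal_ne_zero.2 hp.ne'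
  have h1 := one_add_mul_I_ne_zero t
  have hI := Complex.I_ne_zero
  have hs1 : ∀ s : ℝ, (s : ℂ) * (t * Complex.I) = ((s * t : ℝ) : ℂ) * Complex.I := fun s => by
    push_cast; ring
  have hpow : ∀ s : ℝ, 0 < s → ((s : ℂ) * (t * Complex.I) / (t * Complex.I)) ^ (κ : ℂ) =
      ((s ^ κ : ℝ) : ℂ) := fun s hs => by
    rw [mul_div_assoc, div_self (mul_ne_zero htc hI), mul_one, Complex.ofReal_cpow hs.le]
  congr 1
  · rw [← intervalIntegral.integral_const_mul, ← intervalIntegral.integral_const_mul]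
    refine intervalIntegral.integral_congr_ae (Eventually.of_forall fun s hs => ?_)
    rw [uIoc_of_le zero_le_one] at hs
    rw [hpow s hs.1, hs1 s, kernelFun, ← Complex.exp_sub]
    have e : (-(p : ℂ) * (((s * t : ℝ) : ℂ) * Complex.I)) = -(p * s * t * Complex.I) := by
      push_cast; ring
    rw [e]
    push_cast
    field_simp
  · rw [← intervalIntegral.integral_const_mul, ← intervalIntegral.integral_const_mul]
    refine intervalIntegral.integral_congr_ae (Eventually.of_forall fun s hs => ?_)
    rw [uIoc_of_le zero_le_one] at hs
    have hst : s * t ≠ 0 := mul_ne_zero hs.1.ne' ht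
    have hsc : (s : ℂ) ≠ 0 := Complex.ofReal_ne_zero.2 hs.1.ne'
    rw [hpow s hs.1, hs1 s, kernelFun, ← Complex.exp_sub,
      (hb.hasDerivAt_phase hα hα1 hC hε hst).deriv]
    -- Here x²Φ'(x) = -x b(x) e^{-x}: the sign cancels that of `H02`, and the exponential turns p
    -- into p + 1.
    have e : Complex.exp (-((p + 1 : ℝ) * s * t * Complex.I)) =
        Complex.exp (-(p : ℂ) * (((s * t : ℝ) : ℂ) * Complex.I)) *
          Complex.exp (-(((s * t : ℝ) : ℂ) * Complex.I)) := by
      rw [← Complex.exp_add]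
      congr 1
      push_cast
      ring
    rw [e]
    simp only [hbdef]
    push_cast
    field_simp

end decomposition

section terms

variable {α σ τ a b c D DB Dβ η : ℝ}

lemma IsSymbol.isOscillatoryAmplitude {ε : ℝ} {k : ℕ} {J J' : ℝ → ℂ}
    (hJ : IsSymbol ε α k (α - 1) DB J J') (hε : 0 < ε) (hε1 : ε ≤ 1) (hD : 0 ≤ DB)
    (hak : α * k ≤ a) (hb : b ≤ 1 - α) : IsOscillatoryAmplitude a b DB J J' := by
  have key : ∀ {x : ℂ} {t : ℝ}, t ≠ 0 → (|t| ≤ 1 → ‖x‖ ≤ DB * (ε * |t| ^ (-α)) ^ k) →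
      (1 ≤ |t| → ‖x‖ ≤ DB * |t| ^ (α - 1)) → ‖x‖ ≤ DB * (|t| ^ (-a) + |t| ^ (-b)) := by
    intro x t ht h1 h2
    have ht0 : 0 < |t| := abs_pos.2 ht
    have p1 : 0 ≤ |t| ^ (-a) := by positivity
    have p2 : 0 ≤ |t| ^ (-b) := by positivity
    rcases le_total |t| 1 with h | h
    · refine (h1 h).trans (mul_le_mul_of_nonneg_left ?_ hD)
      have h3 : (ε * |t| ^ (-α)) ^ k ≤ (1 * |t| ^ (-α)) ^ k := by gcongr
      have h4 : (1 * |t| ^ (-α)) ^ k = |t| ^ (-(α * k)) := by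
        rw [one_mul, ← Real.rpow_natCast, ← Real.rpow_mul ht0.le, neg_mul]
      have h5 : |t| ^ (-(α * k)) ≤ |t| ^ (-a) :=
        Real.rpow_le_rpow_of_exponent_ge ht0 h (by linarith)
      linarith
    · refine (h2 h).trans (mul_le_mul_of_nonneg_left ?_ hD)
      have h5 : |t| ^ (α - 1) ≤ |t| ^ (-b) := Real.rpow_le_rpow_of_exponent_le h (by linarith)
      linarith
  exact ⟨hJ.hasDeriv, fun t ht => key ht (hJ.small t ht) (hJ.large t),
    fun t ht => key ht (hJ.small' t ht) (hJ.large' t)⟩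

/-- Boundary terms of the integrations by parts sit at s = 1, where there is no damping, so order k
costs the full |t|^{-αk}. -/
lemma exists_hasWeightedTransform_boundary (k : ℕ) (ha : 0 < a) (ha1 : a < 1) (hb : 0 < b)
    (hb1 : b < 1) (haσ : a < σ) (hbσ : b < σ) (hσ1 : σ < 1) (hτa : τ ≤ σ - a) (hτb : τ ≤ σ - b)
    (hak : α * k ≤ a) (hbα : b ≤ 1 - α) (hDB : 0 ≤ DB) :
    ∃ K : ℝ, 0 ≤ K ∧ ∀ (ε q : ℝ) (B B' : ℝ → ℂ), 0 < ε → ε ≤ 1 → IsSymbol ε α k α DB B B' →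
      0 ≤ q → HasWeightedTransform α σ (K * (1 + q) ^ (-τ))
        (fun t => Complex.exp (-(q * t * Complex.I)) * (B t * (1 + t * Complex.I)⁻¹)) := by
  obtain ⟨K, hK, h⟩ := exists_hasWeightedTransform_exp_mul α ha ha1 hb hb1 haσ hbσ hσ1 hτa hτb
  refine ⟨K * (2 * (DB * 1)), by positivity, fun ε q B B' hε hε1 hB hq => ?_⟩
  have hJ := hB.mul (isSymbol_inv (ε := ε) (α := α)) hε hDB
  exact h _ _ _ _ q (IsSymbol.isOscillatoryAmplitude hJ hε hε1 (by positivity) hak hbα)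
    (by positivity) hJ.large hq

lemma exists_hasWeightedTransform_kernel (k : ℕ) (hc : 0 < c) (hα : 0 < α) (hα2 : α < 1 / 2)
    (hη : 0 < η) (hη1 : η ≤ 1) (ha : 0 < a) (ha1 : a < 1) (hb : 0 < b)
    (hb1 : b < 1) (haσ : a < σ) (hbσ : b < σ) (hσ1 : σ < 1) (hτa : τ ≤ σ - a) (hτb : τ ≤ σ - b)
    (hτ0 : 0 ≤ τ) (hτ : τ ≤ 1 / 2) (hak : α * (k - 1 + η) ≤ a) (hbα : b ≤ 1 - 2 * α)
    (hDB : 0 ≤ DB) (hDβ : 0 ≤ Dβ) :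
    ∃ K : ℝ, 0 ≤ K ∧ ∀ (ε q κ : ℝ) (φ β β' B B' : ℝ → ℂ), 0 < ε → ε ≤ 1 →
      IsPhase ε α c D φ β → IsSymbol ε α 1 α Dβ β β' → IsSymbol ε α k α DB B B' →
      0 < q → -1 / 4 ≤ κ → κ ≤ 0 →
      HasWeightedTransform α σ (K * (1 + q) ^ (-τ)) (kernelTransform κ φ B q) := by
  obtain ⟨M, hM0, hM⟩ := exists_kernel_bounds (D := D) k hc hα hα2 hη hη1 ha.le hak hbα hDB hDβ
  obtain ⟨K, hK, h⟩ := exists_hasWeightedTransform_integral α ha ha1 hb hb1 haσ hbσ hσ1 hτa hτb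
    hη hτ0 hτ
  refine ⟨K * M, by positivity, fun ε q κ φ β β' B B' hε hε1 hφ hβ hB hq hκ hκ0 => ?_⟩
  refine h (kernelFun φ B) (kernelDeriv φ β B B') M M q κ
    (measurable_kernelFun hφ.measurable hB.measurable) (fun s hs => ?_) hM0 (fun s hs => ?_) hq hκ
    hκ0
  · obtain ⟨h1, h2, -⟩ := hM ε φ β β' B B' hε hε1 hφ hβ hB s hs
    exact ⟨fun t ht => hasDerivAt_kernelFun hφ hB hs.1.ne' ht, h1, h2⟩
  · exact (hM ε φ β β' B B' hε hε1 hφ hβ hB s hs).2.2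

end terms

section expansion

variable {ε α c D Dβ κ p : ℝ} {φ β β₁ β₂ : ℝ → ℂ}

/-- `b² / (1 + x)` on the imaginary axis. -/
def squareSymbol (β : ℝ → ℂ) (t : ℝ) : ℂ := β t * β t * (1 + t * Complex.I)⁻¹

/-- `t` times the derivative of `squareSymbol β`. -/
def squareSymbolDeriv (β β₁ : ℝ → ℂ) (t : ℝ) : ℂ :=
  (β₁ t * β t + β t * β₁ t) * (1 + t * Complex.I)⁻¹ + β t * β t *
    (-(t * Complex.I) * ((1 + t * Complex.I)⁻¹ * (1 + t * Complex.I)⁻¹))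

lemma isSymbol_square (hβ : IsSymbol ε α 1 α Dβ β β₁) (hε : 0 < ε) (hD : 0 ≤ Dβ) :
    IsSymbol ε α 2 (2 * α - 1) (4 * (Dβ * Dβ)) (squareSymbol β) (squareSymbolDeriv β β₁) := by
  have h := (hβ.mul hβ hε hD).mul (isSymbol_inv (ε := ε) (α := α)) hε (by positivity)
  have e1 : α + α + -1 = 2 * α - 1 := by ring
  have e2 : 2 * (2 * (Dβ * Dβ) * 1) = 4 * (Dβ * Dβ) := by ring
  rw [e1, e2] at h
  exact h

/-- The third integration by parts makes the derivative of `squareSymbol` an amplitude, whose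
transform requires one derivative more. -/
lemma exists_isSymbol_squareDeriv (α : ℝ) {Dβ : ℝ} (hD : 0 ≤ Dβ) :
    ∃ E : ℝ, 0 ≤ E ∧ ∀ (ε : ℝ) (β β₁ β₂ : ℝ → ℂ), 0 < ε → IsSymbol ε α 1 α Dβ β β₁ →
      IsSymbol ε α 1 α Dβ β₁ β₂ → ∃ G : ℝ → ℂ,
        IsSymbol ε α 2 (2 * α - 1) E (squareSymbolDeriv β β₁) G := by
  refine ⟨2 * ((2 * (Dβ * Dβ) + 2 * (Dβ * Dβ)) * 1) + 2 * (2 * (Dβ * Dβ) * (2 * (1 * (2 * (1 * 1))))),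
    by positivity, fun ε β β₁ β₂ hε hβ hβ₁ => ?_⟩
  have h1 := ((hβ₁.mul hβ hε hD).add (hβ.mul hβ₁ hε hD)).mul
    (isSymbol_inv (ε := ε) (α := α)) hε (by positivity)
  have hinv := (isSymbol_inv (ε := ε) (α := α)).mul (isSymbol_inv (ε := ε) (α := α)) hε
    zero_le_one
  have h2 := (hβ.mul hβ hε hD).mul ((isSymbol_mul_I (ε := ε) (α := α)).neg.mul hinv hε
    zero_le_one) hε (by positivity)
  have e1 : α + α + -1 = 2 * α - 1 := by ring
  have e2 : α + α + (1 + (-1 + -1)) = 2 * α - 1 := by ring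
  rw [e1] at h1
  rw [e2] at h2
  exact ⟨_, h1.add h2⟩

/-- Up to three integrations by parts, grouped by the powers of 1/p gained. The second one creates
b², whose growth |t|^{2α} exceeds the |t|^α allowed by the kernel bounds. It is split as b²/(1+x) +
x b²/(1+x): the first summand is admissible as it stands, and the factor x of the second permits a
third integration by parts. -/
lemma kernelTransform_expansion (hε : 0 < ε) (hα : 0 < α) (hc : 0 < c)
    (hφ : IsPhase ε α c D φ β) (hβ : IsSymbol ε α 1 α Dβ β β₁) (hβ₁ : IsSymbol ε α 1 α Dβ β₁ β₂)
    (hD : 0 ≤ Dβ) (hκ : -1 < κ) (hp : 0 < p) {t : ℝ} (ht : t ≠ 0) :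
    (2 + κ) / p * kernelTransform κ φ (fun t => t * Complex.I * 1) p t +
      1 / p * kernelTransform κ φ (fun t => t * Complex.I * β t) (p + 1 : ℝ) t =
    ((2 + κ) / (p * p) : ℂ) * ((-1 : ℂ) * (Complex.exp (-(p * t * Complex.I)) *
          (1 * (1 + t * Complex.I)⁻¹)) + (1 + κ : ℂ) * kernelTransform κ φ (fun _ => 1) p t +
        kernelTransform κ φ β (p + 1) t) +
    (1 / (p * (p + 1)) : ℂ) * ((-1 : ℂ) * (Complex.exp (-((p + 1 : ℝ) * t * Complex.I)) *
          (β t * (1 + t * Complex.I)⁻¹)) + (1 + κ : ℂ) * kernelTransform κ φ β (p + 1) t +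
        kernelTransform κ φ β₁ (p + 1) t + kernelTransform κ φ (squareSymbol β) (p + 2) t) +
    (1 / (p * (p + 1) * (p + 2)) : ℂ) * ((-1 : ℂ) *
          (Complex.exp (-((p + 2 : ℝ) * t * Complex.I)) *
          (squareSymbol β t * (1 + t * Complex.I)⁻¹)) +
        (1 + κ : ℂ) * kernelTransform κ φ (squareSymbol β) (p + 2) t +
        kernelTransform κ φ (squareSymbolDeriv β β₁) (p + 2) t +
        kernelTransform κ φ (fun t => β t * squareSymbol β t) (p + 3) t) := by
  obtain ⟨E, hE, hsq'⟩ := exists_isSymbol_squareDeriv α hD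
  obtain ⟨G, hG⟩ := hsq' ε β β₁ β₂ hε hβ hβ₁
  have hsq := isSymbol_square hβ hε hD
  have hone := isSymbol_one (ε := ε) (α := α)
  have hzero : IsSymbol ε α 0 0 0 (fun _ => 0) (fun _ => 0) :=
    ⟨fun t _ => (hasDerivAt_const t (0 : ℂ)).congr_deriv (by simp), fun _ _ _ => by simp,
      fun _ _ _ => by simp, fun _ _ => by simp, fun _ _ => by simp⟩
  have s1 := kernelTransform_mul_I (q := p) hε hα hc hφ hβ hD zero_le_one hone hzero le_rfl hκ ht
  have s2 := kernelTransform_mul_I (q := p + 1) hε hα hc hφ hβ hD hD hβ hβ₁ hD hκ ht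
  have s3 := kernelTransform_mul_I (q := p + 2) hε hα hc hφ hβ hD (by positivity) hsq hG hE hκ
    ht
  have e1 : p + 1 + 1 = p + 2 := by ring
  have e2 : p + 2 + 1 = p + 3 := by ring
  rw [e1] at s2
  rw [e2] at s3
  rw [kernelTransform_zero] at s1
  simp only [mul_one] at s1
  have hxsq := (isSymbol_mul_I (ε := ε) (α := α)).mul hsq hε zero_le_one
  obtain ⟨N₁, hN₁⟩ := exists_norm_kernelFun_le hε hα hc hφ (by positivity) hsq ht
  obtain ⟨N₂, hN₂⟩ := exists_norm_kernelFun_le hε hα hc hφ (by positivity) hxsq ht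
  -- The splitting b² = (1 + x) b²/(1 + x), with x = it.
  have s4 : kernelTransform κ φ (fun t => β t * β t) (p + 2) t =
      kernelTransform κ φ (squareSymbol β) (p + 2) t +
      kernelTransform κ φ (fun t => t * Complex.I * squareSymbol β t) (p + 2) t := by
    rw [← kernelTransform_add (intervalIntegrable_kernel hκ hφ.measurable hsq.measurable hN₁)
      (intervalIntegrable_kernel hκ hφ.measurable hxsq.measurable hN₂)]
    refine kernelTransform_congr (fun t _ => ?_) ht
    have := one_add_mul_I_ne_zero t
    simp only [squareSymbol]
    field_simp
  rw [s4] at s2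
  have hpc : (p : ℂ) ≠ 0 := Complex.ofReal_ne_zero.2 hp.ne'
  have hp1 : (p : ℂ) + 1 ≠ 0 := by
    have : ((p + 1 : ℝ) : ℂ) ≠ 0 := Complex.ofReal_ne_zero.2 (by linarith)
    simpa using this
  have hp2 : (p : ℂ) + 2 ≠ 0 := by
    have : ((p + 2 : ℝ) : ℂ) ≠ 0 := Complex.ofReal_ne_zero.2 (by linarith)
    simpa using this
  simp only [mul_one, one_mul] at s1 ⊢
  have t1 : ((p + 1 : ℝ) : ℂ) = p + 1 := by push_cast; ring
  have t2 : ((p + 2 : ℝ) : ℂ) = p + 2 := by push_cast; ring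
  rw [t1] at s2 ⊢
  rw [t2] at s3 ⊢
  replace s1 := (eq_div_iff hpc).2 ((mul_comm _ _).trans s1)
  replace s2 := (eq_div_iff hp1).2 ((mul_comm _ _).trans s2)
  replace s3 := (eq_div_iff hp2).2 ((mul_comm _ _).trans s3)
  replace s1 : _ = (_ + kernelTransform κ φ β (p + 1) t) / (p : ℂ) := s1
  rw [s1, s2, s3]
  simp only [div_eq_mul_inv, mul_inv]
  ring

end expansion

end SelfSim
end

/-! ### The weighted estimate for `H0`. -/

noncomputable section

namespace SelfSim

lemma norm_ofReal_add_le {κ : ℝ} (m : ℝ) (h : 0 ≤ m + κ) (hκ : κ ≤ 0) :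
    ‖(m + κ : ℂ)‖ ≤ m := by
  have : (m + κ : ℂ) = ((m + κ : ℝ) : ℂ) := by push_cast; ring
  rw [this, Complex.norm_real, Real.norm_of_nonneg h]
  linarith

set_option maxHeartbeats 1000000 in
/-- The boundary function of `H₀` satisfies the weighted estimate, uniformly in the parameters. -/
lemma exists_hasWeightedTransform_H0 {α θ C c : ℝ} (hα : 0 < α) (hαθ : α < θ) (hθ : θ < 1 / 2)
    (hC : 1 ≤ C) (hc : 0 < c) :
    ∃ K : ℝ, 0 ≤ K ∧ ∀ (ε κ p : ℝ) (b : ℂ → ℂ), 0 < ε → ε ≤ 1 → IsRate α C c ε b →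
      -1 / 4 ≤ κ → κ ≤ 0 → 0 < p →
      HasWeightedTransform α (2 * θ - (θ - α) / 2) (K * ((1 + p) ^ (1 - θ) / p ^ 3)) (fun t =>
        (2 + κ) / p * kernelTransform κ (fun t => phase b (t * Complex.I))
          (fun t => t * Complex.I * 1) p t +
        1 / p * kernelTransform κ (fun t => phase b (t * Complex.I))
          (fun t => t * Complex.I * b (t * Complex.I)) (p + 1 : ℝ) t) := by
  have hα2 : α < 1 / 2 := hαθ.trans hθ
  -- This choice makes σ - (α + η) equal to θ, the decay wanted from amplitudes of size |t|^{-α-η},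
  -- and leaves 2α + η < σ.
  set η := (θ - α) / 2 with hη
  have hη0 : 0 < η := by linarith
  have hη1 : η ≤ 1 := by linarith
  set σ := 2 * θ - η with hσ
  have hσ1 : σ < 1 := by linarith
  -- The exponent at infinity: 1 - 2α is the decay of the differentiated kernel, and b' ≤ η ensures
  -- σ - b' ≥ θ.
  set b' := min (1 - 2 * α) η with hb'
  have hb'0 : 0 < b' := lt_min (by linarith) hη0
  have hb'1 : b' ≤ 1 - 2 * α := min_le_left _ _
  have hb'2 : b' ≤ η := min_le_right _ _
  have hαη : α * η ≤ η := mul_le_of_le_one_left hη0.le (by linarith)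
  have hD : 0 ≤ 40 * C := by linarith
  set D₀ := 10 * C + c / α + c with hD₀
  obtain ⟨E, hE, hsq'⟩ := exists_isSymbol_squareDeriv α hD
  -- Thanks to damping, order two costs only α(1 + η) ≤ α + η, so the decay (1+p)^{-θ} survives.
  have ker₁ : ∀ (k : ℕ) (DB : ℝ), (k : ℝ) ≤ 2 → 0 ≤ DB → _ := fun k DB hk hDB =>
    exists_hasWeightedTransform_kernel (α := α) (σ := σ) (τ := θ) (a := α + η) (b := b') (c := c)
      (D := D₀) (DB := DB) (Dβ := 40 * C) (η := η) k hc hα hα2 hη0 hη1 (by linarith) (by linarith)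
      hb'0 (by linarith) (by linarith) (by linarith) hσ1 (by linarith) (by linarith) (by linarith)
      (by linarith) (by nlinarith) hb'1 hDB hD
  -- Order three costs about 2α and leaves no decay in p from the translation; these terms carry
  -- three powers of 1/p instead.
  have ker₂ : ∀ (k : ℕ) (DB : ℝ), (k : ℝ) ≤ 3 → 0 ≤ DB → _ := fun k DB hk hDB =>
    exists_hasWeightedTransform_kernel (α := α) (σ := σ) (τ := 0) (a := 2 * α + η) (b := b')
      (c := c) (D := D₀) (DB := DB) (Dβ := 40 * C) (η := η) k hc hα hα2 hη0 hη1 (by linarith)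
      (by linarith) hb'0 (by linarith) (by linarith) (by linarith) hσ1 (by linarith) (by linarith)
      le_rfl (by linarith) (by nlinarith) hb'1 hDB hD
  have bd₁ : ∀ (k : ℕ) (DB : ℝ), (k : ℝ) ≤ 1 → 0 ≤ DB → _ := fun k DB hk hDB =>
    exists_hasWeightedTransform_boundary (α := α) (σ := σ) (τ := θ) (a := α + η) (b := b')
      (DB := DB) k (by linarith) (by linarith)
      hb'0 (by linarith) (by linarith) (by linarith) hσ1 (by linarith) (by linarith) (by nlinarith)
      (by linarith) hDB
  have bd₂ : ∀ (k : ℕ) (DB : ℝ), (k : ℝ) ≤ 2 → 0 ≤ DB → _ := fun k DB hk hDB =>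
    exists_hasWeightedTransform_boundary (α := α) (σ := σ) (τ := 0) (a := 2 * α + η) (b := b')
      (DB := DB) k (by linarith) (by linarith)
      hb'0 (by linarith) (by linarith) (by linarith) hσ1 (by linarith) (by linarith) (by nlinarith)
      (by linarith) hDB
  obtain ⟨k₁, hk₁, f₁⟩ := bd₁ 0 1 (by norm_num) zero_le_one
  obtain ⟨k₂, hk₂, f₂⟩ := ker₁ 0 1 (by norm_num) zero_le_one
  obtain ⟨k₃, hk₃, f₃⟩ := ker₁ 1 (40 * C) (by norm_num) hD
  obtain ⟨k₄, hk₄, f₄⟩ := bd₁ 1 (40 * C) (by norm_num) hD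
  obtain ⟨k₅, hk₅, f₅⟩ := ker₁ 2 (4 * (40 * C * (40 * C))) (by norm_num) (by positivity)
  obtain ⟨k₆, hk₆, f₆⟩ := bd₂ 2 (4 * (40 * C * (40 * C))) (by norm_num) (by positivity)
  obtain ⟨k₇, hk₇, f₇⟩ := ker₂ 2 (4 * (40 * C * (40 * C))) (by norm_num) (by positivity)
  obtain ⟨k₈, hk₈, f₈⟩ := ker₂ 2 E (by norm_num) hE
  obtain ⟨k₉, hk₉, f₉⟩ := ker₂ (1 + 2) (2 * (40 * C * (4 * (40 * C * (40 * C))))) (by norm_num)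
    (by positivity)
  refine ⟨2 * (k₁ + k₂ + k₃) + (k₄ + k₃ + k₃ + k₅) + (k₆ + k₇ + k₈ + k₉), by positivity,
    fun ε κ p b hε hε1 hb hκ hκ0 hp => ?_⟩
  obtain ⟨hβ, hβ₁⟩ := hb.isSymbol hα (by linarith) hC hε hε1
  have hφ := hb.isPhase hα hα2 (by linarith) hc hε hε1
  set φ : ℝ → ℂ := fun t => phase b (t * Complex.I) with hφdef
  set β : ℝ → ℂ := fun t => b (t * Complex.I) with hβdef
  set β₁ : ℝ → ℂ := fun t => t * Complex.I * deriv b (t * Complex.I) with hβ₁def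
  obtain ⟨G, hG⟩ := hsq' ε β β₁ _ hε hβ hβ₁
  have hsq := isSymbol_square hβ hε hD
  have hone := isSymbol_one (ε := ε) (α := α)
  have hcube := hβ.mul hsq hε hD
  have hone' := hone.mono hα.le zero_le_one
  have hsq' := hsq.mono (by linarith : 2 * α - 1 ≤ α) (by positivity)
  have hG' := hG.mono (by linarith : 2 * α - 1 ≤ α) hE
  have hcube' := hcube.mono (by linarith : α + (2 * α - 1) ≤ α) (by positivity)
  set w := (1 + p) ^ (-θ) with hw
  have hw0 : 0 ≤ w := by positivity
  have dec : ∀ {K q : ℝ} {F : ℝ → ℂ}, 0 ≤ K → p ≤ q →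
      HasWeightedTransform α σ (K * (1 + q) ^ (-θ)) F → HasWeightedTransform α σ (K * w) F := by
    intro K q F hK hq h
    refine h.mono (mul_le_mul_of_nonneg_left ?_ hK)
    exact Real.rpow_le_rpow_of_nonpos (by linarith) (by linarith) (by linarith)
  have dec' : ∀ {K q : ℝ} {F : ℝ → ℂ},
      HasWeightedTransform α σ (K * (1 + q) ^ (-0 : ℝ)) F → HasWeightedTransform α σ K F := by
    intro K q F h
    simpa using h
  have hnegone : ∀ {K : ℝ} {F : ℝ → ℂ}, HasWeightedTransform α σ K F →
      HasWeightedTransform α σ K (fun t => (-1 : ℂ) * F t) := fun h => by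
    simpa using h.const_mul (-1)
  have honeκ : ∀ {K : ℝ} {F : ℝ → ℂ}, 0 ≤ K → HasWeightedTransform α σ K F →
      HasWeightedTransform α σ K (fun t => (1 + κ : ℂ) * F t) := fun {K} {F} hK h => by
    refine (h.const_mul (1 + κ)).mono (mul_le_of_le_one_left hK ?_)
    simpa using norm_ofReal_add_le (κ := κ) 1 (by linarith) hκ0
  have T₁ := hnegone (dec hk₁ le_rfl (f₁ ε p _ _ hε hε1 hone' hp.le))
  have T₂ := honeκ (by positivity) (dec hk₂ le_rfl (f₂ ε p κ φ β β₁ _ _ hε hε1 hφ hβ hone' hp hκ hκ0))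
  have T₃ := dec hk₃ (by linarith : p ≤ p + 1)
    (f₃ ε (p + 1) κ φ β β₁ _ _ hε hε1 hφ hβ hβ (by linarith) hκ hκ0)
  have T₃' := dec hk₃ (by linarith : p ≤ p + 1)
    (f₃ ε (p + 1) κ φ β β₁ _ _ hε hε1 hφ hβ hβ₁ (by linarith) hκ hκ0)
  have T₄ := hnegone (dec hk₄ (by linarith : p ≤ p + 1) (f₄ ε (p + 1) _ _ hε hε1 hβ (by linarith)))
  have T₅ := dec hk₅ (by linarith : p ≤ p + 2)
    (f₅ ε (p + 2) κ φ β β₁ _ _ hε hε1 hφ hβ hsq' (by linarith) hκ hκ0)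
  have T₆ := hnegone (dec' (f₆ ε (p + 2) _ _ hε hε1 hsq' (by linarith)))
  have T₇ := honeκ hk₇ (dec' (f₇ ε (p + 2) κ φ β β₁ _ _ hε hε1 hφ hβ hsq' (by linarith) hκ hκ0))
  have T₈ := dec' (f₈ ε (p + 2) κ φ β β₁ _ _ hε hε1 hφ hβ hG' (by linarith) hκ hκ0)
  have T₉ := dec' (f₉ ε (p + 3) κ φ β β₁ _ _ hε hε1 hφ hβ hcube' (by linarith) hκ hκ0)
  have G₁ := ((T₁.add T₂ (by positivity) (by positivity)).add T₃ (by positivity)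
    (by positivity)).const_mul ((2 + κ) / (p * p) : ℂ)
  have G₂ := (((T₄.add (honeκ (by positivity) T₃) (by positivity) (by positivity)).add T₃'
    (by positivity) (by positivity)).add T₅ (by positivity) (by positivity)).const_mul
    (1 / (p * (p + 1)) : ℂ)
  have G₃ := (((T₆.add T₇ (by positivity) (by positivity)).add T₈ (by positivity)
    (by positivity)).add T₉ (by positivity) (by positivity)).const_mul
    (1 / (p * (p + 1) * (p + 2)) : ℂ)
  have hsum := (G₁.add G₂ (by positivity) (by positivity)).add G₃ (by positivity) (by positivity)
  refine (hsum.mono ?_).congr fun t ht =>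
    (kernelTransform_expansion hε hα hc hφ hβ hβ₁ hD (by linarith) hp ht).symm
  have hn₁ : ‖((2 + κ) / (p * p) : ℂ)‖ ≤ 2 / (p * p) := by
    rw [norm_div, norm_mul, Complex.norm_real, Real.norm_of_nonneg hp.le]
    gcongr
    simpa using norm_ofReal_add_le (κ := κ) 2 (by linarith) hκ0
  have hn₂ : ‖(1 / (p * (p + 1)) : ℂ)‖ = 1 / (p * (p + 1)) := by
    have : (1 / (p * (p + 1)) : ℂ) = ((1 / (p * (p + 1)) : ℝ) : ℂ) := by push_cast; ring
    rw [this, Complex.norm_real, Real.norm_of_nonneg (by positivity)]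
  have hn₃ : ‖(1 / (p * (p + 1) * (p + 2)) : ℂ)‖ = 1 / (p * (p + 1) * (p + 2)) := by
    have : (1 / (p * (p + 1) * (p + 2)) : ℂ) = ((1 / (p * (p + 1) * (p + 2)) : ℝ) : ℂ) := by
      push_cast; ring
    rw [this, Complex.norm_real, Real.norm_of_nonneg (by positivity)]
  set V := (1 + p) ^ (1 - θ) / p ^ 3 with hV
  have hV1 : (1 + p) ^ (1 - θ) = w * (1 + p) := by
    rw [hw, ← Real.rpow_add_one (by positivity)]
    ring_nf
  -- The target is (1+p)^{-θ}(1+p)/p³, and p ≤ 1 + p.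
  have e₁ : 1 / (p * p) * w ≤ V := by
    rw [hV, hV1, le_div_iff₀ (by positivity)]
    have : 1 / (p * p) * w * p ^ 3 = w * p := by field_simp
    rw [this]
    gcongr
    linarith
  have e₂ : 1 / (p * (p + 1)) * w ≤ V := by
    refine le_trans ?_ e₁
    gcongr
    linarith
  have e₃ : 1 / (p * (p + 1) * (p + 2)) ≤ V := by
    rw [hV]
    have h1 : 1 ≤ (1 + p) ^ (1 - θ) := Real.one_le_rpow (by linarith) (by linarith)
    have h2 : p ^ 3 ≤ p * (p + 1) * (p + 2) := by nlinarith [mul_pos hp hp]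
    gcongr
  rw [hn₂, hn₃]
  have m₁ : ‖((2 + κ) / (p * p) : ℂ)‖ * (k₁ * w + k₂ * w + k₃ * w) ≤
      2 * (k₁ + k₂ + k₃) * V := by
    calc ‖((2 + κ) / (p * p) : ℂ)‖ * (k₁ * w + k₂ * w + k₃ * w)
        ≤ 2 / (p * p) * (k₁ * w + k₂ * w + k₃ * w) := by gcongr
      _ = 2 * (k₁ + k₂ + k₃) * (1 / (p * p) * w) := by ring
      _ ≤ _ := by gcongr
  have m₂ : 1 / (p * (p + 1)) * (k₄ * w + k₃ * w + k₃ * w + k₅ * w) ≤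
      (k₄ + k₃ + k₃ + k₅) * V := by
    calc 1 / (p * (p + 1)) * (k₄ * w + k₃ * w + k₃ * w + k₅ * w)
        = (k₄ + k₃ + k₃ + k₅) * (1 / (p * (p + 1)) * w) := by ring
      _ ≤ _ := by gcongr
  have m₃ : 1 / (p * (p + 1) * (p + 2)) * (k₆ + k₇ + k₈ + k₉) ≤ (k₆ + k₇ + k₈ + k₉) * V := by
    rw [mul_comm]
    gcongr
  linarith

end SelfSim
end

/-! ### The Fourier transform on L² and existence of the inverse Laplace transform. -/

noncomputable section

namespace SelfSim

open scoped FourierTransform SchwartzMap ContDiff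

/-- On `L¹ ∩ L²` the Fourier transform of `L²` is given by the Fourier integral. -/
theorem coeFn_fourier_toLp {g : ℝ → ℂ} (h₁ : Integrable g) (h₂ : MemLp g 2 volume) :
    (𝓕 (h₂.toLp g) : Lp ℂ 2 (volume : Measure ℝ)) =ᵐ[volume] 𝓕 g := by
  have hcont : Continuous (𝓕 g) := VectorFourier.fourierIntegral_continuous
    Real.continuous_fourierChar (by exact continuous_inner) h₁
  apply ae_eq_of_integral_contDiff_smul_eq
  · exact (Lp.memLp _).locallyIntegrable one_le_two
  · exact hcont.locallyIntegrable
  intro u hu huc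
  have hc₁ : HasCompactSupport (Complex.ofRealCLM ∘ u) := huc.comp_left rfl
  have hc₂ : ContDiff ℝ ∞ (Complex.ofRealCLM ∘ u) := by fun_prop
  let s : 𝓢(ℝ, ℂ) := hc₁.toSchwartzMap hc₂
  have hs : ∀ x, s x = (u x : ℂ) := fun x => rfl
  -- Both transforms are tested with a smooth compactly supported s: the L² transform agrees with
  -- the distributional one, and the Fourier integral satisfies the multiplication formula.
  have key := congrArg (fun T : 𝓢'(ℝ, ℂ) => T s)
    (Lp.fourier_toTemperedDistribution_eq (h₂.toLp g))
  simp only [TemperedDistribution.fourier_apply, Lp.toTemperedDistribution_apply] at key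
  have e₁ : ∫ x, u x • (𝓕 (h₂.toLp g) : Lp ℂ 2 (volume : Measure ℝ)) x
      = ∫ x, s x • (𝓕 (h₂.toLp g) : Lp ℂ 2 (volume : Measure ℝ)) x := by
    simp [hs]
  rw [e₁, ← key]
  have e₂ : ∫ x, (𝓕 s) x • (h₂.toLp g) x = ∫ x, (𝓕 (s : ℝ → ℂ)) x • g x := by
    refine integral_congr_ae ?_
    filter_upwards [h₂.coeFn_toLp] with x hx
    rw [hx, SchwartzMap.fourier_coe]
  rw [e₂]
  have e₃ := VectorFourier.integral_fourierIntegral_smul_eq_flip (L := innerₗ ℝ) (μ := volume)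
    (ν := volume) Real.continuous_fourierChar (by exact continuous_inner)
    (s.integrable (μ := volume)) h₁
  rw [flip_innerₗ] at e₃
  refine Eq.trans e₃ ?_
  refine integral_congr_ae (Eventually.of_forall fun x => ?_)
  simp only [hs]
  simp
  left
  rfl

lemma tendsto_eLpNorm_indicator_sub {g : ℝ → ℂ} (hg : MemLp g 2 volume) {S : ℝ → Set ℝ}
    (hS : ∀ R, MeasurableSet (S R)) (hmem : ∀ t, ∀ᶠ R in atTop, t ∈ S R) :
    Tendsto (fun R => eLpNorm (fun t => (S R).indicator g t - g t) 2 volume) atTop (𝓝 0) := by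
  have h2 : (2 : ENNReal) ≠ 0 := two_ne_zero
  have h3 : (2 : ENNReal) ≠ ⊤ := ENNReal.ofNat_ne_top
  have hle : ∀ R t, ‖(S R).indicator g t - g t‖ₑ ≤ ‖g t‖ₑ := by
    intro R t
    by_cases h : t ∈ S R <;> simp [h]
  have hlim : Tendsto (fun R => ∫⁻ t, ‖(S R).indicator g t - g t‖ₑ ^ (2 : ℝ)) atTop
      (𝓝 (∫⁻ _ : ℝ, 0)) := by
    refine tendsto_lintegral_filter_of_dominated_convergence' (fun t => ‖g t‖ₑ ^ (2 : ℝ)) ?_ ?_ ?_ ?_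
    · refine Eventually.of_forall fun R => ?_
      exact (((hg.1.indicator (hS R)).sub hg.1).enorm).pow_const _
    · exact Eventually.of_forall fun R => Eventually.of_forall fun t =>
        ENNReal.rpow_le_rpow (hle R t) (by norm_num)
    · have := lintegral_rpow_enorm_lt_top_of_eLpNorm_lt_top h2 h3 hg.2
      simpa using this.ne
    · refine Eventually.of_forall fun t => ?_
      refine tendsto_const_nhds.congr' ?_
      filter_upwards [hmem t] with R hR
      simp [hR]
  have := (ENNReal.continuous_rpow_const (y := (1 / 2 : ℝ))).tendsto _ |>.comp hlim
  simp only [lintegral_zero] at this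
  rw [ENNReal.zero_rpow_of_pos (by norm_num)] at this
  refine this.congr fun R => ?_
  simp only [Function.comp]
  rw [eLpNorm_eq_lintegral_rpow_enorm_toReal h2 h3]
  simp

lemma memLp_comp_mul_left {g : ℝ → ℂ} (hg : MemLp g 2 volume) {a : ℝ} (ha : a ≠ 0) :
    MemLp (fun t => g (a * t)) 2 volume := by
  have h : MemLp g 2 (Measure.map (a * ·) volume) := by
    rw [Real.map_volume_mul_left ha]
    exact hg.smul_measure ENNReal.ofReal_ne_top
  exact h.comp_of_map (by fun_prop)

/-- The substitution t = -2πτ produces the Fourier kernel e^{-2πiτξ}, and its Jacobian is the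
prefactor 1/(2π). -/
lemma truncatedInverseLaplace_eq_fourier (F : ℂ → ℂ) {R : ℝ} (hR : 0 < R) (ξ : ℝ) :
    truncatedInverseLaplace F R ξ = 𝓕 (fun τ : ℝ => (Ioc (-R) R).indicator
      (fun t : ℝ => F (t * Complex.I)) (-(2 * Real.pi) * τ)) ξ := by
  set g : ℝ → ℂ := fun t : ℝ => F (t * Complex.I)
  have hpi : (Real.pi : ℂ) ≠ 0 := Complex.ofReal_ne_zero.2 Real.pi_ne_zero
  rw [Real.fourier_real_eq_integral_exp_smul]
  have h := Measure.integral_comp_mul_left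
    (fun t : ℝ => Complex.exp (t * Complex.I * ξ) • (Ioc (-R) R).indicator g t)
    (-(2 * Real.pi))
  have e : ∀ τ : ℝ, Complex.exp (((-2 * Real.pi * τ * ξ : ℝ) : ℂ) * Complex.I) =
      Complex.exp (((-(2 * Real.pi) * τ : ℝ) : ℂ) * Complex.I * ξ) := by
    intro τ
    congr 1
    push_cast
    ring
  simp only [e]
  rw [h, truncatedInverseLaplace, intervalIntegral.integral_of_le (by linarith),
    ← integral_indicator measurableSet_Ioc]
  have e2 : |(-(2 * Real.pi))⁻¹| = 1 / (2 * Real.pi) := by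
    rw [abs_inv, abs_neg, abs_of_pos Real.two_pi_pos, one_div]
  rw [e2, Complex.real_smul]
  have e3 : ∀ t : ℝ, (Ioc (-R) R).indicator
      (fun t : ℝ => F (t * Complex.I) * Complex.exp (t * Complex.I * ξ) * Complex.I) t =
      Complex.I * (Complex.exp (t * Complex.I * ξ) • (Ioc (-R) R).indicator g t) := by
    intro t
    by_cases ht : t ∈ Ioc (-R) R
    · simp only [indicator_of_mem ht, smul_eq_mul, g]
      ring
    · simp [indicator_of_notMem ht]
  simp only [e3]
  rw [integral_const_mul, ← mul_assoc]
  congr 1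
  push_cast
  field_simp

/-- The inverse Laplace transform exists as soon as the boundary function is square integrable. -/
theorem exists_isInverseLaplace {F : ℂ → ℂ}
    (hF : MemLp (fun t : ℝ => F (t * Complex.I)) 2 volume) : ∃ Q : ℝ → ℂ, IsInverseLaplace F Q := by
  set g : ℝ → ℂ := fun t : ℝ => F (t * Complex.I) with hg
  have ha : -(2 * Real.pi) ≠ 0 := neg_ne_zero.2 Real.two_pi_pos.ne'
  set G : ℝ → ℂ := fun τ => g (-(2 * Real.pi) * τ) with hG
  have hG2 : MemLp G 2 volume := memLp_comp_mul_left hF ha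
  set S : ℝ → Set ℝ := fun R => (fun τ => -(2 * Real.pi) * τ) ⁻¹' Ioc (-R) R with hSdef
  have hS : ∀ R, MeasurableSet (S R) := fun R => measurableSet_Ioc.preimage (by fun_prop)
  have hmem : ∀ τ, ∀ᶠ R in atTop, τ ∈ S R := by
    intro τ
    filter_upwards [eventually_gt_atTop |-(2 * Real.pi) * τ|] with R hR
    exact ⟨(abs_lt.1 hR).1, (abs_lt.1 hR).2.le⟩
  -- The truncations converge in L² by dominated convergence; Plancherel carries this convergence to
  -- their transforms.
  have hlim := tendsto_eLpNorm_indicator_sub hG2 hS hmem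
  have hGR : ∀ R, MemLp ((S R).indicator G) 2 volume := fun R => hG2.indicator (hS R)
  have hfin : ∀ R, volume (S R) ≠ ⊤ := by
    intro R
    rw [hSdef]
    simp only
    rw [Real.volume_preimage_mul_left ha, Real.volume_Ioc]
    exact ENNReal.mul_ne_top ENNReal.ofReal_ne_top ENNReal.ofReal_ne_top
  have hint : ∀ R, Integrable ((S R).indicator G) := by
    intro R
    rw [integrable_indicator_iff (hS R)]
    have : IsFiniteMeasure (volume.restrict (S R)) := ⟨by
      rw [Measure.restrict_apply_univ]; exact (hfin R).lt_top⟩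
    exact (hG2.restrict (S R)).integrable one_le_two
  let Q : Lp ℂ 2 (volume : Measure ℝ) := 𝓕 (hG2.toLp G)
  refine ⟨Q, hF, Lp.memLp Q, ?_⟩
  refine hlim.congr' ?_
  filter_upwards [eventually_gt_atTop 0] with R hR
  have e1 : ∀ ξ, truncatedInverseLaplace F R ξ = 𝓕 ((S R).indicator G) ξ := by
    intro ξ
    rw [truncatedInverseLaplace_eq_fourier F hR]
    rfl
  have e2 : (fun ξ => truncatedInverseLaplace F R ξ - Q ξ) =ᵐ[volume]
      (𝓕 ((hGR R).toLp _) - Q : Lp ℂ 2 (volume : Measure ℝ)) := by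
    filter_upwards [coeFn_fourier_toLp (hint R) (hGR R),
      Lp.coeFn_sub (𝓕 ((hGR R).toLp _) : Lp ℂ 2 (volume : Measure ℝ)) Q] with ξ h1 h2
    rw [e1, h2, Pi.sub_apply, h1]
  have e3 : (𝓕 ((hGR R).toLp _) - Q : Lp ℂ 2 (volume : Measure ℝ)) =
      𝓕 (((hGR R).sub hG2).toLp _) := by
    rw [MemLp.toLp_sub]
    exact ((Lp.fourierTransformₗᵢ ℝ ℂ).map_sub _ _).symm
  rw [eLpNorm_congr_ae e2, e3, ← Lp.enorm_def, ← ofReal_norm, Lp.norm_fourier_eq, ofReal_norm,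
    Lp.enorm_toLp]
  rfl

end SelfSim

end

/-! ### Square integrability, and passage to the limit in the truncation. -/

noncomputable section

namespace SelfSim

section

variable {ε α c D κ q σ N : ℝ} {φ β B : ℝ → ℂ}

lemma norm_kernelTransform_le (hκ : -1 < κ) {t M : ℝ}
    (hM : ∀ s ∈ Ioo (0 : ℝ) 1, ‖kernelFun φ B s t‖ ≤ M) :
    ‖kernelTransform κ φ B q t‖ ≤ M * (1 + κ)⁻¹ := by
  have hi : ∫ s in (0 : ℝ)..1, s ^ κ * M = M * (1 + κ)⁻¹ := by
    rw [intervalIntegral.integral_mul_const, integral_rpow (Or.inl hκ), Real.one_rpow,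
      Real.zero_rpow (by linarith)]
    ring
  rw [← hi]
  refine intervalIntegral.norm_integral_le_of_norm_le zero_le_one ?_
    ((intervalIntegral.intervalIntegrable_rpow' hκ).mul_const M)
  filter_upwards [Measure.ae_ne volume 1] with s hs1 hs
  have hp : 0 ≤ s ^ κ := Real.rpow_nonneg hs.1.le _
  rw [norm_mul, norm_mul, norm_exp_neg_mul_I, one_mul, Complex.norm_real, Real.norm_of_nonneg hp]
  exact mul_le_mul_of_nonneg_left (hM s ⟨hs.1, lt_of_le_of_ne hs.2 hs1⟩) hp

lemma IsPhase.norm_kernelFun_le (hφ : IsPhase ε α c D φ β) (hε : 0 < ε) (hc : 0 < c) {M : ℝ}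
    (hM : ∀ t : ℝ, t ≠ 0 → |t| ≤ 1 → ‖B t‖ ≤ M) {s t : ℝ} (hs : s ∈ Ioo (0 : ℝ) 1) (ht : t ≠ 0)
    (ht1 : |t| ≤ 1) : ‖kernelFun φ B s t‖ ≤ M * Real.exp D := by
  have hs0 := hs.1
  have hst : |s * t| ≤ 1 := by
    rw [abs_mul, abs_of_pos hs.1]
    exact mul_le_one₀ hs.2.le (abs_nonneg _) ht1
  have h1 := hM _ (mul_ne_zero hs.1.ne' ht) hst
  have h2 : ‖Complex.exp (φ t - φ (s * t))‖ ≤ Real.exp D := by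
    refine (hφ.norm_exp_le hs ht).trans (mul_le_of_le_one_right (Real.exp_pos _).le ?_)
    have : 0 ≤ 1 - s := by linarith [hs.2]
    exact Real.exp_le_one_iff.2 (neg_nonpos.2 (by positivity))
  have h3 : ‖(1 + t * Complex.I)⁻¹‖ ≤ 1 := by
    rw [norm_inv]
    exact inv_le_one_of_one_le₀ (one_le_norm_one_add_mul_I t)
  have hM0 : 0 ≤ M := (norm_nonneg _).trans h1
  rw [kernelFun, norm_mul, norm_mul]
  calc _ ≤ M * Real.exp D * 1 := by gcongr
    _ = _ := mul_one _

/-- The tail |t|^{α-1} is square integrable at infinity because α < 1/2; near the origin boundedness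
is assumed. -/
lemma HasWeightedTransform.memLp {F : ℝ → ℂ} (hF : HasWeightedTransform α σ N F) (hα : 0 < α)
    (hα2 : α < 1 / 2) {M : ℝ} (hM : ∀ t : ℝ, t ≠ 0 → |t| ≤ 1 → ‖F t‖ ≤ M) :
    MemLp F 2 volume := by
  obtain ⟨M', hM'⟩ := hF.tail
  have hmeas : AEStronglyMeasurable F volume := by
    have hcov : AECover volume atTop (fun n : ℕ => Ioc (-((n : ℝ) + 1)) ((n : ℝ) + 1)) := by
      refine aecover_Ioc ?_ ?_
      · exact tendsto_neg_atTop_atBot.comp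
          (tendsto_atTop_add_const_right _ _ tendsto_natCast_atTop_atTop)
      · exact tendsto_atTop_add_const_right _ _ tendsto_natCast_atTop_atTop
    refine hcov.aestronglyMeasurable fun n => ?_
    exact (hF.intervalIntegrable ((n : ℝ) + 1) (by positivity)).1.aestronglyMeasurable
  have hg : MemLp (fun t : ℝ => 2 * (|M| + |M'|) * (1 + |t|) ^ (α - 1)) 2 volume := by
    refine MemLp.const_mul ?_ _
    have hm : AEStronglyMeasurable (fun t : ℝ => (1 + |t|) ^ (α - 1)) volume :=
      Measurable.aestronglyMeasurable (by fun_prop)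
    rw [memLp_two_iff_integrable_sq hm]
    have := integrable_one_add_norm (E := ℝ) (μ := volume) (r := 2 - 2 * α)
      (by simp; linarith)
    refine this.congr (Eventually.of_forall fun t => ?_)
    have h0 : 0 ≤ 1 + |t| := by positivity
    simp only [Real.norm_eq_abs]
    rw [← Real.rpow_natCast, ← Real.rpow_mul h0]
    congr 1
    push_cast
    ring
  refine hg.mono' hmeas ?_
  filter_upwards [Measure.ae_ne volume 0] with t ht
  have h0 : 0 < 1 + |t| := by positivity
  have hr : 0 ≤ (1 + |t|) ^ (α - 1) := by positivity
  rcases le_total |t| 1 with h1 | h1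
  · have h2 : (1 : ℝ) ≤ 2 * (1 + |t|) ^ (α - 1) := by
      have e1 : (2 : ℝ) ^ (α - 1) ≤ (1 + |t|) ^ (α - 1) :=
        Real.rpow_le_rpow_of_nonpos h0 (by linarith) (by linarith)
      have e2 : (2 : ℝ) ^ (-1 : ℝ) ≤ 2 ^ (α - 1) :=
        Real.rpow_le_rpow_of_exponent_le one_le_two (by linarith)
      rw [Real.rpow_neg_one] at e2
      linarith
    calc ‖F t‖ ≤ M := hM t ht h1
      _ ≤ (|M| + |M'|) * 1 := by linarith [le_abs_self M, abs_nonneg M']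
      _ ≤ (|M| + |M'|) * (2 * (1 + |t|) ^ (α - 1)) := by gcongr
      _ = _ := by ring
  · have h2 : |t| ^ (α - 1) ≤ 2 * (1 + |t|) ^ (α - 1) := by
      have e1 : |t| ^ (α - 1) ≤ ((1 + |t|) / 2) ^ (α - 1) :=
        Real.rpow_le_rpow_of_nonpos (by positivity) (by linarith) (by linarith)
      have e2 : (2⁻¹ : ℝ) ^ (α - 1) ≤ 2 := by
        rw [Real.inv_rpow zero_le_two, ← Real.rpow_neg (zero_le_two (α := ℝ))]
        calc (2 : ℝ) ^ (-(α - 1)) ≤ 2 ^ (1 : ℝ) :=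
              Real.rpow_le_rpow_of_exponent_le one_le_two (by linarith)
          _ = 2 := Real.rpow_one 2
      rw [div_eq_inv_mul, Real.mul_rpow (by norm_num) h0.le] at e1
      exact e1.trans (mul_le_mul_of_nonneg_right e2 hr)
    calc ‖F t‖ ≤ M' * |t| ^ (α - 1) := hM' t h1
      _ ≤ (|M| + |M'|) * |t| ^ (α - 1) := by
        gcongr
        linarith [le_abs_self M', abs_nonneg M]
      _ ≤ (|M| + |M'|) * (2 * (1 + |t|) ^ (α - 1)) := by gcongr
      _ = _ := by ring

lemma continuous_truncatedInverseLaplace {F : ℂ → ℂ} {R : ℝ} (hR : 0 < R)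
    (hF : IntervalIntegrable (fun t : ℝ => F (t * Complex.I)) volume (-R) R) :
    Continuous (truncatedInverseLaplace F R) := by
  rw [funext (truncatedInverseLaplace_eq_fourier F hR)]
  refine VectorFourier.fourierIntegral_continuous Real.continuous_fourierChar
    (by exact continuous_inner) ?_
  refine Integrable.comp_mul_left' ?_ (neg_ne_zero.2 Real.two_pi_pos.ne')
  rw [integrable_indicator_iff measurableSet_Ioc]
  exact hF.1

lemma enorm_truncatedInverseLaplace_le (F : ℂ → ℂ) (R ξ : ℝ) :
    ‖truncatedInverseLaplace F R ξ‖ₑ ≤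
      ‖∫ t in (-R)..R, F (t * Complex.I) * Complex.exp (t * Complex.I * ξ)‖ₑ := by
  rw [truncatedInverseLaplace, intervalIntegral.integral_mul_const, mul_comm, mul_assoc, enorm_mul]
  refine mul_le_of_le_one_right' ?_
  rw [← ofReal_norm, ← ENNReal.ofReal_one]
  refine ENNReal.ofReal_le_ofReal ?_
  have : Complex.I * (1 / (2 * Real.pi * Complex.I)) = ((2 * Real.pi)⁻¹ : ℝ) := by
    have hpi : (Real.pi : ℂ) ≠ 0 := Complex.ofReal_ne_zero.2 Real.pi_ne_zero
    push_cast
    field_simp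
  rw [this, Complex.norm_real, Real.norm_of_nonneg (by positivity)]
  exact inv_le_one_of_one_le₀ (by linarith [Real.pi_gt_three])

/-- A bound for all truncated integrals passes to the inverse Laplace transform. -/
theorem HasWeightedTransform.integral_norm_le {F : ℂ → ℂ} {Q : ℝ → ℂ}
    (hF : HasWeightedTransform α σ N (fun t : ℝ => F (t * Complex.I))) (hN : 0 ≤ N)
    (hQ : IsInverseLaplace F Q) :
    IntegrableOn (fun ξ : ℝ => ‖Q ξ‖ / (1 + ξ) ^ σ) (Ioi 0) ∧
      ∫ ξ in Ioi (0 : ℝ), ‖Q ξ‖ / (1 + ξ) ^ σ ≤ N := by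
  obtain ⟨q, -, hq, hqN⟩ := hF.transform
  have hR : Tendsto (fun n : ℕ => (n : ℝ) + 1) atTop atTop :=
    tendsto_atTop_add_const_right _ _ tendsto_natCast_atTop_atTop
  have hR0 : ∀ n : ℕ, (0 : ℝ) < (n : ℝ) + 1 := fun n => by positivity
  -- L² convergence gives convergence in measure, hence almost everywhere along a subsequence; the
  -- majorant q holds for every truncation and so for the limit.
  have hmeasure : TendstoInMeasure volume
      (fun (n : ℕ) ξ => truncatedInverseLaplace F ((n : ℝ) + 1) ξ) atTop Q :=
    tendstoInMeasure_of_tendsto_eLpNorm two_ne_zero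
      (fun n => (continuous_truncatedInverseLaplace (hR0 n)
        (hF.intervalIntegrable _ (hR0 n))).aestronglyMeasurable) hQ.memLp.1 (hQ.tendsto.comp hR)
  obtain ⟨ns, -, hns⟩ := hmeasure.exists_seq_tendsto_ae
  have hle : ∀ᵐ ξ : ℝ, ‖Q ξ‖ₑ ≤ q ξ := by
    filter_upwards [hns, hq] with ξ h1 h2
    refine le_of_tendsto h1.enorm (Eventually.of_forall fun i => ?_)
    exact (enorm_truncatedInverseLaplace_le F _ ξ).trans (h2 _ (hR0 _))
  have hm : AEStronglyMeasurable (fun ξ : ℝ => ‖Q ξ‖ / (1 + ξ) ^ σ)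
      (volume.restrict (Ioi 0)) := by
    simp only [div_eq_mul_inv]
    exact hQ.memLp.1.restrict.norm.mul (Measurable.aestronglyMeasurable (by fun_prop))
  have hnn : 0 ≤ᵐ[volume.restrict (Ioi 0)] fun ξ : ℝ => ‖Q ξ‖ / (1 + ξ) ^ σ := by
    filter_upwards [ae_restrict_mem measurableSet_Ioi] with ξ hξ
    have : (0 : ℝ) ≤ 1 + ξ := by linarith [mem_Ioi.1 hξ]
    exact div_nonneg (norm_nonneg _) (Real.rpow_nonneg this _)
  have hbound : ∫⁻ ξ in Ioi (0 : ℝ), ENNReal.ofReal (‖Q ξ‖ / (1 + ξ) ^ σ) ≤ ENNReal.ofReal N := by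
    refine le_trans (lintegral_mono_ae ?_) hqN
    filter_upwards [ae_restrict_mem measurableSet_Ioi, ae_restrict_of_ae hle] with ξ hξ h
    have : (0 : ℝ) ≤ 1 + ξ := by linarith [mem_Ioi.1 hξ]
    rw [div_eq_mul_inv, ← Real.rpow_neg this, ENNReal.ofReal_mul (norm_nonneg _), ofReal_norm]
    gcongr
  refine ⟨⟨hm, ?_⟩, ?_⟩
  · rw [hasFiniteIntegral_iff_ofReal hnn]
    exact hbound.trans_lt ENNReal.ofReal_lt_top
  · rw [integral_eq_lintegral_of_nonneg_ae hnn hm]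
    exact ENNReal.toReal_le_of_le_ofReal hN hbound

end

/-- The boundary function of `H0` is bounded near the origin. -/
lemma IsRate.exists_norm_kernelTransform_le {ε α c C κ q : ℝ} {b : ℂ → ℂ}
    (hb : IsRate α C c ε b) (hα : 0 < α) (hα2 : α < 1 / 2) (hC : 1 ≤ C) (hc : 0 < c) (hε : 0 < ε)
    (hε1 : ε ≤ 1) (hκ : -1 < κ) : ∃ M : ℝ, ∀ t : ℝ, t ≠ 0 → |t| ≤ 1 →
      ‖kernelTransform κ (fun t => phase b (t * Complex.I)) (fun t => t * Complex.I * 1) q t‖ ≤ M ∧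
      ‖kernelTransform κ (fun t => phase b (t * Complex.I))
        (fun t => t * Complex.I * b (t * Complex.I)) (q + 1 : ℝ) t‖ ≤ M := by
  have hφ := hb.isPhase hα hα2 (by linarith) hc hε hε1
  have hβ := (hb.isSymbol hα (by linarith) hC hε hε1).1
  have h1 : ∀ t : ℝ, t ≠ 0 → |t| ≤ 1 → ‖(t : ℂ) * Complex.I * 1‖ ≤ 40 * C := by
    intro t _ ht1
    simp only [mul_one, norm_mul, Complex.norm_I, Complex.norm_real, Real.norm_eq_abs]
    linarith
  have h2 : ∀ t : ℝ, t ≠ 0 → |t| ≤ 1 → ‖(t : ℂ) * Complex.I * b (t * Complex.I)‖ ≤ 40 * C := by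
    intro t ht ht1
    have ht0 : 0 < |t| := abs_pos.2 ht
    have h3 := hβ.small t ht ht1
    rw [pow_one] at h3
    simp only [norm_mul, Complex.norm_I, Complex.norm_real, Real.norm_eq_abs, mul_one]
    -- The factor x in the amplitude x b(x) cancels the singularity of b, since α < 1.
    have h4 : |t| * |t| ^ (-α) ≤ 1 := by
      rw [mul_comm, ← Real.rpow_add_one ht0.ne']
      exact Real.rpow_le_one ht0.le ht1 (by linarith)
    calc |t| * ‖b (t * Complex.I)‖ ≤ |t| * (40 * C * (ε * |t| ^ (-α))) := by gcongr
      _ = 40 * C * (ε * (|t| * |t| ^ (-α))) := by ring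
      _ ≤ 40 * C * (1 * 1) := by gcongr
      _ = _ := by ring
  refine ⟨_, fun t ht ht1 => ⟨norm_kernelTransform_le hκ fun s hs =>
    hφ.norm_kernelFun_le hε hc h1 hs ht ht1, norm_kernelTransform_le hκ fun s hs =>
    hφ.norm_kernelFun_le hε hc h2 hs ht ht1⟩⟩

end SelfSim

end

/-! ### The theorem. -/

theorem proposition8p1 (α θ : ℝ) (hα : 0 < α) (hαθ : α < θ) (hθ : θ < 1 / 2) :
    ∃ ν : ℝ, 0 < ν ∧
      ∀ (W : ℝ → ℝ → ℝ) (w : ℂ → ℂ), SelfSim.IsAdmissibleKernel α W w →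
        ∃ ε₀ : ℝ, 0 < ε₀ ∧ ∃ C : ℝ, 0 < C ∧
          ∀ ε : ℝ, 0 < ε → ε < ε₀ →
          ∀ f : ℝ → ℝ, SelfSim.IsNormalizedProfile ε W f →
          ∀ p : ℝ, 0 < p →
            (∃ Q : ℝ → ℂ,
              SelfSim.IsInverseLaplace (SelfSim.H0 ε w (SelfSim.muOf f) p) Q) ∧
            ∀ Q₀ : ℝ → ℂ,
              SelfSim.IsInverseLaplace (SelfSim.H0 ε w (SelfSim.muOf f) p) Q₀ →
                IntegrableOn (fun ξ : ℝ => ‖Q₀ ξ‖ / (1 + ξ) ^ (2 * θ - ν)) (Ioi 0) ∧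
                ∫ ξ in Ioi (0 : ℝ), ‖Q₀ ξ‖ / (1 + ξ) ^ (2 * θ - ν)
                  ≤ C * ((1 + p) ^ (1 - θ) / p ^ 3) := by
  -- The loss ν is the η of `exists_hasWeightedTransform_H0`.
  refine ⟨(θ - α) / 2, by linarith, fun W w hK => ?_⟩
  obtain ⟨C, c, hC, hc, hrate⟩ := hK.exists_isRate hα (by linarith)
  obtain ⟨K, hK0, hH⟩ := SelfSim.exists_hasWeightedTransform_H0 hα hαθ hθ hC hc
  -- The threshold is that of the mass and negative-moment bounds and is the same for every kernel;
  -- K + 1 replaces K only to be positive.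
  refine ⟨1 / 10 ^ 7, by norm_num, K + 1, by linarith, fun ε hε hε0 f hf p hp => ?_⟩
  have hε1 : ε ≤ 1 := hε0.le.trans (by norm_num)
  obtain ⟨hb, hκ, hκ0⟩ := hrate ε hε hε0.le f hf
  have hV : 0 ≤ (1 + p) ^ (1 - θ) / p ^ 3 := by positivity
  have hF : SelfSim.HasWeightedTransform α (2 * θ - (θ - α) / 2)
      (K * ((1 + p) ^ (1 - θ) / p ^ 3))
      (fun t : ℝ => SelfSim.H0 ε w (SelfSim.muOf f) p (t * Complex.I)) :=
    (hH ε _ p _ hε hε1 hb hκ hκ0 hp).congr fun t ht =>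
      (SelfSim.H0_mul_I_eq hb hα (by linarith) (by linarith) hε hp ht).symm
  obtain ⟨M, hM⟩ := hb.exists_norm_kernelTransform_le (q := p) hα (by linarith) hC hc hε hε1
    (show -1 < SelfSim.kappa (SelfSim.muOf f) by linarith)
  refine ⟨SelfSim.exists_isInverseLaplace (hF.memLp hα (by linarith)
    (M := ‖((2 + SelfSim.kappa (SelfSim.muOf f)) / p : ℂ)‖ * M + ‖(1 / p : ℂ)‖ * M)
    fun t ht ht1 => ?_), fun Q₀ hQ => ?_⟩
  · rw [SelfSim.H0_mul_I_eq hb hα (by linarith) (by linarith) hε hp ht]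
    refine (norm_add_le _ _).trans ?_
    rw [norm_mul, norm_mul]
    have h1 := (hM t ht ht1).1
    have h2 := (hM t ht ht1).2
    gcongr
  · obtain ⟨h1, h2⟩ := hF.integral_norm_le (by positivity) hQ
    exact ⟨h1, h2.trans (by gcongr; linarith)⟩
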